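/- For an invertible matrix $A\in\mathbb{R}^{d\times d}$ and $x\in\mathbb{R}^d\setminus\{0\}$ let $f_A(x)=Ax/\|Ax\|_2$. Model of computation: a program is a fixed finite structured program (assignments, sequencing, if, while) on arrays of rational numbers, with the operations $+,-,\times,\div$, rounding to the nearest integer, comparison, and array access. Each operation, literal, array access, test and assignment counts as one operation. The bit length of a rational number is the number of binary digits of its numerator plus that of its denominator, in lowest terms. Theorem (Matrix Rounding). There are a (deterministic) program and a constant $C\in\mathbb{N}$ with the following property. Let $d,n,b,r$ be non-negative integers and let (i) $X=(x_1,\dots,x_n)$ be points of $\{-2^b,\dots,2^b\}^d\setminus\{\mathbf 0\}$ that span $\mathbb{R}^d$, (ii) $A\in\{-2^{rb},\dots,2^{rb}\}^{d\times d}$ be an integer matrix of full rank $d$, (iii) $\epsilon\in(0,1)$ be a rational number. The program is given $d$, $n$, $X$, $A$, $\epsilon$ and an arbitrary integer $B$ with $2^{b}/2\le B\le 2^b$ (an estimate of the range of the coordinates; the numbers $b$ and $r$ themselves are not given). It halts and outputs an integer matrix $A'$ of full rank $d$ such that $$|A'_{ij}|\le \left(\frac d\epsilon\right)^{C d^3 b}\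 \text{ for all } i,j,\qquad \|f_A(x)-f_{A'}(x)\|_2\le\epsilon\ \text{ for all } x\in X .$$ It performs at most $C(d+n+r+1)^C$ operations, and all numbers that occur have bit length at most $$\ell(\epsilon)+C\,(d+n+r+b+\lceil\log_2(1/\epsilon)\rceil+1)^C,$$ where $\ell(\epsilon)$ is the bit length of the input number $\epsilon$. -/

import Mathlib

open scoped Matrix

namespace RatProg

/-! ### Programs over the rationals

A program works on countably many two-dimensional arrays of rational numbers and uses the four
arithmetic operations, rounding to the nearest integer, comparisons, array access, and structured
control flow.  Every operation, literal, array access, test and assignment costs one unit, and the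
bit length of every number that is produced or read is recorded. -/

/-- Contents of the memory: `s a i j` is the entry `(i, j)` of the array number `a`. -/
abbrev Store : Type := ℕ → ℕ → ℕ → ℚ

/-- The store obtained from `s` by writing `v` in the entry `(i, j)` of the array `a`. -/
def Store.write (s : Store) (a i j : ℕ) (v : ℚ) : Store :=
  fun a' i' j' => if a' = a ∧ i' = i ∧ j' = j then v else s a' i' j'

/-- Bit length of a rational number: the number of binary digits of the numerator and of the
denominator in lowest terms. -/
def bitLength (q : ℚ) : ℕ := Nat.size q.num.natAbs + Nat.size q.den

/-- Arithmetic expressions. -/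
inductive Expr : Type
  | lit (z : ℤ)
  | read (a : ℕ) (i j : Expr)
  | add (e f : Expr)
  | sub (e f : Expr)
  | mul (e f : Expr)
  | div (e f : Expr)
  | rnd (e : Expr)

namespace Expr

/-- The value of an expression.  In an array access the index expressions are evaluated first, and
the value of an index is rounded down to a natural number.  Division by zero gives zero. -/
def eval (s : Store) : Expr → ℚ
  | lit z => (z : ℚ)
  | read a i j => s a ⌊eval s i⌋₊ ⌊eval s j⌋₊
  | add e f => eval s e + eval s f
  | sub e f => eval s e - eval s f
  | mul e f => eval s e * eval s f
  | div e f => eval s e / eval s f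
  | rnd e => ((round (eval s e) : ℤ) : ℚ)

/-- The number of unit operations used to evaluate an expression. -/
def cost : Expr → ℕ
  | lit _ => 1
  | read _ i j => cost i + cost j + 1
  | add e f => cost e + cost f + 1
  | sub e f => cost e + cost f + 1
  | mul e f => cost e + cost f + 1
  | div e f => cost e + cost f + 1
  | rnd e => cost e + 1

/-- All numbers that occur in the evaluation of the expression, intermediate results included, have
bit length at most `W`. -/
def Fits (W : ℕ) (s : Store) : Expr → Prop
  | lit z => bitLength (z : ℚ) ≤ W
  | read a i j => Fits W s i ∧ Fits W s j ∧ bitLength (eval s (read a i j)) ≤ W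
  | add e f => Fits W s e ∧ Fits W s f ∧ bitLength (eval s (add e f)) ≤ W
  | sub e f => Fits W s e ∧ Fits W s f ∧ bitLength (eval s (sub e f)) ≤ W
  | mul e f => Fits W s e ∧ Fits W s f ∧ bitLength (eval s (mul e f)) ≤ W
  | div e f => Fits W s e ∧ Fits W s f ∧ bitLength (eval s (div e f)) ≤ W
  | rnd e => Fits W s e ∧ bitLength (eval s (rnd e)) ≤ W

end Expr

/-- Programs: `assign a i j e` writes the value of `e` in the entry `(i, j)` of the array `a`,
`ite e f p q` runs `p` if `e ≤ f` and `q` otherwise, and `loop e f p` repeats `p` as long as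
`e ≤ f`. -/
inductive Prog : Type
  | skip
  | assign (a : ℕ) (i j e : Expr)
  | seq (p q : Prog)
  | ite (e f : Expr) (p q : Prog)
  | loop (e f : Expr) (p : Prog)

open RatProg.Expr in
/-- `Exec W p s t s'`: started in the store `s`, the program `p` halts in the store `s'` after
exactly `t` unit operations, and all numbers that occur on the way have bit length at most `W`. -/
inductive Exec (W : ℕ) : Prog → Store → ℕ → Store → Prop
  | skip (s : Store) : Exec W Prog.skip s 1 s
  | assign (a : ℕ) (i j e : Expr) (s : Store)
      (hi : Fits W s i) (hj : Fits W s j) (he : Fits W s e) :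
      Exec W (Prog.assign a i j e) s (cost i + cost j + cost e + 1)
        (s.write a ⌊eval s i⌋₊ ⌊eval s j⌋₊ (eval s e))
  | seq (p q : Prog) (s s' s'' : Store) (t t' : ℕ)
      (hp : Exec W p s t s') (hq : Exec W q s' t' s'') :
      Exec W (Prog.seq p q) s (t + t') s''
  | ite_pos (e f : Expr) (p q : Prog) (s s' : Store) (t : ℕ)
      (he : Fits W s e) (hf : Fits W s f) (h : eval s e ≤ eval s f) (hp : Exec W p s t s') :
      Exec W (Prog.ite e f p q) s (cost e + cost f + 1 + t) s'
  | ite_neg (e f : Expr) (p q : Prog) (s s' : Store) (t : ℕ)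
      (he : Fits W s e) (hf : Fits W s f) (h : ¬ eval s e ≤ eval s f) (hq : Exec W q s t s') :
      Exec W (Prog.ite e f p q) s (cost e + cost f + 1 + t) s'
  | loop_stop (e f : Expr) (p : Prog) (s : Store)
      (he : Fits W s e) (hf : Fits W s f) (h : ¬ eval s e ≤ eval s f) :
      Exec W (Prog.loop e f p) s (cost e + cost f + 1) s
  | loop_step (e f : Expr) (p : Prog) (s s' s'' : Store) (t t' : ℕ)
      (he : Fits W s e) (hf : Fits W s f) (h : eval s e ≤ eval s f)
      (hp : Exec W p s t s') (hl : Exec W (Prog.loop e f p) s' t' s'') :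
      Exec W (Prog.loop e f p) s (cost e + cost f + 1 + t + t') s''

/-- The initial store: array `0` holds `d`, `n`, the range estimate `B` and the accuracy `ε` in its
entries `(0, 0)`, `(0, 1)`, `(0, 2)`, `(0, 3)`; array `1` holds the points, one in each row;
array `2` holds the matrix; everything else is zero. -/
def inputStore {d n : ℕ} (B : ℕ) (x : Fin n → Fin d → ℤ) (A : Matrix (Fin d) (Fin d) ℤ) (ε : ℚ) :
    Store
  | 0, 0, 0 => (d : ℚ)
  | 0, 0, 1 => (n : ℚ)
  | 0, 0, 2 => (B : ℚ)
  | 0, 0, 3 => ε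
  | 1, k, i => if h : k < n ∧ i < d then ((x ⟨k, h.1⟩ ⟨i, h.2⟩ : ℤ) : ℚ) else 0
  | 2, i, j => if h : i < d ∧ j < d then ((A ⟨i, h.1⟩ ⟨j, h.2⟩ : ℤ) : ℚ) else 0
  | _, _, _ => 0

/-- The matrix `A'` is the `d × d` upper left block of the array `3` of the store. -/
def HasOutput {d : ℕ} (s : Store) (A' : Matrix (Fin d) (Fin d) ℤ) : Prop :=
  ∀ i j : Fin d, s 3 i j = ((A' i j : ℤ) : ℚ)

end RatProg

/-- The integer vector `v` as a point of Euclidean space. -/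
def intPoint {d : ℕ} (v : Fin d → ℤ) : EuclideanSpace ℝ (Fin d) :=
  WithLp.toLp 2 (fun i => (v i : ℝ))

/-- The integer matrix `A` as a real matrix. -/
def intMatrix {d : ℕ} (A : Matrix (Fin d) (Fin d) ℤ) : Matrix (Fin d) (Fin d) ℝ :=
  A.map (fun z : ℤ => (z : ℝ))

/-- The map `f_A`, which sends `x` to `A x / ‖A x‖₂`. -/
noncomputable def radialMap {d : ℕ} (A : Matrix (Fin d) (Fin d) ℝ)
    (x : EuclideanSpace ℝ (Fin d)) : EuclideanSpace ℝ (Fin d) :=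
  ‖(WithLp.toLp 2 (A *ᵥ x.ofLp) : EuclideanSpace ℝ (Fin d))‖⁻¹ •
    (WithLp.toLp 2 (A *ᵥ x.ofLp) : EuclideanSpace ℝ (Fin d))

/-!
The program rests on a change of the lengths of the columns of `A` in a suitable basis, which keeps
the directions of all images `A x` up to a small error and leaves a matrix with few digits.

*The basis.*  Among the bases consisting of points of `X`, take one of least weight, where the weight
of `x` is the `ℓ¹` norm of `A x`.  Then every point `x = ∑ c_i y_i` of `X` involves only basis
vectors whose weights do not exceed its own (`IsGreedy.exists_basis`), and by Cramer's rule the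
coefficients are bounded by a determinant, say by `Δ`.  The basis is found by one pass over the
points: a new point replaces the heaviest basis vector that it involves, provided that it is lighter
(`IsGreedy.exchange`).  The pass starts with the standard basis, whose vectors are regarded as
heavier than all points, and carries along the inverse `W` of the basis matrix `Y`.  By Cramer's
rule again, the entries of `W` have few digits at every moment (`bits_inverse_le`), although they
are updated by rational operations.

*The lengths.*  Let `a_i = A y_i`, in the order of increasing weights `w_i`.  Replace `a_i` by
`t_i a_i`, where the factors `t_i > 0` are chosen such that each ratio of consecutive scaled weights
is the old ratio or `G`, whichever is less (`GapState.succ`).  If `p` is the heaviest index in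
`x = ∑ c_i y_i`, then `∑ c_i t_i a_i` differs from `t_p A x` only by the terms with `t_i ≠ t_p`; the
scaled weights of these are below that of `a_p`, and hence below that of `A x`, by the factor `G`.
So the directions agree up to a multiple of `Δ / G`, and the scaled weights lie between `1` and
`G ^ d`.

*The rounding.*  Now each column is rounded: `2 round (G t_i a_i) + e_i` is `2 G t_i a_i` up to an
error that is again smaller by the factor `G`, and the matrix `M` with these columns is congruent to
the identity modulo `2`, so it is invertible (`det_two_mul_add_one_ne_zero`).  The output is
`M` times the adjugate of `Y`, with a sign: an integer matrix that is a positive multiple of `M W`.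
The error is estimated in `sum_abs_roundedMatrix_sub_le`.

If `d ≤ 1`, or if all entries of `A` are in `{-1, 0, 1}`, the required bound may leave no room for
this construction; then the output is the sign of `A`, or `A` itself.  In all other cases `d ≥ 2`
and `b ≥ 1`, and the powers of `2` and of `d` in the estimates are absorbed by powers of `d / ε`
(`entry_bound`).

*The program.*  The relation `Runs K p s T Q` combines termination within `T` operations, a
postcondition `Q`, and the bound `K` for the size of all stored numbers.  An expression of bounded
length enlarges the number of digits at most by a constant factor (`fits_of_bdd`), so only the sizes
of the numbers that are stored have to be estimated.  The memory is used as follows, where an array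
with one entry is called a variable.

* arrays `0`, `1`, `2`, `3`: the parameters, the points, the matrix and the output;
* variables `4`, `25`, `26`: the integer that replaces `ε⁻¹`, the number `G`, and a power that enters
  its computation; variable `5`: whether `A` has an entry outside `{-1, 0, 1}`;
* arrays `6`, `7` and variable `8`: the images of the points, their weights, and the weight assigned
  to the standard basis; variable `27`: the partial sums of a weight;
* arrays `9`, `10`, `11` and variable `12`: the inverse of the basis matrix, the weights and the
  indices of the basis vectors, and the absolute value of the determinant;
* arrays `13`, `16`: the coordinates of the current point, and the pivot row divided by the pivot;
  variables `14`, `15`: the weight and the index of the basis vector that is selected by a search;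
* array `17` and variables `18`, `19`: the factors `t_i`, and the weight and the scaled weight of the
  last index treated; array `20`: the matrix `M`;
* variables `21`, `22`, `23`, `24`: loop counters, and the partial sums of an inner product.
-/

namespace RatProg

/-! ### Bit lengths -/

/-- The larger of the numbers of binary digits of the numerator and the denominator.  Unlike
`bitLength` it grows only additively under the four operations. -/
def bits (q : ℚ) : ℕ := max (Nat.size q.num.natAbs) (Nat.size q.den)

theorem bits_le_iff {q : ℚ} {K : ℕ} : bits q ≤ K ↔ q.num.natAbs < 2 ^ K ∧ q.den < 2 ^ K := by
  simp [bits, Nat.size_le]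

theorem bitLength_le_two_mul_bits (q : ℚ) : bitLength q ≤ 2 * bits q := by
  have h1 := le_max_left (Nat.size q.num.natAbs) (Nat.size q.den)
  have h2 := le_max_right (Nat.size q.num.natAbs) (Nat.size q.den)
  unfold bitLength bits
  omega

theorem bits_le_of_mul_eq {q : ℚ} {p m : ℤ} {K : ℕ} (hm : m ≠ 0) (h : q * m = p)
    (hp : p.natAbs < 2 ^ K) (hmK : m.natAbs < 2 ^ K) : bits q ≤ K := by
  have hm' : (m : ℚ) ≠ 0 := by exact_mod_cast hm
  have hq : q = Rat.divInt p m := by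
    rw [Rat.divInt_eq_div, ← h]; field_simp
  rw [bits_le_iff]
  constructor
  · rcases eq_or_ne p 0 with rfl | hp0
    · rw [hq]; simp
    · refine lt_of_le_of_lt ?_ hp
      rw [hq]
      exact Nat.le_of_dvd (Int.natAbs_pos.2 hp0) (Int.natAbs_dvd_natAbs.2 (Rat.num_dvd p hm))
  · refine lt_of_le_of_lt ?_ hmK
    rw [hq]
    have := Rat.den_dvd p m
    exact Nat.le_of_dvd (Int.natAbs_pos.2 hm) (Int.natCast_dvd.1 this)

theorem one_le_bits (q : ℚ) : 1 ≤ bits q := by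
  have h : 0 < Nat.size q.den := Nat.size_pos.2 q.pos
  exact le_trans h (le_max_right _ _)

theorem bits_spec (q : ℚ) : q.num.natAbs < 2 ^ bits q ∧ q.den < 2 ^ bits q :=
  bits_le_iff.1 le_rfl

theorem bits_intCast_le {z : ℤ} {K : ℕ} (hK : 1 ≤ K) (h : z.natAbs < 2 ^ K) :
    bits (z : ℚ) ≤ K := by
  refine bits_le_of_mul_eq (p := z) (m := 1) one_ne_zero (by simp) h ?_
  exact Nat.one_lt_two_pow (by omega)

theorem bits_natCast_le {z : ℕ} {K : ℕ} (hK : 1 ≤ K) (h : z < 2 ^ K) : bits (z : ℚ) ≤ K := by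
  have := bits_intCast_le (z := z) hK (by simpa using h)
  simpa using this

theorem bits_zero : bits 0 = 1 := by simp [bits]

theorem bits_one : bits 1 = 1 := by simp [bits]

theorem bits_mul_le (p q : ℚ) : bits (p * q) ≤ bits p + bits q := by
  obtain ⟨h1, h2⟩ := bits_spec p
  obtain ⟨h3, h4⟩ := bits_spec q
  have hp : p * p.den = p.num := Rat.mul_den_eq_num p
  have hq : q * q.den = q.num := Rat.mul_den_eq_num q
  refine bits_le_of_mul_eq (p := p.num * q.num) (m := p.den * q.den) ?_ ?_ ?_ ?_
  · have := p.pos; have := q.pos; positivity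
  · push_cast; rw [← hp, ← hq]; ring
  · rw [Int.natAbs_mul, pow_add]; exact Nat.mul_lt_mul'' h1 h3
  · rw [Int.natAbs_mul, pow_add]; exact Nat.mul_lt_mul'' h2 h4

theorem bits_inv_le (q : ℚ) : bits q⁻¹ ≤ bits q := by
  rcases eq_or_ne q 0 with rfl | h0
  · simp
  · obtain ⟨h1, h2⟩ := bits_spec q
    have hq : q * q.den = q.num := Rat.mul_den_eq_num q
    refine bits_le_of_mul_eq (p := q.den) (m := q.num) ?_ ?_ ?_ h1
    · exact Rat.num_ne_zero.2 h0
    · rw [← hq]; push_cast; field_simp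
    · simpa using h2

theorem bits_div_le (p q : ℚ) : bits (p / q) ≤ bits p + bits q := by
  rw [div_eq_mul_inv]
  exact (bits_mul_le _ _).trans (Nat.add_le_add_left (bits_inv_le q) _)

theorem bits_neg (q : ℚ) : bits (-q) = bits q := by simp [bits]

theorem bits_abs (q : ℚ) : bits |q| = bits q := by
  rcases abs_choice q with h | h <;> rw [h]
  exact bits_neg q

theorem bits_add_le (p q : ℚ) : bits (p + q) ≤ bits p + bits q + 1 := by
  obtain ⟨h1, h2⟩ := bits_spec p
  obtain ⟨h3, h4⟩ := bits_spec q
  have hp : p * p.den = p.num := Rat.mul_den_eq_num p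
  have hq : q * q.den = q.num := Rat.mul_den_eq_num q
  refine bits_le_of_mul_eq (p := p.num * q.den + q.num * p.den) (m := p.den * q.den) ?_ ?_ ?_ ?_
  · have := p.pos; have := q.pos; positivity
  · push_cast; rw [← hp, ← hq]; ring
  · refine lt_of_le_of_lt (Int.natAbs_add_le _ _) ?_
    rw [Int.natAbs_mul, Int.natAbs_mul, pow_succ, pow_add]
    have h5 := Nat.mul_lt_mul'' h1 h4
    have h6 := Nat.mul_lt_mul'' h3 h2
    simp only [Int.natAbs_natCast]
    nlinarith
  · rw [Int.natAbs_mul, pow_succ, pow_add]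
    have h5 := Nat.mul_lt_mul'' h2 h4
    simp only [Int.natAbs_natCast]
    omega

theorem bits_sub_le (p q : ℚ) : bits (p - q) ≤ bits p + bits q + 1 := by
  have := bits_add_le p (-q)
  rwa [bits_neg, ← sub_eq_add_neg] at this

theorem abs_round_le_abs_num (q : ℚ) : (round q).natAbs ≤ q.num.natAbs := by
  have h1 : |(round q : ℚ)| ≤ |q| + 1 / 2 := by
    have h := abs_sub_round q
    have h2 := abs_sub_abs_le_abs_sub (round q : ℚ) q
    rw [abs_sub_comm] at h2
    linarith
  have h2 : |q| ≤ |(q.num : ℚ)| := by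
    rw [← Rat.mul_den_eq_num q, abs_mul]
    have : (1 : ℚ) ≤ |(q.den : ℚ)| := by
      rw [Nat.abs_cast]; exact_mod_cast q.pos
    exact le_mul_of_one_le_right (abs_nonneg _) this
  have h3 : ((round q).natAbs : ℚ) < (q.num.natAbs : ℚ) + 1 := by
    rw [Nat.cast_natAbs, Nat.cast_natAbs]
    push_cast
    linarith
  have h4 : (round q).natAbs < q.num.natAbs + 1 := by exact_mod_cast h3
  omega

theorem bits_round_le (q : ℚ) : bits ((round q : ℤ) : ℚ) ≤ bits q :=
  bits_intCast_le (one_le_bits q) ((abs_round_le_abs_num q).trans_lt (bits_spec q).1)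

theorem bits_sum_le (f : ℕ → ℚ) {L : ℕ} (m : ℕ) (hf : ∀ j < m, bits (f j) ≤ L) :
    bits (∑ j ∈ Finset.range m, f j) ≤ m * (L + 1) + 1 := by
  induction m with
  | zero => simp [bits_zero]
  | succ m ih =>
    rw [Finset.sum_range_succ]
    have h1 := bits_add_le (∑ j ∈ Finset.range m, f j) (f m)
    have h2 := ih fun j hj => hf j (by omega)
    have h3 := hf m (by omega)
    nlinarith

/-! ### Running programs within bounds -/

namespace Expr

/-- The factor by which the bit length of the numbers in the evaluation of an expression may exceed
the bit length of the numbers in the store. -/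
def weight : Expr → ℕ
  | lit z => z.natAbs + 1
  | read _ i j => weight i + weight j + 1
  | add e f => weight e + weight f + 1
  | sub e f => weight e + weight f + 1
  | mul e f => weight e + weight f + 1
  | div e f => weight e + weight f + 1
  | rnd e => weight e + 1

end Expr

/-- All entries of the store have at most `K` bits. -/
def Bdd (K : ℕ) (s : Store) : Prop := ∀ a i j, bits (s a i j) ≤ K

open RatProg.Expr in
theorem bits_eval_le {K : ℕ} {s : Store} (hs : Bdd K s) (e : Expr) :
    bits (eval s e) ≤ weight e * K := by
  have hK : 1 ≤ K := (one_le_bits _).trans (hs 0 0 0)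
  induction e with
  | lit z =>
    refine (bits_intCast_le (K := z.natAbs + 1) (by omega) ?_).trans
      (Nat.le_mul_of_pos_right _ hK)
    exact (Nat.lt_two_pow_self (n := z.natAbs)).trans (Nat.pow_lt_pow_right (by norm_num) (by omega))
  | read a i j hi hj =>
    simp only [eval, weight]
    nlinarith [hs a ⌊eval s i⌋₊ ⌊eval s j⌋₊]
  | add e f he hf => simp only [eval, weight]; nlinarith [bits_add_le (eval s e) (eval s f)]
  | sub e f he hf => simp only [eval, weight]; nlinarith [bits_sub_le (eval s e) (eval s f)]
  | mul e f he hf => simp only [eval, weight]; nlinarith [bits_mul_le (eval s e) (eval s f)]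
  | div e f he hf => simp only [eval, weight]; nlinarith [bits_div_le (eval s e) (eval s f)]
  | rnd e he => simp only [eval, weight]; nlinarith [bits_round_le (eval s e)]

open RatProg.Expr in
theorem Expr.Fits.mono {W W' : ℕ} (h : W ≤ W') {s : Store} {e : Expr} (he : Fits W s e) :
    Fits W' s e := by
  induction e with
  | lit z => exact le_trans he h
  | read a i j hi hj => exact ⟨hi he.1, hj he.2.1, he.2.2.trans h⟩
  | add e f h1 h2 => exact ⟨h1 he.1, h2 he.2.1, he.2.2.trans h⟩
  | sub e f h1 h2 => exact ⟨h1 he.1, h2 he.2.1, he.2.2.trans h⟩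
  | mul e f h1 h2 => exact ⟨h1 he.1, h2 he.2.1, he.2.2.trans h⟩
  | div e f h1 h2 => exact ⟨h1 he.1, h2 he.2.1, he.2.2.trans h⟩
  | rnd e h1 => exact ⟨h1 he.1, he.2.trans h⟩

theorem Exec.mono {W W' : ℕ} (h : W ≤ W') {p : Prog} {s s' : Store} {t : ℕ}
    (hp : Exec W p s t s') : Exec W' p s t s' := by
  induction hp with
  | skip s => exact .skip s
  | assign a i j e s hi hj he => exact .assign a i j e s (hi.mono h) (hj.mono h) (he.mono h)
  | seq p q s s' s'' t t' _ _ h1 h2 => exact .seq _ _ _ _ _ _ _ h1 h2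
  | ite_pos e f p q s s' t he hf hle _ h1 =>
    exact .ite_pos _ _ _ _ _ _ _ (he.mono h) (hf.mono h) hle h1
  | ite_neg e f p q s s' t he hf hle _ h1 =>
    exact .ite_neg _ _ _ _ _ _ _ (he.mono h) (hf.mono h) hle h1
  | loop_stop e f p s he hf hle =>
    exact Exec.loop_stop _ _ _ _ (he.mono h) (hf.mono h) hle
  | loop_step e f p s s' s'' t t' he hf hle _ _ h1 h2 =>
    exact .loop_step _ _ _ _ _ _ _ _ (he.mono h) (hf.mono h) hle h1 h2

open RatProg.Expr in
theorem fits_of_bdd {K : ℕ} {s : Store} (hs : Bdd K s) (e : Expr) :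
    Fits (2 * (weight e * K)) s e := by
  have key (e : Expr) : bitLength (eval s e) ≤ 2 * (weight e * K) :=
    (bitLength_le_two_mul_bits _).trans (Nat.mul_le_mul_left 2 (bits_eval_le hs e))
  induction e with
  | lit z => exact key (lit z)
  | read a i j hi hj =>
    exact ⟨hi.mono (by simp only [weight]; nlinarith), hj.mono (by simp only [weight]; nlinarith),
      key (read a i j)⟩
  | add e f hi hj =>
    exact ⟨hi.mono (by simp only [weight]; nlinarith), hj.mono (by simp only [weight]; nlinarith),
      key (add e f)⟩
  | sub e f hi hj =>
    exact ⟨hi.mono (by simp only [weight]; nlinarith), hj.mono (by simp only [weight]; nlinarith),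
      key (sub e f)⟩
  | mul e f hi hj =>
    exact ⟨hi.mono (by simp only [weight]; nlinarith), hj.mono (by simp only [weight]; nlinarith),
      key (mul e f)⟩
  | div e f hi hj =>
    exact ⟨hi.mono (by simp only [weight]; nlinarith), hj.mono (by simp only [weight]; nlinarith),
      key (div e f)⟩
  | rnd e hi => exact ⟨hi.mono (by simp only [weight]; nlinarith), key (rnd e)⟩

/-- Started in the store `s`, whose entries have at most `K` bits, the program `p` halts after at
most `T` unit operations in a store that satisfies `Q` and whose entries have again at most `K`
bits.  Intermediate results of evaluations may have up to `200 * K` digits. -/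
def Runs (K : ℕ) (p : Prog) (s : Store) (T : ℕ) (Q : Store → Prop) : Prop :=
  Bdd K s → ∃ t s', t ≤ T ∧ Exec (200 * K) p s t s' ∧ Bdd K s' ∧ Q s'

namespace Store

theorem write_apply (s : Store) (a i j a' i' j' : ℕ) (v : ℚ) :
    s.write a i j v a' i' j' = if a' = a ∧ i' = i ∧ j' = j then v else s a' i' j' := rfl

theorem write_ne (s : Store) {a a' : ℕ} (h : a' ≠ a) (i j : ℕ) (v : ℚ) :
    s.write a i j v a' = s a' := by
  funext i' j'
  simp [write_apply, h]

theorem write_self (s : Store) (a i j : ℕ) (v : ℚ) : s.write a i j v a i j = v := by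
  simp [write_apply]

theorem write_same (s : Store) (a i j i' j' : ℕ) (v : ℚ) :
    s.write a i j v a i' j' = if i' = i ∧ j' = j then v else s a i' j' := by
  simp [write_apply]

end Store

theorem Bdd.write {K : ℕ} {s : Store} (hs : Bdd K s) (a i j : ℕ) {v : ℚ} (hv : bits v ≤ K) :
    Bdd K (s.write a i j v) := by
  intro a' i' j'
  rw [Store.write_apply]
  split_ifs
  · exact hv
  · exact hs _ _ _

namespace Runs

open RatProg.Expr

variable {K : ℕ} {s : Store} {Q R : Store → Prop} {T T' : ℕ} {p q : Prog}

theorem skip (h : Q s) : Runs K Prog.skip s 1 Q :=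
  fun hs => ⟨1, s, le_rfl, .skip s, hs, h⟩

theorem conseq (h : Runs K p s T Q) (hT : T ≤ T') (hQ : ∀ s', Q s' → R s') : Runs K p s T' R := by
  intro hs
  obtain ⟨t, s', h1, h2, h3, h4⟩ := h hs
  exact ⟨t, s', h1.trans hT, h2, h3, hQ _ h4⟩

theorem seq (h : Runs K p s T R) (h' : ∀ s', R s' → Runs K q s' T' Q) :
    Runs K (Prog.seq p q) s (T + T') Q := by
  intro hs
  obtain ⟨t, s', h1, h2, h3, h4⟩ := h hs
  obtain ⟨t', s'', h1', h2', h3', h4'⟩ := h' s' h4 h3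
  exact ⟨t + t', s'', by omega, .seq _ _ _ _ _ _ _ h2 h2', h3', h4'⟩

theorem assign {a i' j' : ℕ} {i j e : Expr} {v : ℚ} (hi : eval s i = i') (hj : eval s j = j')
    (he : eval s e = v) (hv : Bdd K s → bits v ≤ K) (hQ : Q (s.write a i' j' v))
    (hw : weight i + weight j + weight e ≤ 100 := by decide)
    (hc : cost i + cost j + cost e + 1 ≤ 50 := by decide) :
    Runs K (Prog.assign a i j e) s 50 Q := by
  intro hs
  have h := Exec.assign (W := 200 * K) a i j e s ((fits_of_bdd hs i).mono (by nlinarith))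
    ((fits_of_bdd hs j).mono (by nlinarith)) ((fits_of_bdd hs e).mono (by nlinarith))
  rw [hi, hj, he, Nat.floor_natCast, Nat.floor_natCast] at h
  exact ⟨_, _, hc, h, hs.write _ _ _ (hv hs), hQ⟩

theorem ite {e f : Expr} {u v : ℚ} (he : eval s e = u) (hf : eval s f = v)
    (hp : u ≤ v → Runs K p s T Q) (hq : v < u → Runs K q s T Q)
    (hw : weight e + weight f ≤ 100 := by decide)
    (hc : cost e + cost f + 1 ≤ 50 := by decide) :
    Runs K (Prog.ite e f p q) s (T + 50) Q := by
  intro hs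
  have h1 : Fits (200 * K) s e := (fits_of_bdd hs e).mono (by nlinarith)
  have h2 : Fits (200 * K) s f := (fits_of_bdd hs f).mono (by nlinarith)
  by_cases h : u ≤ v
  · obtain ⟨t, s', h3, h4, h5, h6⟩ := hp h hs
    exact ⟨_, s', by omega, .ite_pos _ _ _ _ _ _ _ h1 h2 (by rwa [he, hf]) h4, h5, h6⟩
  · obtain ⟨t, s', h3, h4, h5, h6⟩ := hq (not_le.1 h) hs
    exact ⟨_, s', by omega, .ite_neg _ _ _ _ _ _ _ h1 h2 (by rwa [he, hf]) h4, h5, h6⟩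

end Runs

/-- The scalar variable kept in the entry `(0, 0)` of the array `a`. -/
def var (a : ℕ) : Expr := .read a (.lit 0) (.lit 0)

/-- The assignment to a scalar variable. -/
def set (a : ℕ) (e : Expr) : Prog := .assign a (.lit 0) (.lit 0) e

/-- Runs `p` for the values `0, …, m - 1` of the scalar variable `c`, where `m` is the entry `(0, h)`
of the array `0`. -/
def forLoop (c h : ℕ) (p : Prog) : Prog :=
  .seq (set c (.lit 0)) (.loop (.add (var c) (.lit 1)) (.read 0 (.lit 0) (.lit h))
    (.seq p (set c (.add (var c) (.lit 1)))))

namespace Runs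

open RatProg.Expr

variable {K : ℕ} {s : Store} {Q R : Store → Prop} {T T' : ℕ} {p q : Prog}

theorem eval_var (s : Store) (a : ℕ) : eval s (var a) = s a 0 0 := by simp [var, eval]

theorem set {a : ℕ} {e : Expr} {v : ℚ} (he : eval s e = v) (hv : Bdd K s → bits v ≤ K)
    (hQ : Q (s.write a 0 0 v)) (hw : weight e ≤ 98 := by decide)
    (hc : cost e ≤ 47 := by decide) : Runs K (set a e) s 50 Q := by
  refine Runs.assign (by simp [eval]) (by simp [eval]) he hv hQ ?_ ?_
  · simp only [weight]; omega
  · simp only [cost]; omega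

theorem forLoop {c h m : ℕ} (hh : h < 10) (I : ℕ → Store → Prop) (hc : ∀ k s, I k s → s c 0 0 = k)
    (hm : ∀ k s, I k s → s 0 0 h = m) (h0 : I 0 (s.write c 0 0 0))
    (hstep : ∀ k < m, ∀ s, I k s →
      Runs K p s T fun s' => s' c 0 0 = k ∧ I (k + 1) (s'.write c 0 0 ((k + 1 : ℕ) : ℚ))) :
    Runs K (forLoop c h p) s ((m + 1) * (T + 100)) (I m) := by
  have hmK (k : ℕ) (s : Store) (hs : Bdd K s) (hI : I k s) (j : ℕ) (hj : j ≤ m) :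
      bits (j : ℚ) ≤ K := by
    have h1 := hs 0 0 h
    rw [hm k s hI] at h1
    refine bits_natCast_le ((one_le_bits _).trans h1) ?_
    have h2 := (bits_le_iff.1 h1).1
    simp only [Rat.num_natCast, Int.natAbs_natCast] at h2
    omega
  have key : ∀ j k s, k + j = m → I k s →
      Runs K (.loop (.add (var c) (.lit 1)) (.read 0 (.lit 0) (.lit h))
        (.seq p (RatProg.set c (.add (var c) (.lit 1))))) s (j * (T + 59) + 9) (I m) := by
    intro j
    induction j with
    | zero =>
      intro k s hk hI hs
      obtain rfl : k = m := by omega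
      refine ⟨9, s, by omega, ?_, hs, hI⟩
      refine Exec.loop_stop _ _ _ _ ((fits_of_bdd hs _).mono ?_) ((fits_of_bdd hs _).mono ?_) ?_
      · have : weight (.add (var c) (.lit 1)) = 6 := rfl
        rw [this]; omega
      · have : weight (.read 0 (.lit 0) (.lit h)) = h + 3 := by simp [weight]; omega
        rw [this]; nlinarith
      · simp [eval, eval_var, hc _ _ hI, hm _ _ hI]
    | succ j ih =>
      intro k s hk hI hs
      obtain ⟨t, s', h1, h2, h3, h4, h5⟩ := hstep k (by omega) s hI hs
      have h6 : Runs K (RatProg.set c (.add (var c) (.lit 1))) s' 50 (I (k + 1)) := by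
        refine Runs.set (v := ((k + 1 : ℕ) : ℚ)) ?_ ?_ h5 ?_ ?_
        · simp [eval, eval_var, h4]
        · intro _; exact hmK k s hs hI _ (by omega)
        · simp [weight, var]
        · simp [cost, var]
      obtain ⟨t', s'', h1', h2', h3', h4'⟩ := h6 h3
      obtain ⟨t'', s''', h1'', h2'', h3'', h4''⟩ := ih (k + 1) s'' (by omega) h4' h3'
      refine ⟨_, s''', ?_, Exec.loop_step _ _ _ _ _ _ _ _ ((fits_of_bdd hs _).mono ?_)
        ((fits_of_bdd hs _).mono ?_) ?_ (.seq _ _ _ _ _ _ _ h2 h2') h2'', h3'', h4''⟩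
      · simp only [cost, var]
        nlinarith
      · have : weight (.add (var c) (.lit 1)) = 6 := rfl
        rw [this]; omega
      · have : weight (.read 0 (.lit 0) (.lit h)) = h + 3 := by simp [weight]; omega
        rw [this]; nlinarith
      · simp only [eval, eval_var, hc _ _ hI, Int.cast_zero, Nat.floor_zero, Int.cast_natCast,
          Nat.floor_natCast, hm _ _ hI, Int.cast_one]
        exact_mod_cast (by omega : k + 1 ≤ m)
  have h1 : Runs K (RatProg.set c (.lit 0)) s 50 (I 0) := by
    refine Runs.set (v := 0) (by simp [eval]) ?_ h0 (by simp [weight]) (by simp [cost])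
    intro hs
    rw [bits_zero]
    exact (one_le_bits _).trans (hs 0 0 0)
  refine (Runs.seq h1 fun s' hs' => key m 0 s' (by omega) hs').conseq ?_ fun _ h => h
  nlinarith

end Runs

/-- The stores `s` and `s'` differ at most in the arrays listed in `S`. -/
def Same (S : List ℕ) (s s' : Store) : Prop := ∀ a, a ∉ S → s' a = s a

theorem Same.refl (S : List ℕ) (s : Store) : Same S s s := fun _ _ => rfl

theorem Same.trans {S S' S'' : List ℕ} {s s' s'' : Store} (h : Same S s s') (h' : Same S' s' s'')
    (h1 : S ⊆ S'' := by decide) (h2 : S' ⊆ S'' := by decide) : Same S'' s s'' :=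
  fun a ha => (h' a fun h => ha (h2 h)).trans (h a fun h => ha (h1 h))

theorem Same.write {S : List ℕ} {s s' : Store} (h : Same S s s') {a : ℕ} (i j : ℕ) (v : ℚ)
    (ha : a ∈ S := by decide) : Same S s (s'.write a i j v) := by
  intro a' ha'
  have hne : a' ≠ a := by rintro rfl; exact ha' ha
  rw [Store.write_ne _ hne]
  exact h a' ha'

end RatProg

/-! ### Directions of nearby vectors -/

theorem norm_normalize_sub_normalize_le {E : Type*} [NormedAddCommGroup E] [NormedSpace ℝ E]
    {u v : E} (hu : u ≠ 0) : ‖‖u‖⁻¹ • u - ‖v‖⁻¹ • v‖ ≤ 2 * ‖v - u‖ / ‖u‖ := by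
  have hu' : 0 < ‖u‖ := norm_pos_iff.2 hu
  rcases eq_or_ne v 0 with rfl | hv
  · rw [smul_zero, sub_zero, norm_smul, norm_inv, norm_norm, inv_mul_cancel₀ hu'.ne', zero_sub,
      norm_neg, mul_div_cancel_right₀ _ hu'.ne']
    norm_num
  have hv' : 0 < ‖v‖ := norm_pos_iff.2 hv
  rw [le_div_iff₀ hu', mul_comm]
  have h1 : ‖u‖ * ‖‖u‖⁻¹ • u - ‖v‖⁻¹ • v‖ = ‖(u - v) + (1 - ‖u‖ * ‖v‖⁻¹) • v‖ := by
    rw [← norm_norm u, ← norm_smul, norm_norm]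
    congr 1
    rw [smul_sub, smul_smul, smul_smul, mul_inv_cancel₀ hu'.ne', sub_smul, one_smul, one_smul]
    abel
  have h2 : ‖(1 - ‖u‖ * ‖v‖⁻¹) • v‖ = |‖v‖ - ‖u‖| := by
    rw [norm_smul, Real.norm_eq_abs]
    nth_rewrite 2 [← abs_of_pos hv']
    rw [← abs_mul, sub_mul, one_mul, mul_assoc, inv_mul_cancel₀ hv'.ne', mul_one]
  rw [h1]
  refine (norm_add_le _ _).trans ?_
  rw [h2, norm_sub_rev u v]
  linarith [abs_norm_sub_norm_le v u]

theorem radialMap_smul {d : ℕ} (A : Matrix (Fin d) (Fin d) ℝ) {c : ℝ} (hc : 0 < c)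
    (x : EuclideanSpace ℝ (Fin d)) : radialMap (c • A) x = radialMap A x := by
  unfold radialMap
  rw [Matrix.smul_mulVec, WithLp.toLp_smul, norm_smul, smul_smul, Real.norm_of_nonneg hc.le,
    mul_inv, mul_comm, ← mul_assoc, mul_inv_cancel₀ hc.ne', one_mul]

theorem EuclideanSpace.norm_le_sum_abs {d : ℕ} (v : EuclideanSpace ℝ (Fin d)) :
    ‖v‖ ≤ ∑ i, |v i| := by
  rw [EuclideanSpace.norm_eq]
  refine Real.sqrt_le_iff.2 ⟨Finset.sum_nonneg fun _ _ => abs_nonneg _, ?_⟩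
  simpa using Finset.sum_sq_le_sq_sum_of_nonneg (s := Finset.univ) (f := fun i => |v i|)
    fun i _ => abs_nonneg _

theorem EuclideanSpace.sum_abs_le {d : ℕ} (v : EuclideanSpace ℝ (Fin d)) :
    ∑ i, |v i| ≤ d * ‖v‖ := by
  refine (Finset.sum_le_card_nsmul _ _ ‖v‖ fun i _ => ?_).trans (by simp)
  simpa using PiLp.norm_apply_le v i

/-- If `s • A' x` agrees with `A x` up to a relative error `η` in the `ℓ¹` norm, then the two
directions differ by at most `2 d η`: the two norms differ by a factor of at most `d`. -/
theorem norm_radialMap_sub_le {d : ℕ} {A A' : Matrix (Fin d) (Fin d) ℤ} {x : Fin d → ℤ}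
    {s η ε : ℚ} (hs : 0 < s) (hη : 0 ≤ η) (hu : 0 < ∑ i, |((A *ᵥ x) i : ℚ)|)
    (h : ∑ i, |s * (A' *ᵥ x) i - (A *ᵥ x) i| ≤ η * ∑ i, |((A *ᵥ x) i : ℚ)|)
    (hε : 2 * d * η ≤ ε) :
    ‖radialMap (intMatrix A) (intPoint x) - radialMap (intMatrix A') (intPoint x)‖ ≤ (ε : ℝ) := by
  have hs' : (0 : ℝ) < s := by exact_mod_cast hs
  have key (B : Matrix (Fin d) (Fin d) ℤ) (i : Fin d) :
      (intMatrix B *ᵥ (intPoint x).ofLp) i = (((B *ᵥ x) i : ℤ) : ℝ) := by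
    simp [intMatrix, intPoint, Matrix.mulVec, dotProduct]
  rw [← radialMap_smul (intMatrix A') hs']
  unfold radialMap
  set u : EuclideanSpace ℝ (Fin d) := WithLp.toLp 2 (intMatrix A *ᵥ (intPoint x).ofLp) with hu_def
  set v : EuclideanSpace ℝ (Fin d) :=
    WithLp.toLp 2 (((s : ℝ) • intMatrix A') *ᵥ (intPoint x).ofLp) with hv_def
  have hui (i : Fin d) : u i = (((A *ᵥ x) i : ℤ) : ℝ) := key A i
  have hvi (i : Fin d) : v i = s * (((A' *ᵥ x) i : ℤ) : ℝ) := by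
    rw [hv_def, Matrix.smul_mulVec]
    simp [key]
  have hu1 : (∑ i, |u i| : ℝ) = ((∑ i, |((A *ᵥ x) i : ℚ)| : ℚ) : ℝ) := by
    push_cast
    exact Finset.sum_congr rfl fun i _ => by rw [hui]
  have hvu : ∑ i, |(v - u) i| ≤ η * ∑ i, |u i| := by
    rw [hu1]
    have h' : ((∑ i, |s * (A' *ᵥ x) i - (A *ᵥ x) i| : ℚ) : ℝ)
        ≤ ((η * ∑ i, |((A *ᵥ x) i : ℚ)| : ℚ) : ℝ) := by exact_mod_cast h
    rw [Rat.cast_mul] at h'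
    refine le_trans (le_of_eq ?_) h'
    push_cast
    refine Finset.sum_congr rfl fun i _ => ?_
    rw [PiLp.sub_apply, hui, hvi]
  have hu0 : u ≠ 0 := by
    intro h0
    rw [h0] at hu1
    simp only [PiLp.zero_apply, abs_zero, Finset.sum_const_zero] at hu1
    have : (0 : ℝ) < ((∑ i, |((A *ᵥ x) i : ℚ)| : ℚ) : ℝ) := by exact_mod_cast hu
    linarith
  have hn : 0 < ‖u‖ := norm_pos_iff.2 hu0
  refine (norm_normalize_sub_normalize_le hu0).trans ?_
  rw [div_le_iff₀ hn]
  have h1 := EuclideanSpace.norm_le_sum_abs (v - u)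
  have h2 := EuclideanSpace.sum_abs_le u
  have hη' : (0 : ℝ) ≤ η := by exact_mod_cast hη
  have hε' : (2 * d * η : ℝ) ≤ ε := by exact_mod_cast hε
  have h3 : ‖v - u‖ ≤ η * (d * ‖u‖) := h1.trans (hvu.trans (mul_le_mul_of_nonneg_left h2 hη'))
  nlinarith

/-! ### Integer bases with small entries -/

/-- The bound for the determinant of an integer matrix with entries of absolute value at
most `2 ^ b`. -/
def detBound (d b : ℕ) : ℕ := d.factorial * (2 ^ b) ^ d

theorem one_le_detBound (d b : ℕ) : 1 ≤ detBound d b :=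
  Nat.one_le_iff_ne_zero.2 (mul_ne_zero (Nat.factorial_ne_zero d) (by positivity))

theorem abs_det_le_detBound {d b : ℕ} {Y : Matrix (Fin d) (Fin d) ℤ}
    (hY : ∀ i j, |Y i j| ≤ 2 ^ b) : |Y.det| ≤ detBound d b := by
  have := Matrix.det_le (A := Y) (abv := AbsoluteValue.abs) (x := 2 ^ b) hY
  simpa [detBound] using this

section

variable {d b : ℕ} {Y : Matrix (Fin d) (Fin d) ℤ} {W : Matrix (Fin d) (Fin d) ℚ}

theorem det_ne_zero_of_mul_map_eq_one (h : W * Y.map (Int.cast : ℤ → ℚ) = 1) : Y.det ≠ 0 := by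
  intro h0
  have h1 := congrArg Matrix.det h
  have h2 : (Y.map (Int.cast : ℤ → ℚ)).det = Y.det := ((Int.castRingHom ℚ).map_det Y).symm
  rw [Matrix.det_mul, Matrix.det_one, h2, h0] at h1
  simp at h1

theorem det_smul_eq_adjugate (h : W * Y.map (Int.cast : ℤ → ℚ) = 1) :
    (Y.det : ℚ) • W = Y.adjugate.map (Int.cast : ℤ → ℚ) := by
  have h1 := mul_eq_one_comm.1 h
  have h2 : Y.adjugate.map (Int.cast : ℤ → ℚ) * Y.map (Int.cast : ℤ → ℚ) = (Y.det : ℚ) • 1 := by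
    ext i j
    have := congrArg (Int.cast : ℤ → ℚ) (congrFun (congrFun (Matrix.adjugate_mul Y) i) j)
    simp only [Matrix.mul_apply, Matrix.smul_apply, Matrix.one_apply] at this
    simp only [Matrix.mul_apply, Matrix.map_apply, Matrix.smul_apply, Matrix.one_apply]
    push_cast at this
    rw [this]
    simp
  have h3 := congrArg (· * W) h2
  rw [mul_assoc, h1, mul_one] at h3
  rw [h3, Matrix.smul_mul, one_mul]

theorem abs_adjugate_le (hY : ∀ i j, |Y i j| ≤ 2 ^ b) (i j : Fin d) :
    |Y.adjugate i j| ≤ detBound d b := by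
  rw [Matrix.adjugate_apply]
  refine abs_det_le_detBound fun i' j' => ?_
  rw [Matrix.updateRow_apply]
  split_ifs
  · rw [Pi.single_apply]
    split_ifs
    · simpa using one_le_pow₀ (n := b) (one_le_two : (1 : ℤ) ≤ 2)
    · simp
  · exact hY _ _

theorem det_mul_mulVec (h : W * Y.map (Int.cast : ℤ → ℚ) = 1) (x : Fin d → ℤ) (i : Fin d) :
    (Y.det : ℚ) * (W *ᵥ fun j => (x j : ℚ)) i = ((Y.updateCol i x).det : ℤ) := by
  have h1 : (Y.det : ℚ) * (W *ᵥ fun j => (x j : ℚ)) i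
      = (((Y.det : ℚ) • W) *ᵥ fun j => (x j : ℚ)) i := by
    rw [Matrix.smul_mulVec]; rfl
  rw [h1, det_smul_eq_adjugate h, ← Matrix.cramer_apply, Matrix.cramer_eq_adjugate_mulVec]
  simp [Matrix.mulVec, dotProduct]

theorem abs_det_updateCol_le (hY : ∀ i j, |Y i j| ≤ 2 ^ b) {x : Fin d → ℤ}
    (hx : ∀ i, |x i| ≤ 2 ^ b) (i : Fin d) : |(Y.updateCol i x).det| ≤ detBound d b := by
  refine abs_det_le_detBound fun i' j' => ?_
  rw [Matrix.updateCol_apply]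
  split_ifs
  · exact hx _
  · exact hY _ _

theorem abs_mulVec_le (hY : ∀ i j, |Y i j| ≤ 2 ^ b) (h : W * Y.map (Int.cast : ℤ → ℚ) = 1)
    {x : Fin d → ℤ} (hx : ∀ i, |x i| ≤ 2 ^ b) (i : Fin d) :
    |(W *ᵥ fun j => (x j : ℚ)) i| ≤ detBound d b := by
  have h1 : (1 : ℚ) ≤ |(Y.det : ℚ)| := by
    exact_mod_cast Int.one_le_abs (det_ne_zero_of_mul_map_eq_one h)
  have h2 : |(Y.det : ℚ) * (W *ᵥ fun j => (x j : ℚ)) i| ≤ detBound d b := by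
    rw [det_mul_mulVec h]
    exact_mod_cast abs_det_updateCol_le hY hx i
  rw [abs_mul] at h2
  nlinarith [abs_nonneg ((W *ᵥ fun j => (x j : ℚ)) i)]

theorem natAbs_lt_two_pow {d b L : ℕ} (hL : detBound d b < 2 ^ L) {z : ℤ}
    (hz : |z| ≤ detBound d b) : z.natAbs < 2 ^ L := by
  refine lt_of_le_of_lt ?_ hL
  rw [Int.abs_eq_natAbs] at hz
  exact_mod_cast hz

theorem bits_inverse_le {L : ℕ} (hL : detBound d b < 2 ^ L) (hY : ∀ i j, |Y i j| ≤ 2 ^ b)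
    (h : W * Y.map (Int.cast : ℤ → ℚ) = 1) (i j : Fin d) : RatProg.bits (W i j) ≤ L := by
  refine RatProg.bits_le_of_mul_eq (p := Y.adjugate i j) (m := Y.det)
    (det_ne_zero_of_mul_map_eq_one h) ?_ (natAbs_lt_two_pow hL (abs_adjugate_le hY i j))
    (natAbs_lt_two_pow hL (abs_det_le_detBound hY))
  have := congrFun (congrFun (det_smul_eq_adjugate h) i) j
  simp only [Matrix.smul_apply, Matrix.map_apply, smul_eq_mul] at this
  rw [mul_comm, this]

end

/-! ### Greedy bases -/

/-- `W` is the inverse of a matrix `Y` whose column `i` is the point `x l` of weight `w i = β l`,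
where `l = idx i`, or a small integer vector that is assigned the weight `w i = H` and the dummy
index `0`; `D` is the absolute value of `det Y`.  Each of the first `k` points is a combination of
columns whose weights do not exceed its own weight. -/
def IsGreedy {d n : ℕ} (b : ℕ) (x : Fin n → Fin d → ℤ) (β : ℕ → ℚ) (H : ℚ) (k : ℕ)
    (W : Matrix (Fin d) (Fin d) ℚ) (w idx : Fin d → ℚ) (D : ℚ) : Prop :=
  ∃ Y : Matrix (Fin d) (Fin d) ℤ, (∀ i j, |Y i j| ≤ 2 ^ b) ∧ W * Y.map (Int.cast : ℤ → ℚ) = 1 ∧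
    D = |(Y.det : ℚ)| ∧
    (∀ i, (∃ l : Fin n, idx i = ((l : ℕ) : ℚ) ∧ w i = β l ∧ ∀ j, Y j i = x l j) ∨
      (idx i = 0 ∧ w i = H)) ∧
    ∀ l : Fin n, (l : ℕ) < k → ∀ i, (W *ᵥ fun j => (x l j : ℚ)) i ≠ 0 → w i ≤ β l

section

variable {d n b : ℕ} {x : Fin n → Fin d → ℤ} {β : ℕ → ℚ} {H : ℚ} {k : ℕ}
  {W : Matrix (Fin d) (Fin d) ℚ} {w idx : Fin d → ℚ} {D : ℚ}

theorem isGreedy_zero : IsGreedy b x β H 0 1 (fun _ => H) (fun _ => 0) 1 := by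
  refine ⟨1, fun i j => ?_, ?_, by simp, fun i => Or.inr ⟨rfl, rfl⟩, fun l hl => absurd hl (by simp)⟩
  · rw [Matrix.one_apply]
    split_ifs
    · simpa using one_le_pow₀ (n := b) (one_le_two : (1 : ℤ) ≤ 2)
    · simp
  · simp

theorem IsGreedy.succ (h : IsGreedy b x β H k W w idx D) (hk : k < n)
    (hc : ∀ i, (W *ᵥ fun j => (x ⟨k, hk⟩ j : ℚ)) i ≠ 0 → w i ≤ β k) :
    IsGreedy b x β H (k + 1) W w idx D := by
  obtain ⟨Y, h1, h2, h3, h4, h5⟩ := h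
  refine ⟨Y, h1, h2, h3, h4, fun l hl i hi => ?_⟩
  rcases Nat.lt_succ_iff_lt_or_eq.1 hl with hl | hl
  · exact h5 l hl i hi
  · obtain rfl : l = ⟨k, hk⟩ := Fin.ext hl
    exact hc i hi

theorem exchange_mulVec (W : Matrix (Fin d) (Fin d) ℚ) (c y : Fin d → ℚ) (p i : Fin d) :
    ((Matrix.of fun i j => W i j - (c i - if i = p then 1 else 0) * (W p j / c p)) *ᵥ y) i
      = (W *ᵥ y) i - (c i - if i = p then 1 else 0) * ((W *ᵥ y) p / c p) := by
  simp only [Matrix.mulVec, dotProduct, Matrix.of_apply, Finset.sum_div, Finset.mul_sum,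
    ← Finset.sum_sub_distrib]
  exact Finset.sum_congr rfl fun j _ => by ring

/-- The exchange step: the new point replaces a column of maximal weight among the columns that it
involves. -/
theorem IsGreedy.exchange (h : IsGreedy b x β H k W w idx D) (hk : k < n)
    (hx : ∀ l i, |x l i| ≤ 2 ^ b) {c : Fin d → ℚ}
    (hcW : c = W *ᵥ fun j => (x ⟨k, hk⟩ j : ℚ)) {p : Fin d} (hp : c p ≠ 0)
    (hmax : ∀ i, c i ≠ 0 → w i ≤ w p) (hlt : β k < w p) :
    IsGreedy b x β H (k + 1)
      (Matrix.of fun i j => W i j - (c i - if i = p then 1 else 0) * (W p j / c p))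
      (Function.update w p (β k)) (Function.update idx p (k : ℚ)) (D * |c p|) := by
  obtain ⟨Y, h1, h2, h3, h4, h5⟩ := h
  refine ⟨Y.updateCol p (x ⟨k, hk⟩), fun i j => ?_, ?_, ?_, fun i => ?_, fun l hl i hi => ?_⟩
  · rw [Matrix.updateCol_apply]
    split_ifs
    · exact hx _ _
    · exact h1 _ _
  · ext i q
    have hcol : (fun j => ((Y.updateCol p (x ⟨k, hk⟩) j q : ℤ) : ℚ))
        = if q = p then fun j => (x ⟨k, hk⟩ j : ℚ) else fun j => (Y j q : ℚ) := by
      funext j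
      rw [Matrix.updateCol_apply]
      split_ifs <;> rfl
    have hWY (i : Fin d) : (W *ᵥ fun j => (Y j q : ℚ)) i = (1 : Matrix (Fin d) (Fin d) ℚ) i q := by
      rw [← h2]; rfl
    have := exchange_mulVec W c (fun j => ((Y.updateCol p (x ⟨k, hk⟩) j q : ℤ) : ℚ)) p i
    refine Eq.trans (by rfl) (this.trans ?_)
    rw [hcol]
    split_ifs with hq hi hi
    · subst hq hi; rw [← hcW, Matrix.one_apply_eq]; field_simp; ring
    · subst hq; rw [← hcW, Matrix.one_apply_ne hi]; field_simp; ring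
    · subst hi; simp only [hWY]; rw [Matrix.one_apply_ne (Ne.symm hq)]; simp
    · simp only [hWY]; rw [Matrix.one_apply_ne (Ne.symm hq)]; simp
  · rw [h3, ← abs_mul, hcW, det_mul_mulVec h2]
  · rcases eq_or_ne i p with rfl | hip
    · exact Or.inl ⟨⟨k, hk⟩, by simp, by simp, fun j => by simp⟩
    · simp only [Function.update_of_ne hip]
      rcases h4 i with ⟨l, hl1, hl2, hl3⟩ | h
      · refine Or.inl ⟨l, hl1, hl2, fun j => ?_⟩
        rw [Matrix.updateCol_ne hip, hl3]
      · exact Or.inr h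
  · rw [exchange_mulVec] at hi
    rcases Nat.lt_succ_iff_lt_or_eq.1 hl with hl | hl
    · have h6 := h5 l hl
      set v := W *ᵥ fun j => (x l j : ℚ) with hv
      by_cases hvp : v p = 0
      · rw [hvp, zero_div, mul_zero, sub_zero] at hi
        have hip : i ≠ p := by rintro rfl; exact hi hvp
        rw [Function.update_of_ne hip]
        exact h6 i hi
      · have h7 := h6 p hvp
        rcases eq_or_ne i p with rfl | hip
        · rw [Function.update_self]
          linarith
        · rw [Function.update_of_ne hip]
          by_cases hvi : v i = 0
          · refine (hmax i ?_).trans h7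
            intro hci
            rw [hvi, hci, if_neg hip] at hi
            simp at hi
          · exact h6 i hvi
    · obtain rfl : l = ⟨k, hk⟩ := Fin.ext hl
      rw [← hcW] at hi
      rcases eq_or_ne i p with rfl | hip
      · simp
      · rw [if_neg hip] at hi
        exfalso; apply hi; field_simp; ring

/-- When all points have been processed and they span the space, all columns are points. -/
theorem IsGreedy.exists_basis (h : IsGreedy b x β H n W w idx D) (hH : ∀ l : Fin n, β l < H)
    (hspan : Submodule.span ℝ (Set.range fun l => intPoint (x l)) = ⊤) :
    ∃ (σ : Fin d → Fin n) (Y : Matrix (Fin d) (Fin d) ℤ), (∀ i j, |Y i j| ≤ 2 ^ b) ∧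
      W * Y.map (Int.cast : ℤ → ℚ) = 1 ∧ D = |(Y.det : ℚ)| ∧
      (∀ i, idx i = ((σ i : ℕ) : ℚ) ∧ w i = β (σ i) ∧ ∀ j, Y j i = x (σ i) j) ∧
      ∀ l : Fin n, ∀ i, (W *ᵥ fun j => (x l j : ℚ)) i ≠ 0 → w i ≤ β l := by
  obtain ⟨Y, h1, h2, h3, h4, h5⟩ := h
  have hslot (i : Fin d) :
      ∃ l : Fin n, idx i = ((l : ℕ) : ℚ) ∧ w i = β l ∧ ∀ j, Y j i = x l j := by
    rcases h4 i with h | ⟨-, hwi⟩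
    · exact h
    exfalso
    -- The row `i` of `W` vanishes on all points, hence on the whole space.
    have hzero (l : Fin n) : (W *ᵥ fun j => (x l j : ℚ)) i = 0 := by
      by_contra hne
      have := h5 l l.2 i hne
      rw [hwi] at this
      exact absurd (hH l) (not_lt.2 this)
    let φ : EuclideanSpace ℝ (Fin d) →ₗ[ℝ] ℝ :=
      { toFun := fun y => ∑ j, (W i j : ℝ) * y j
        map_add' := fun y z => by simp [mul_add, Finset.sum_add_distrib]
        map_smul' := fun a y => by
          simp only [PiLp.smul_apply, smul_eq_mul, RingHom.id_apply, Finset.mul_sum]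
          exact Finset.sum_congr rfl fun j _ => by ring }
    have hφ : φ = 0 := by
      refine LinearMap.ext_on_range hspan fun l => ?_
      have := congrArg (Rat.cast : ℚ → ℝ) (hzero l)
      simpa [φ, intPoint, Matrix.mulVec, dotProduct] using this
    have hφY : φ (intPoint fun j => Y j i) = 1 := by
      have := congrArg (Rat.cast : ℚ → ℝ) (congrFun (congrFun h2 i) i)
      simpa [φ, intPoint, Matrix.mul_apply] using this
    rw [hφ] at hφY
    simp at hφY
  choose σ hσ using hslot
  exact ⟨σ, Y, h1, h2, h3, hσ, fun l => h5 l l.2⟩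

theorem IsGreedy.bits_le (h : IsGreedy b x β H k W w idx D) {L : ℕ} (hL : detBound d b < 2 ^ L)
    (hL1 : 1 ≤ L) (hβ : ∀ l : Fin n, RatProg.bits (β l) ≤ L) (hH : RatProg.bits H ≤ L) :
    (∀ i j, RatProg.bits (W i j) ≤ L) ∧ (∀ i, RatProg.bits (w i) ≤ L) ∧ RatProg.bits D ≤ L := by
  obtain ⟨Y, h1, h2, h3, h4, -⟩ := h
  refine ⟨bits_inverse_le hL h1 h2, fun i => ?_, ?_⟩
  · rcases h4 i with ⟨l, -, hl, -⟩ | ⟨-, h⟩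
    · rw [hl]; exact hβ l
    · rwa [h]
  · rw [h3, RatProg.bits_abs]
    exact RatProg.bits_intCast_le hL1 (natAbs_lt_two_pow hL (abs_det_le_detBound h1))

end

/-! ### Compressing the gaps between the weights -/

/-- The state of the computation of the factors `t i` after `k` indices have been treated, in the
order of increasing weight; `t i = 0` marks the indices that are not yet treated, `prev` is the
last weight treated and `γ` the corresponding scaled weight `t i * w i`.  Factors decrease with the
weight, and may differ only if the scaled weights are a factor `G` apart. -/
structure GapState {d : ℕ} (w : Fin d → ℚ) (G : ℚ) (k : ℕ) (t : Fin d → ℚ) (prev γ : ℚ) :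
    Prop where
  card : (Finset.univ.filter fun i => t i ≠ 0).card = k
  prev_nonneg : 0 ≤ prev
  le_prev : ∀ i, t i ≠ 0 → w i ≤ prev
  prev_le : ∀ i, t i = 0 → prev ≤ w i
  one_le : 1 ≤ γ
  le_pow : γ ≤ G ^ k
  pos : ∀ i, t i ≠ 0 → 0 < t i ∧ 1 ≤ t i * w i
  scaled_le : ∀ i, t i ≠ 0 → t i * w i ≤ γ
  le_scaled : ∀ i, t i ≠ 0 → γ ≤ t i * prev
  gap_last : ∀ i, t i ≠ 0 → (t i * prev - γ) * w i * G ≤ γ * prev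
  anti : ∀ i j, t i ≠ 0 → t j ≠ 0 → w i ≤ w j → t j ≤ t i
  gap : ∀ i j, t i ≠ 0 → t j ≠ 0 → w i ≤ w j → (t i - t j) * w i * G ≤ t j * w j

section

variable {d : ℕ} {w : Fin d → ℚ} {G : ℚ} {k : ℕ} {t : Fin d → ℚ} {prev γ : ℚ}

theorem gapState_zero (hw : ∀ i, 1 ≤ w i) : GapState w G 0 (fun _ => 0) 0 1 where
  card := by simp
  prev_nonneg := le_rfl
  le_prev i h := absurd rfl h
  prev_le i _ := by linarith [hw i]
  one_le := le_rfl
  le_pow := by simp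
  pos i h := absurd rfl h
  scaled_le i h := absurd rfl h
  le_scaled i h := absurd rfl h
  gap_last i h := absurd rfl h
  anti i j h := absurd rfl h
  gap i j h := absurd rfl h

theorem GapState.exists_eq_zero (h : GapState w G k t prev γ) (hk : k < d) : ∃ i, t i = 0 := by
  by_contra! hne
  have := h.card
  rw [Finset.filter_true_of_mem fun i _ => hne i, Finset.card_univ, Fintype.card_fin] at this
  omega

theorem GapState.ne_zero (h : GapState w G d t prev γ) (i : Fin d) : t i ≠ 0 := by
  have h1 : (Finset.univ.filter fun i => t i ≠ 0) = Finset.univ := by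
    rw [← Finset.card_eq_iff_eq_univ, h.card, Fintype.card_fin]
  have h2 := Finset.mem_univ i
  rw [← h1] at h2
  simpa using h2

theorem GapState.succ (h : GapState w G k t prev γ) (hw : ∀ i, 1 ≤ w i) (hG : 1 ≤ G)
    {p : Fin d} (hp : t p = 0) (hmin : ∀ i, t i = 0 → w p ≤ w i) {γ' : ℚ}
    (hγ' : γ' = if w p ≤ G * prev then γ * w p / prev else γ * G) :
    GapState w G (k + 1) (Function.update t p (γ' / w p)) (w p) γ' := by
  have hwp : 0 < w p := by linarith [hw p]
  have hpp := h.prev_le p hp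
  have hγ0 : 0 < γ := by linarith [h.one_le]
  have hprev0 : w p ≤ G * prev → 0 < prev := fun hle => by
    rcases h.prev_nonneg.lt_or_eq with h0 | h0
    · exact h0
    · rw [← h0, mul_zero] at hle; linarith
  have hγγ' : γ ≤ γ' := by
    rw [hγ']
    split_ifs with hle
    · rw [le_div_iff₀ (hprev0 hle)]
      exact mul_le_mul_of_nonneg_left hpp hγ0.le
    · nlinarith
  have hγ'0 : 0 < γ' := hγ0.trans_le hγγ'
  have htp : γ' / w p ≠ 0 := (div_pos hγ'0 hwp).ne'
  have hmul : γ' / w p * w p = γ' := div_mul_cancel₀ _ hwp.ne'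
  -- The relations between an old index and the new one.
  have hold (i : Fin d) (hi : t i ≠ 0) :
      γ' ≤ t i * w p ∧ (t i * w p - γ') * w i * G ≤ γ' * w p := by
    have h1 := h.le_scaled i hi
    have h2 := h.gap_last i hi
    have h3 := h.scaled_le i hi
    have h4 := (h.pos i hi).1
    have hpos : 0 < prev := by
      by_contra hn
      nlinarith
    rw [hγ']
    split_ifs with hle
    · constructor
      · rw [div_le_iff₀ hpos]
        nlinarith
      · have h5 : (t i * w p - γ * w p / prev) * w i * G
            = (w p / prev) * ((t i * prev - γ) * w i * G) := by field_simp
        have h6 : 0 ≤ w p / prev := (div_pos hwp hpos).le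
        have h7 : γ ≤ γ * w p / prev := by
          rw [le_div_iff₀ hpos]; exact mul_le_mul_of_nonneg_left hpp hγ0.le
        rw [h5]
        calc w p / prev * ((t i * prev - γ) * w i * G) ≤ w p / prev * (γ * prev) :=
              mul_le_mul_of_nonneg_left h2 h6
          _ = γ * w p := by field_simp
          _ ≤ _ := mul_le_mul_of_nonneg_right h7 hwp.le
    · rw [not_le] at hle
      constructor
      · calc γ * G ≤ t i * prev * G := mul_le_mul_of_nonneg_right h1 (by linarith)
          _ = t i * (G * prev) := by ring
          _ ≤ _ := mul_le_mul_of_nonneg_left hle.le h4.le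
      · have hwi := hw i
        have hGwp : 0 ≤ G * w p := by positivity
        have hsub : 0 ≤ γ * G * w i * G := by positivity
        calc (t i * w p - γ * G) * w i * G = (t i * w i) * (G * w p) - γ * G * w i * G := by ring
          _ ≤ γ * (G * w p) - 0 := by gcongr
          _ = _ := by ring
  have hstep (i : Fin d) (hi : Function.update t p (γ' / w p) i ≠ 0) :
      i = p ∨ i ≠ p ∧ t i ≠ 0 := by
    rcases eq_or_ne i p with hip | hip
    · exact Or.inl hip
    · rw [Function.update_of_ne hip] at hi
      exact Or.inr ⟨hip, hi⟩
  have heq (i : Fin d) (hi : t i ≠ 0) (hwi : w p ≤ w i) : t i = γ' / w p := by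
    have h1 := h.le_prev i hi
    have h2 := (hold i hi).1
    have h3 := h.scaled_le i hi
    have h4 : w i = w p := le_antisymm (h1.trans hpp) hwi
    rw [eq_div_iff hwp.ne']
    rw [h4] at h3
    exact le_antisymm (h3.trans hγγ') h2
  refine ⟨?_, hwp.le, ?_, ?_, h.one_le.trans hγγ', ?_, ?_, ?_, ?_, ?_, ?_, ?_⟩
  · have h1 : (Finset.univ.filter fun i => Function.update t p (γ' / w p) i ≠ 0)
        = insert p (Finset.univ.filter fun i => t i ≠ 0) := by
      ext i
      rcases eq_or_ne i p with rfl | hip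
      · simpa using htp
      · simp [hip]
    rw [h1, Finset.card_insert_of_notMem (by simp [hp]), h.card]
  · intro i hi
    rcases hstep i hi with rfl | ⟨-, hi⟩
    · exact le_rfl
    · exact (h.le_prev i hi).trans hpp
  · intro i hi
    rcases eq_or_ne i p with rfl | hip
    · exact le_rfl
    · rw [Function.update_of_ne hip] at hi
      exact hmin i hi
  · have hGk : γ * G ≤ G ^ (k + 1) := by
      rw [pow_succ]; exact mul_le_mul_of_nonneg_right h.le_pow (by linarith)
    refine le_trans ?_ hGk
    rw [hγ']
    split_ifs with hle
    · rw [div_le_iff₀ (hprev0 hle), mul_assoc]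
      exact mul_le_mul_of_nonneg_left hle hγ0.le
    · exact le_rfl
  · intro i hi
    rcases hstep i hi with rfl | ⟨hip, hi⟩
    · rw [Function.update_self, hmul]
      exact ⟨div_pos hγ'0 hwp, h.one_le.trans hγγ'⟩
    · rw [Function.update_of_ne hip]
      exact h.pos i hi
  · intro i hi
    rcases hstep i hi with rfl | ⟨hip, hi⟩
    · rw [Function.update_self, hmul]
    · rw [Function.update_of_ne hip]
      exact (h.scaled_le i hi).trans hγγ'
  · intro i hi
    rcases hstep i hi with rfl | ⟨hip, hi⟩
    · rw [Function.update_self, hmul]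
    · rw [Function.update_of_ne hip]
      exact (hold i hi).1
  · intro i hi
    rcases hstep i hi with rfl | ⟨hip, hi⟩
    · rw [Function.update_self, hmul, sub_self, zero_mul, zero_mul]
      positivity
    · rw [Function.update_of_ne hip]
      exact (hold i hi).2
  · intro i j hi hj hij
    rcases hstep i hi with hip | ⟨hip, hi'⟩ <;> rcases hstep j hj with hjp | ⟨hjp, hj'⟩
    · rw [hip, hjp]
    · rw [hip] at hij ⊢
      rw [Function.update_self, Function.update_of_ne hjp, heq j hj' hij]
    · rw [hjp, Function.update_self, Function.update_of_ne hip, div_le_iff₀ hwp]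
      exact (hold i hi').1
    · rw [Function.update_of_ne hip, Function.update_of_ne hjp]
      exact h.anti i j hi' hj' hij
  · intro i j hi hj hij
    rcases hstep i hi with hip | ⟨hip, hi'⟩ <;> rcases hstep j hj with hjp | ⟨hjp, hj'⟩
    · rw [hip, hjp, Function.update_self, hmul, sub_self, zero_mul, zero_mul]
      exact hγ'0.le
    · rw [hip] at hij ⊢
      rw [Function.update_self, Function.update_of_ne hjp, heq j hj' hij, sub_self, zero_mul,
        zero_mul]
      exact mul_nonneg (div_pos hγ'0 hwp).le (by linarith [hw j])
    · rw [hjp, Function.update_self, Function.update_of_ne hip, hmul]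
      have h1 := (hold i hi').2
      have h2 : (t i - γ' / w p) * w i * G = ((t i * w p - γ') * w i * G) / w p := by field_simp
      rw [h2, div_le_iff₀ hwp]
      exact h1
    · rw [Function.update_of_ne hip, Function.update_of_ne hjp]
      exact h.gap i j hi' hj' hij

end

/-! ### The rounded matrix -/

theorem det_map_intCast_real {d : ℕ} (A : Matrix (Fin d) (Fin d) ℤ) :
    (intMatrix A).det = ((A.det : ℤ) : ℝ) :=
  ((Int.castRingHom ℝ).map_det A).symm

theorem rank_intMatrix_eq_iff {d : ℕ} (A : Matrix (Fin d) (Fin d) ℤ) :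
    (intMatrix A).rank = d ↔ A.det ≠ 0 := by
  have h1 : A.det ≠ 0 ↔ IsUnit (intMatrix A) := by
    rw [Matrix.isUnit_iff_isUnit_det, det_map_intCast_real, isUnit_iff_ne_zero]
    simp
  rw [h1, ← Matrix.linearIndependent_rows_iff_isUnit, linearIndependent_iff_card_eq_finrank_span,
    Set.finrank, ← Matrix.rank_eq_finrank_span_row, Fintype.card_fin, eq_comm]

theorem mulVec_ne_zero {d : ℕ} {A : Matrix (Fin d) (Fin d) ℤ} (hA : A.det ≠ 0) {x : Fin d → ℤ}
    (hx : x ≠ 0) : A *ᵥ x ≠ 0 := fun h => hx (Matrix.eq_zero_of_mulVec_eq_zero hA h)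

theorem one_le_sum_abs {d : ℕ} {v : Fin d → ℤ} (hv : v ≠ 0) : 1 ≤ ∑ i, |(v i : ℚ)| := by
  obtain ⟨i, hi⟩ := Function.ne_iff.1 hv
  have h1 : (1 : ℚ) ≤ |(v i : ℚ)| := by exact_mod_cast Int.one_le_abs hi
  exact h1.trans (Finset.single_le_sum (f := fun i => |(v i : ℚ)|) (fun _ _ => abs_nonneg _)
    (Finset.mem_univ i))

/-- A matrix that is congruent to the identity modulo `2` is invertible. -/
theorem det_two_mul_add_one_ne_zero {d : ℕ} (R : Matrix (Fin d) (Fin d) ℤ) :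
    (Matrix.of fun l i => 2 * R l i + if l = i then 1 else 0).det ≠ 0 := by
  intro h
  have h1 := (Int.castRingHom (ZMod 2)).map_det
    (Matrix.of fun l i => 2 * R l i + if l = i then 1 else 0)
  have h2 : (Int.castRingHom (ZMod 2)).mapMatrix
      (Matrix.of fun l i => 2 * R l i + if l = i then 1 else 0) = 1 := by
    ext l i
    have h0 : (2 : ZMod 2) = 0 := rfl
    simp only [RingHom.mapMatrix_apply, Matrix.map_apply, Matrix.of_apply, Matrix.one_apply]
    split_ifs <;> simp [h0]
  rw [h, h2, Matrix.det_one] at h1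
  simp at h1

/-- The entry `(l, i)` of the matrix with columns `2 round (G t_i a_i) + e_i`. -/
def roundedEntry (G t a : ℚ) (δ : Prop) [Decidable δ] : ℤ :=
  2 * round (G * t * a) + if δ then 1 else 0

theorem abs_roundedEntry_sub_le (G t a : ℚ) (δ : Prop) [Decidable δ] :
    |(roundedEntry G t a δ : ℚ) - 2 * G * t * a| ≤ 2 := by
  have h := abs_sub_round (G * t * a)
  rw [abs_le] at h ⊢
  unfold roundedEntry
  split_ifs <;> push_cast <;> constructor <;> linarith [h.1, h.2]

section

variable {d n b : ℕ} {x : Fin n → Fin d → ℤ} {A Y : Matrix (Fin d) (Fin d) ℤ}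
  {W : Matrix (Fin d) (Fin d) ℚ} {σ : Fin d → Fin n} {w t : Fin d → ℚ} {G prev γ ε D : ℚ}

/-- The matrix `D • M * W`, where `W` is the inverse of the integer matrix `Y` and `D = |det Y|`,
so that `D • W` is up to sign the adjugate of `Y`. -/
def roundedMatrix (A Y : Matrix (Fin d) (Fin d) ℤ) (t : Fin d → ℚ) (G : ℚ) :
    Matrix (Fin d) (Fin d) ℤ :=
  (Matrix.of fun l i => roundedEntry G (t i) ((A *ᵥ fun j => Y j i) l : ℤ) (l = i)) *
    (Y.det.sign • Y.adjugate)

theorem abs_det_mul_apply (hWY : W * Y.map (Int.cast : ℤ → ℚ) = 1) (i j : Fin d) :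
    |(Y.det : ℚ)| * W i j = ((Y.det.sign • Y.adjugate) i j : ℤ) := by
  have h := congrFun (congrFun (det_smul_eq_adjugate hWY) i) j
  simp only [Matrix.smul_apply, Matrix.map_apply, smul_eq_mul] at h ⊢
  push_cast
  rw [← h, ← mul_assoc]
  congr 1
  exact_mod_cast (Int.sign_mul_self_eq_abs Y.det).symm

theorem roundedMatrix_apply (hWY : W * Y.map (Int.cast : ℤ → ℚ) = 1) (l j : Fin d) :
    (roundedMatrix A Y t G l j : ℚ) = |(Y.det : ℚ)| *
      ∑ i, (roundedEntry G (t i) ((A *ᵥ fun j => Y j i) l : ℤ) (l = i) : ℚ) * W i j := by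
  rw [roundedMatrix, Matrix.mul_apply, Finset.mul_sum, Int.cast_sum]
  simp only [Int.cast_mul]
  refine Finset.sum_congr rfl fun i _ => ?_
  rw [← abs_det_mul_apply hWY, Matrix.of_apply]
  ring

theorem det_roundedMatrix_ne_zero (hY : Y.det ≠ 0) : (roundedMatrix A Y t G).det ≠ 0 := by
  rw [roundedMatrix, Matrix.det_mul]
  refine mul_ne_zero (det_two_mul_add_one_ne_zero _) ?_
  rw [Matrix.det_smul, Matrix.det_adjugate]
  exact mul_ne_zero (pow_ne_zero _ (by simpa using hY)) (pow_ne_zero _ hY)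

theorem abs_roundedMatrix_le (hY : ∀ i j, |Y i j| ≤ 2 ^ b)
    (hw : ∀ i, w i = ∑ l, |((A *ᵥ fun j => Y j i) l : ℚ)|) (hG : 1 ≤ G)
    (ht : GapState w G d t prev γ) (l j : Fin d) :
    |(roundedMatrix A Y t G l j : ℚ)| ≤ d * (4 * G ^ (d + 1) * detBound d b) := by
  have hM (i : Fin d) :
      |(roundedEntry G (t i) ((A *ᵥ fun j => Y j i) l : ℤ) (l = i) : ℚ)| ≤ 4 * G ^ (d + 1) := by
    have h1 := abs_roundedEntry_sub_le G (t i) ((A *ᵥ fun j => Y j i) l : ℤ) (l = i)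
    have hti := ht.ne_zero i
    have h2 : |t i * ((A *ᵥ fun j => Y j i) l : ℤ)| ≤ G ^ d := by
      rw [abs_mul, abs_of_pos (ht.pos i hti).1]
      refine le_trans ?_ ((ht.scaled_le i hti).trans ht.le_pow)
      refine mul_le_mul_of_nonneg_left ?_ (ht.pos i hti).1.le
      rw [hw]
      exact Finset.single_le_sum (f := fun l => |((A *ᵥ fun j => Y j i) l : ℚ)|)
        (fun _ _ => abs_nonneg _) (Finset.mem_univ l)
    have h3 : |2 * G * t i * ((A *ᵥ fun j => Y j i) l : ℤ)| ≤ 2 * G ^ (d + 1) := by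
      rw [mul_assoc (2 * G), abs_mul, abs_of_nonneg (by linarith : 0 ≤ 2 * G), pow_succ]
      nlinarith
    have h4 : 1 ≤ G ^ (d + 1) := one_le_pow₀ hG
    have h5 := abs_sub_abs_le_abs_sub
      (roundedEntry G (t i) ((A *ᵥ fun j => Y j i) l : ℤ) (l = i) : ℚ)
      (2 * G * t i * ((A *ᵥ fun j => Y j i) l : ℤ))
    linarith
  rw [roundedMatrix, Matrix.mul_apply]
  push_cast
  refine (Finset.abs_sum_le_sum_abs _ _).trans ?_
  refine (Finset.sum_le_card_nsmul _ _ (4 * G ^ (d + 1) * detBound d b) fun i _ => ?_).trans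
    (by simp)
  rw [abs_mul]
  refine mul_le_mul (hM i) ?_ (abs_nonneg _) (by positivity)
  rw [Matrix.smul_apply, smul_eq_mul]
  push_cast
  rw [abs_mul]
  have h1 : |(Y.det.sign : ℚ)| ≤ 1 := by
    rcases Int.sign_trichotomy Y.det with h | h | h <;> rw [h] <;> norm_num
  have h2 : |(Y.adjugate i j : ℚ)| ≤ detBound d b := by exact_mod_cast abs_adjugate_le hY i j
  calc |(Y.det.sign : ℚ)| * |(Y.adjugate i j : ℚ)| ≤ 1 * detBound d b :=
        mul_le_mul h1 h2 (abs_nonneg _) zero_le_one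
    _ = _ := one_mul _

/-- The comparison of `A x` with the multiple `(2 G D t_p)⁻¹ A' x`, where `p` is the heaviest column
that occurs in the expansion of `x`: the columns with a factor other than `t_p` are lighter
than `A x` by a factor of `G`. -/
theorem sum_abs_roundedMatrix_sub_le (hY : ∀ i j, |Y i j| ≤ 2 ^ b)
    (hWY : W * Y.map (Int.cast : ℤ → ℚ) = 1)
    (hw : ∀ i, w i = ∑ l, |((A *ᵥ fun j => Y j i) l : ℚ)|) (hG : 1 ≤ G)
    (ht : GapState w G d t prev γ) {y : Fin d → ℤ} (hy : ∀ i, |y i| ≤ 2 ^ b) {p : Fin d}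
    (hmax : ∀ i, (W *ᵥ fun j => (y j : ℚ)) i ≠ 0 → w i ≤ w p)
    (hp : w p ≤ ∑ l, |((A *ᵥ y) l : ℚ)|) :
    ∑ l, |(2 * G * |(Y.det : ℚ)| * t p)⁻¹ * ((roundedMatrix A Y t G *ᵥ y) l : ℤ) - ((A *ᵥ y) l : ℤ)|
      ≤ (d * (d + 1) * detBound d b / G) * ∑ l, |((A *ᵥ y) l : ℚ)| := by
  set c := W *ᵥ fun j => (y j : ℚ) with hc
  set a : Fin d → Fin d → ℚ := fun l i => ((A *ᵥ fun j => Y j i) l : ℤ) with ha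
  set m : Fin d → Fin d → ℚ := fun l i =>
    (roundedEntry G (t i) ((A *ᵥ fun j => Y j i) l : ℤ) (l = i) : ℚ) with hm
  have hG0 : 0 < G := by linarith
  have hD : |(Y.det : ℚ)| ≠ 0 := by
    simpa using det_ne_zero_of_mul_map_eq_one hWY
  have htp := ht.pos p (ht.ne_zero p)
  have hYc (j : Fin d) : (y j : ℚ) = ∑ i, (Y j i : ℚ) * c i := by
    have h1 : Y.map (Int.cast : ℤ → ℚ) *ᵥ c = fun j => (y j : ℚ) := by
      rw [hc, Matrix.mulVec_mulVec, mul_eq_one_comm.1 hWY, Matrix.one_mulVec]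
    exact (congrFun h1 j).symm
  have hAy (l : Fin d) : ((A *ᵥ y) l : ℚ) = ∑ i, c i * a l i := by
    simp only [ha, Matrix.mulVec, dotProduct]
    push_cast
    simp only [hYc, Finset.mul_sum]
    rw [Finset.sum_comm]
    exact Finset.sum_congr rfl fun i _ => Finset.sum_congr rfl fun j _ => by ring
  have hA'y (l : Fin d) : ((roundedMatrix A Y t G *ᵥ y) l : ℚ)
      = |(Y.det : ℚ)| * ∑ i, c i * m l i := by
    simp only [hc, Matrix.mulVec, dotProduct, Int.cast_sum, Int.cast_mul]
    simp only [roundedMatrix_apply hWY, Finset.mul_sum, Finset.sum_mul]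
    rw [Finset.sum_comm]
    exact Finset.sum_congr rfl fun i _ => Finset.sum_congr rfl fun j _ => by
      simp only [hm]; ring
  have hdiff (l : Fin d) :
      (2 * G * |(Y.det : ℚ)| * t p)⁻¹ * ((roundedMatrix A Y t G *ᵥ y) l : ℚ) - ((A *ᵥ y) l : ℚ)
        = ∑ i, c i * ((t i - t p) / t p * a l i + (m l i - 2 * G * t i * a l i) / (2 * G * t p)) := by
    rw [hA'y, hAy, Finset.mul_sum, Finset.mul_sum, ← Finset.sum_sub_distrib]
    refine Finset.sum_congr rfl fun i _ => ?_
    have := htp.1.ne'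
    field_simp
    ring
  have hterm (i : Fin d) : ∑ l, |c i * ((t i - t p) / t p * a l i
      + (m l i - 2 * G * t i * a l i) / (2 * G * t p))| ≤ detBound d b * ((d + 1) * (w p / G)) := by
    by_cases hci : c i = 0
    · simp only [hci, zero_mul, abs_zero, Finset.sum_const_zero]
      have : 0 < w p := by nlinarith
      positivity
    have hip := hmax i hci
    have hanti := ht.anti i p (ht.ne_zero i) (ht.ne_zero p) hip
    have hgap := ht.gap i p (ht.ne_zero i) (ht.ne_zero p) hip
    have hcle : |c i| ≤ detBound d b := abs_mulVec_le hY hWY hy i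
    have hinv : 1 / t p ≤ w p := by
      rw [div_le_iff₀ htp.1]; linarith [htp.2]
    calc ∑ l, |c i * ((t i - t p) / t p * a l i + (m l i - 2 * G * t i * a l i) / (2 * G * t p))|
        ≤ ∑ l, |c i| * ((t i - t p) / t p * |a l i| + 1 / (G * t p)) := by
          refine Finset.sum_le_sum fun l _ => ?_
          rw [abs_mul]
          refine mul_le_mul_of_nonneg_left ((abs_add_le _ _).trans ?_) (abs_nonneg _)
          rw [abs_mul, abs_div, abs_div, abs_of_nonneg (sub_nonneg.2 hanti), abs_of_pos htp.1,
            abs_of_pos (by have := htp.1; positivity : 0 < 2 * G * t p)]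
          have h1 : |m l i - 2 * G * t i * a l i| ≤ 2 := abs_roundedEntry_sub_le _ _ _ _
          have h2 : 1 / (G * t p) = 2 / (2 * G * t p) := by
            have := htp.1.ne'
            field_simp
          rw [h2]
          have := htp.1
          gcongr
      _ = |c i| * ((t i - t p) / t p * w i + d * (1 / t p / G)) := by
          rw [← Finset.mul_sum, Finset.sum_add_distrib, ← Finset.mul_sum, hw i]
          simp only [Finset.sum_const, Finset.card_univ, Fintype.card_fin, nsmul_eq_mul]
          congr 3
          have := htp.1.ne'
          field_simp
      _ ≤ detBound d b * ((d + 1) * (w p / G)) := by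
          have h1 : (t i - t p) / t p * w i ≤ w p / G := by
            rw [le_div_iff₀ hG0]
            have : (t i - t p) / t p * w i * G = (t i - t p) * w i * G / t p := by ring
            rw [this, div_le_iff₀ htp.1]
            linarith
          have h2 : 1 / t p / G ≤ w p / G := by gcongr
          have h3 : (0 : ℚ) ≤ d := Nat.cast_nonneg d
          have h4 : 0 ≤ w p / G := le_trans (by have := htp.1; positivity) h2
          refine mul_le_mul hcle ?_ ?_ (by positivity)
          · nlinarith
          · have h5 : 0 ≤ w i := by rw [hw]; exact Finset.sum_nonneg fun _ _ => abs_nonneg _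
            have h6 : 0 ≤ (t i - t p) / t p := div_nonneg (sub_nonneg.2 hanti) htp.1.le
            have := htp.1
            positivity
  calc ∑ l, |(2 * G * |(Y.det : ℚ)| * t p)⁻¹ * ((roundedMatrix A Y t G *ᵥ y) l : ℚ)
        - ((A *ᵥ y) l : ℚ)|
      ≤ ∑ l, ∑ i, |c i * ((t i - t p) / t p * a l i
          + (m l i - 2 * G * t i * a l i) / (2 * G * t p))| := by
        refine Finset.sum_le_sum fun l _ => ?_
        rw [hdiff]
        exact Finset.abs_sum_le_sum_abs _ _
    _ = ∑ i, ∑ l, |c i * ((t i - t p) / t p * a l i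
          + (m l i - 2 * G * t i * a l i) / (2 * G * t p))| := Finset.sum_comm
    _ ≤ ∑ _i : Fin d, (detBound d b * ((d + 1) * (w p / G)) : ℚ) :=
        Finset.sum_le_sum fun i _ => hterm i
    _ = (d * (d + 1) * detBound d b / G) * w p := by
        simp only [Finset.sum_const, Finset.card_univ, Fintype.card_fin, nsmul_eq_mul]
        ring
    _ ≤ _ := mul_le_mul_of_nonneg_left hp (by positivity)

theorem norm_radialMap_sub_roundedMatrix_le (hY : ∀ i j, |Y i j| ≤ 2 ^ b)
    (hWY : W * Y.map (Int.cast : ℤ → ℚ) = 1)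
    (hw : ∀ i, w i = ∑ l, |((A *ᵥ fun j => Y j i) l : ℚ)|) (hG : 1 ≤ G)
    (hGε : 4 * d ^ 3 * detBound d b ≤ ε * G)
    (ht : GapState w G d t prev γ) {y : Fin d → ℤ} (hy : ∀ i, |y i| ≤ 2 ^ b) (hy0 : y ≠ 0)
    (hmax : ∀ i, (W *ᵥ fun j => (y j : ℚ)) i ≠ 0 → w i ≤ ∑ l, |((A *ᵥ y) l : ℚ)|)
    (hA : A.det ≠ 0) :
    ‖radialMap (intMatrix A) (intPoint y) - radialMap (intMatrix (roundedMatrix A Y t G)) (intPoint y)‖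
      ≤ (ε : ℝ) := by
  set c := W *ᵥ fun j => (y j : ℚ) with hc
  have hne : (Finset.univ.filter fun i => c i ≠ 0).Nonempty := by
    by_contra h
    rw [Finset.not_nonempty_iff_eq_empty, Finset.filter_eq_empty_iff] at h
    have hc0 : c = 0 := funext fun i => not_not.1 (h (Finset.mem_univ i))
    have h1 : Y.map (Int.cast : ℤ → ℚ) *ᵥ c = fun j => (y j : ℚ) := by
      rw [hc, Matrix.mulVec_mulVec, mul_eq_one_comm.1 hWY, Matrix.one_mulVec]
    rw [hc0, Matrix.mulVec_zero] at h1
    apply hy0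
    funext j
    have := congrFun h1 j
    simp only [Pi.zero_apply] at this
    exact_mod_cast this.symm
  obtain ⟨p, hp, hpmax⟩ := Finset.exists_max_image _ w hne
  have hp' : c p ≠ 0 := (Finset.mem_filter.1 hp).2
  have hd : (1 : ℚ) ≤ d := by exact_mod_cast Fin.pos p
  have hD : 0 < |(Y.det : ℚ)| := by
    simpa using det_ne_zero_of_mul_map_eq_one hWY
  have htp := (ht.pos p (ht.ne_zero p)).1
  refine norm_radialMap_sub_le (s := (2 * G * |(Y.det : ℚ)| * t p)⁻¹)
    (η := d * (d + 1) * detBound d b / G) (by positivity) (by positivity)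
    (lt_of_lt_of_le one_pos (one_le_sum_abs (mulVec_ne_zero hA hy0)))
    (sum_abs_roundedMatrix_sub_le hY hWY hw hG ht hy
      (fun i hi => hpmax i (Finset.mem_filter.2 ⟨Finset.mem_univ _, hi⟩)) (hmax p hp')) ?_
  rw [mul_div_assoc', div_le_iff₀ (by linarith)]
  refine le_trans ?_ hGε
  have h1 : (d : ℚ) * (d + 1) ≤ 2 * d ^ 2 := by nlinarith
  have h2 : (0 : ℚ) ≤ d * detBound d b := by positivity
  nlinarith

end

namespace RatProg

open RatProg.Expr

/-! ### Loops -/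

namespace Runs

variable {K : ℕ} {s : Store} {Q R : Store → Prop} {T T' : ℕ} {p q : Prog}

/-- The rule for loops whose body writes only the arrays in `S`. -/
theorem forLoop_same {c h m : ℕ} {S : List ℕ} (P : ℕ → Store → Prop) (hm : s 0 0 h = m)
    (hP : ∀ k s' v, P k s' → P k (s'.write c 0 0 v)) (h0 : P 0 s)
    (hstep : ∀ k < m, ∀ s', Same (c :: S) s s' → s' c 0 0 = k → P k s' →
      Runs K p s' T fun s'' => Same S s' s'' ∧ P (k + 1) s'')
    (hh : h < 10 := by decide) (hc : c ∉ S := by decide) (h0S : 0 ∉ c :: S := by decide) :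
    Runs K (RatProg.forLoop c h p) s ((m + 1) * (T + 100))
      fun s' => Same (c :: S) s s' ∧ P m s' := by
  have hcS : c ∈ c :: S := List.mem_cons_self
  refine (Runs.forLoop (T := T) hh
    (fun k s' => Same (c :: S) s s' ∧ s' c 0 0 = k ∧ P k s') (fun k s' h => h.2.1)
    (fun k s' h => by rw [h.1 0 h0S, hm])
    ⟨(Same.refl _ s).write _ _ _ hcS, by simp [Store.write_self], hP _ _ _ h0⟩ ?_).conseq le_rfl
    fun s' h => ⟨h.1, h.2.2⟩
  rintro k hk s' ⟨h1, h2, h3⟩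
  refine (hstep k hk s' h1 h2 h3).conseq le_rfl ?_
  rintro s'' ⟨h4, h5⟩
  have h6 : Same (c :: S) s s'' :=
    h1.trans h4 (List.Subset.refl _) (List.subset_cons_self _ _)
  exact ⟨by rw [h4 c hc, h2], h6.write _ _ _ hcS, Store.write_self _ _ _ _ _, hP _ _ _ h5⟩

end Runs

/-- Stores the sum of the values of `e`, for the values `0, …, d - 1` of the variable `23`, in the
variable `24`. -/
def sumLoop (e : Expr) : Prog :=
  .seq (set 24 (.lit 0)) (forLoop 23 0 (set 24 (.add (var 24) e)))

theorem Runs.sumLoop {K d L : ℕ} {s : Store} {e : Expr} (f : ℕ → ℚ) (hd : s 0 0 0 = d)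
    (hL : d * (L + 1) + 1 ≤ K) (hf : ∀ i < d, bits (f i) ≤ L)
    (he : ∀ i < d, ∀ s', Same [23, 24] s s' → s' 23 0 0 = i → eval s' e = f i)
    (hw : weight e ≤ 90 := by decide) (hc : cost e ≤ 40 := by decide) :
    Runs K (sumLoop e) s (50 + (d + 1) * 150)
      fun s' => Same [23, 24] s s' ∧ s' 24 0 0 = ∑ i ∈ Finset.range d, f i := by
  have hb (k : ℕ) (hk : k ≤ d) : bits (∑ i ∈ Finset.range k, f i) ≤ K := by
    refine (bits_sum_le f k fun j hj => hf j (by omega)).trans (le_trans ?_ hL)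
    gcongr
  refine Runs.seq (R := fun s' => Same [24] s s' ∧ s' 24 0 0 = 0)
    (Runs.set (v := 0) (by simp [eval]) (fun _ => by rw [bits_zero]; omega)
      ⟨(Same.refl _ _).write _ _ _, Store.write_self _ _ _ _ _⟩) ?_
  rintro s1 ⟨h1, h2⟩
  refine (Runs.forLoop_same (T := 50) (S := [24]) (h := 0) (m := d)
    (fun k s' => s' 24 0 0 = ∑ i ∈ Finset.range k, f i) ?_ ?_ (by simp [h2]) ?_).conseq le_rfl ?_
  · rw [h1 0 (by decide), hd]
  · intro k s' v h
    simpa [Store.write_ne] using h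
  · intro k hk s' h3 h4 h5
    refine Runs.set (v := ∑ i ∈ Finset.range (k + 1), f i) ?_ (fun _ => hb _ hk)
      ⟨(Same.refl _ _).write _ _ _, Store.write_self _ _ _ _ _⟩ ?_ ?_
    · have h6 : Same [23, 24] s s' := h1.trans h3
      rw [Finset.sum_range_succ, eval, eval_var, h5, he k hk s' h6 h4]
    · simp only [weight, var]; omega
    · simp only [cost, var]; omega
  · rintro s2 ⟨h3, h4⟩
    exact ⟨h1.trans h3, h4⟩

/-! ### The images of the points and their norms -/

/-- The `l`-th coordinate of the image of the `k`-th point. -/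
def imageVal (d : ℕ) (s : Store) (k l : ℕ) : ℚ := ∑ j ∈ Finset.range d, s 2 l j * s 1 k j

/-- The `ℓ¹` norm of the image of the `k`-th point. -/
def normVal (d : ℕ) (s : Store) (k : ℕ) : ℚ := ∑ l ∈ Finset.range d, |imageVal d s k l|

/-- Computes the images of the points, in the array `6`, and adds up the absolute values of the
coordinates of the image of the current point `21`. -/
def imageRow : Prog :=
  forLoop 22 0 (.seq (sumLoop (.mul (.read 2 (var 22) (var 23)) (.read 1 (var 21) (var 23))))
    (.seq (.assign 6 (var 21) (var 22) (var 24))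
      (.ite (.lit 0) (var 24) (set 27 (.add (var 27) (var 24)))
        (set 27 (.sub (var 27) (var 24))))))

/-- Stores the images of the points in the array `6`, their norms in the array `7`, and a number
that exceeds all these norms in the variable `8`. -/
def imagePhase : Prog :=
  .seq (set 8 (.lit 1)) (forLoop 21 1 (.seq (set 27 (.lit 0)) (.seq imageRow
    (.seq (.assign 7 (var 21) (.lit 0) (var 27)) (set 8 (.add (var 8) (var 27)))))))

section

variable {K d n L : ℕ} {s : Store}

theorem bits_imageVal_le (h1 : ∀ i j, bits (s 1 i j) ≤ L) (h2 : ∀ i j, bits (s 2 i j) ≤ L)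
    (k l : ℕ) : bits (imageVal d s k l) ≤ d * (2 * L + 1) + 1 := by
  refine bits_sum_le _ d fun j _ => (bits_mul_le _ _).trans ?_
  linarith [h1 k j, h2 l j]

theorem bits_normVal_le (h1 : ∀ i j, bits (s 1 i j) ≤ L) (h2 : ∀ i j, bits (s 2 i j) ≤ L)
    (k : ℕ) : bits (normVal d s k) ≤ d * (d * (2 * L + 1) + 2) + 1 :=
  bits_sum_le _ d fun j _ => by rw [bits_abs]; exact bits_imageVal_le h1 h2 k j

theorem Runs.imageRow {k : ℕ} (hd : s 0 0 0 = d)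
    (h1 : ∀ i j, bits (s 1 i j) ≤ L) (h2 : ∀ i j, bits (s 2 i j) ≤ L)
    (hK : d * (d * (2 * L + 1) + 2) + 1 ≤ K) (hk : s 21 0 0 = k) (h27 : s 27 0 0 = 0) :
    Runs K imageRow s ((d + 1) * (50 + (d + 1) * 150 + 250)) fun s' =>
      Same [22, 23, 24, 6, 27] s s' ∧ (∀ l < d, s' 6 k l = imageVal d s k l) ∧
      (∀ k' l, k' ≠ k → s' 6 k' l = s 6 k' l) ∧ s' 27 0 0 = normVal d s k := by
  refine (Runs.forLoop_same (T := 50 + (d + 1) * 150 + 150) (S := [23, 24, 6, 27]) (h := 0) (m := d)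
    (fun m s' => (∀ l < m, s' 6 k l = imageVal d s k l) ∧
      (∀ k' l, k' ≠ k → s' 6 k' l = s 6 k' l) ∧
      s' 27 0 0 = ∑ l ∈ Finset.range m, |imageVal d s k l|) hd ?_ ?_ ?_).conseq le_rfl ?_
  · intro m s' v h
    simpa [Store.write_ne] using h
  · simp [h27]
  · rintro m hm s1 hs1 h22 ⟨h3, h4, h5⟩
    have hdK : d * (2 * L + 1) + 1 ≤ K := by
      have : 1 ≤ d := by omega
      nlinarith
    refine (Runs.seq (T := 50 + (d + 1) * 150) (T' := 150) (Runs.sumLoop (d := d) (L := 2 * L)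
      (fun j => s 2 m j * s 1 k j)
      (by rw [hs1 0 (by decide), hd]) hdK (fun j _ => (bits_mul_le _ _).trans ?_) ?_)
      ?_)
    · linarith [h1 k j, h2 m j]
    · intro i hi s2 hs2 h23
      have h21 : s2 21 0 0 = k := by rw [hs2 21 (by decide), hs1 21 (by decide), hk]
      have h22' : s2 22 0 0 = m := by rw [hs2 22 (by decide), h22]
      simp [eval, eval_var, h21, h22', h23, hs2 1 (by decide), hs1 1 (by decide),
        hs2 2 (by decide), hs1 2 (by decide)]
    rintro s2 ⟨hs2, h24⟩
    have h21 : s2 21 0 0 = k := by rw [hs2 21 (by decide), hs1 21 (by decide), hk]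
    have h22' : s2 22 0 0 = m := by rw [hs2 22 (by decide), h22]
    have h24' : s2 24 0 0 = imageVal d s k m := h24
    refine Runs.seq (T := 50) (T' := 100) (R := fun s3 => s3 = s2.write 6 k m (imageVal d s k m))
      (Runs.assign (by simp [eval_var, h21]) (by simp [eval_var, h22']) (by rw [eval_var, h24'])
        (fun _ => (bits_imageVal_le h1 h2 k m).trans hdK) rfl) ?_
    rintro s3 rfl
    have hb (i : ℕ) (hi : i ≤ d) : bits (∑ l ∈ Finset.range i, |imageVal d s k l|) ≤ K := by
      refine (bits_sum_le _ i fun j _ => ?_).trans (le_trans (Nat.add_le_add_right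
        (Nat.mul_le_mul_right (d * (2 * L + 1) + 1 + 1) hi) 1) hK)
      rw [bits_abs]
      exact bits_imageVal_le h1 h2 k j
    have hfin {v : ℚ} (hv : v = ∑ l ∈ Finset.range (m + 1), |imageVal d s k l|) :
        Same [23, 24, 6, 27] s1 ((s2.write 6 k m (imageVal d s k m)).write 27 0 0 v) ∧
        (∀ l < m + 1, ((s2.write 6 k m (imageVal d s k m)).write 27 0 0 v) 6 k l
          = imageVal d s k l) ∧
        (∀ k' l, k' ≠ k → ((s2.write 6 k m (imageVal d s k m)).write 27 0 0 v) 6 k' l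
          = s 6 k' l) ∧ ((s2.write 6 k m (imageVal d s k m)).write 27 0 0 v) 27 0 0
          = ∑ l ∈ Finset.range (m + 1), |imageVal d s k l| := by
      have h6 : Same [23, 24, 6, 27] s1 s2 := hs2.trans (Same.refl [] s2)
      refine ⟨(h6.write _ _ _).write _ _ _, fun l hl => ?_, fun k' l hkl => ?_, ?_⟩
      · rw [Store.write_ne _ (by decide), Store.write_same]
        split_ifs with h
        · rw [h.2]
        · rw [hs2 6 (by decide), h3 l (by omega)]
      · rw [Store.write_ne _ (by decide), Store.write_same, if_neg (fun h => hkl h.1),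
          hs2 6 (by decide), h4 k' l hkl]
      · rw [Store.write_self, hv]
    have h27' : (s2.write 6 k m (imageVal d s k m)) 27 0 0
        = ∑ l ∈ Finset.range m, |imageVal d s k l| := by
      rw [Store.write_ne _ (by decide), hs2 27 (by decide), h5]
    have h24'' : (s2.write 6 k m (imageVal d s k m)) 24 0 0 = imageVal d s k m := by
      rw [Store.write_ne _ (by decide), h24']
    refine Runs.ite (T := 50) (u := 0) (v := imageVal d s k m) (by simp [eval])
      (by rw [eval_var, h24'']) (fun hpos => ?_) (fun hneg => ?_)
    · refine Runs.set (v := ∑ l ∈ Finset.range (m + 1), |imageVal d s k l|) ?_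
        (fun _ => hb _ hm) (hfin rfl)
      rw [eval, eval_var, eval_var, h27', h24'', Finset.sum_range_succ, abs_of_nonneg hpos]
    · refine Runs.set (v := ∑ l ∈ Finset.range (m + 1), |imageVal d s k l|) ?_
        (fun _ => hb _ hm) (hfin rfl)
      rw [eval, eval_var, eval_var, h27', h24'', Finset.sum_range_succ, abs_of_neg hneg,
        sub_eq_add_neg]
  · rintro s' ⟨h3, h4, h5, h6⟩
    exact ⟨h3, h4, h5, h6⟩

theorem Runs.imagePhase (hd : s 0 0 0 = d) (hn : s 0 0 1 = n)
    (h1 : ∀ i j, bits (s 1 i j) ≤ L) (h2 : ∀ i j, bits (s 2 i j) ≤ L)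
    (hK : n * (d * (d * (2 * L + 1) + 2) + 2) + 3 ≤ K) :
    Runs K imagePhase s (50 + (n + 1) * ((d + 1) * (50 + (d + 1) * 150 + 250) + 250)) fun s' =>
      Same [8, 21, 27, 22, 23, 24, 6, 7] s s' ∧
      (∀ k < n, ∀ l < d, s' 6 k l = imageVal d s k l) ∧ (∀ k < n, s' 7 k 0 = normVal d s k) ∧
      s' 8 0 0 = 1 + ∑ k ∈ Finset.range n, normVal d s k := by
  have hb1 (k : ℕ) (hk : k ≤ n) : bits (1 + ∑ i ∈ Finset.range k, normVal d s i) ≤ K := by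
    have h3 := bits_sum_le (normVal d s) k fun j _ => bits_normVal_le (d := d) h1 h2 j
    have h4 := bits_add_le 1 (∑ i ∈ Finset.range k, normVal d s i)
    have h5 := Nat.mul_le_mul_right (d * (d * (2 * L + 1) + 2) + 1 + 1) hk
    rw [bits_one] at h4
    linarith
  refine Runs.seq (R := fun s' => Same [8] s s' ∧ s' 8 0 0 = 1)
    (Runs.set (v := 1) (by simp [eval]) (fun _ => by rw [bits_one]; omega)
      ⟨(Same.refl _ _).write _ _ _, Store.write_self _ _ _ _ _⟩) ?_
  rintro s0 ⟨hs0, h80⟩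
  refine (Runs.forLoop_same (T := 50 + ((d + 1) * (50 + (d + 1) * 150 + 250) + 100))
    (S := [27, 22, 23, 24, 6, 7, 8]) (h := 1) (m := n)
    (fun m s' => (∀ k < m, ∀ l < d, s' 6 k l = imageVal d s k l) ∧
      (∀ k < m, s' 7 k 0 = normVal d s k) ∧ s' 8 0 0 = 1 + ∑ k ∈ Finset.range m, normVal d s k)
    (by rw [hs0 0 (by decide), hn]) ?_ ?_ ?_).conseq (le_of_eq (by ring)) ?_
  · intro m s' v h
    simpa [Store.write_ne] using h
  · simp [h80]
  · rintro k hk s1 hs1 h21 ⟨h3, h4, h5⟩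
    have hs01 : Same [8, 21, 27, 22, 23, 24, 6, 7] s s1 := hs0.trans hs1
    have hdK : d * (d * (2 * L + 1) + 2) + 1 ≤ K := by
      have : 1 ≤ n := by omega
      nlinarith
    refine Runs.seq (R := fun s' => Same [27] s1 s' ∧ s' 27 0 0 = 0)
      (Runs.set (v := 0) (by simp [eval]) (fun _ => by rw [bits_zero]; omega)
        ⟨(Same.refl _ _).write _ _ _, Store.write_self _ _ _ _ _⟩) ?_
    rintro s2 ⟨hs2, h27⟩
    have hi : imageVal d s2 = imageVal d s := by
      funext k l
      simp only [imageVal, hs2 1 (by decide), hs2 2 (by decide), hs01 1 (by decide),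
        hs01 2 (by decide)]
    have hnv : normVal d s2 = normVal d s := by
      funext k
      simp only [normVal, hi]
    refine Runs.seq (Runs.imageRow (d := d) (L := L) (k := k)
      (by rw [hs2 0 (by decide), hs01 0 (by decide), hd])
      (by rw [hs2 1 (by decide), hs01 1 (by decide)]; exact h1)
      (by rw [hs2 2 (by decide), hs01 2 (by decide)]; exact h2) hdK
      (by rw [hs2 21 (by decide), h21]) h27) ?_
    rintro s3 ⟨hs3, h6, h7, h8⟩
    rw [hi] at h6
    rw [hnv] at h8
    have h21' : s3 21 0 0 = k := by rw [hs3 21 (by decide), hs2 21 (by decide), h21]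
    have hs13 : Same [27, 22, 23, 24, 6, 7, 8] s1 s3 := hs2.trans hs3
    refine Runs.seq (T := 50) (T' := 50) (R := fun s' => s' = s3.write 7 k 0 (normVal d s k))
      (Runs.assign (by simp [eval_var, h21']) (by simp [eval]) (by rw [eval_var, h8])
        (fun _ => (bits_normVal_le h1 h2 k).trans hdK) rfl) ?_
    rintro s4 rfl
    refine Runs.set (v := 1 + ∑ i ∈ Finset.range (k + 1), normVal d s i) ?_ (fun _ => hb1 _ hk)
      ⟨(hs13.write _ _ _).write _ _ _, ?_, ?_, Store.write_self _ _ _ _ _⟩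
    · rw [eval, eval_var, eval_var, Store.write_ne _ (by decide), Store.write_ne _ (by decide), h8,
        hs3 8 (by decide), hs2 8 (by decide), h5, Finset.sum_range_succ, add_assoc]
    · intro k' hk' l hl
      rw [Store.write_ne _ (by decide), Store.write_ne _ (by decide)]
      rcases eq_or_ne k' k with rfl | hne
      · exact h6 l hl
      · rw [h7 k' l hne, hs2 6 (by decide), h3 k' (by omega) l hl]
    · intro k' hk'
      rw [Store.write_ne _ (by decide), Store.write_same]
      rcases eq_or_ne k' k with rfl | hne
      · simp
      · rw [if_neg (fun h => hne h.1), hs3 7 (by decide), hs2 7 (by decide), h4 k' (by omega)]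
  · rintro s' ⟨hs', h3, h4, h5⟩
    exact ⟨hs0.trans hs', h3, h4, h5⟩

end


/-! ### Filling arrays, and the auxiliary constants -/

section

variable {K d n L T : ℕ} {s : Store}

theorem Runs.fillCol {c a : ℕ} {S : List ℕ} {q : Prog} (f : ℕ → ℚ) (hd : s 0 0 0 = d)
    (hbody : ∀ i < d, ∀ s', Same (c :: S) s s' → s' c 0 0 = i →
      Runs K q s' T fun s'' => Same S s' s'' ∧ s'' a i 0 = f i ∧
        ∀ i', i' ≠ i → s'' a i' 0 = s' a i' 0)
    (hc : c ∉ S := by decide) (h0S : 0 ∉ c :: S := by decide) (hca : a ≠ c := by decide) :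
    Runs K (RatProg.forLoop c 0 q) s ((d + 1) * (T + 100)) fun s' =>
      Same (c :: S) s s' ∧ ∀ i < d, s' a i 0 = f i := by
  refine Runs.forLoop_same (fun m s' => ∀ i < m, s' a i 0 = f i) hd ?_ (by simp) ?_
    (by decide) hc h0S
  · intro m s' v h
    rwa [Store.write_ne _ hca]
  · intro m hm s1 hs1 h1 h2
    refine (hbody m hm s1 hs1 h1).conseq le_rfl ?_
    rintro s2 ⟨h3, h4, h5⟩
    refine ⟨h3, fun i hi => ?_⟩
    rcases eq_or_ne i m with rfl | hne
    · exact h4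
    · rw [h5 i hne, h2 i (by omega)]

theorem Runs.fillMatrix {c₁ c₂ a : ℕ} {S : List ℕ} {q : Prog} (f : ℕ → ℕ → ℚ) (hd : s 0 0 0 = d)
    (hbody : ∀ i < d, ∀ j < d, ∀ s', Same (c₁ :: c₂ :: S) s s' → s' c₁ 0 0 = i → s' c₂ 0 0 = j →
      s' a i j = s a i j →
      Runs K q s' T fun s'' => Same S s' s'' ∧ s'' a i j = f i j ∧
        ∀ i' j', ¬ (i' = i ∧ j' = j) → s'' a i' j' = s' a i' j')
    (hc₁ : c₁ ∉ c₂ :: S := by decide) (hc₂ : c₂ ∉ S := by decide)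
    (h0S : 0 ∉ c₁ :: c₂ :: S := by decide) (hca : a ≠ c₁ ∧ a ≠ c₂ := by decide) :
    Runs K (RatProg.forLoop c₁ 0 (RatProg.forLoop c₂ 0 q)) s ((d + 1) * ((d + 1) * (T + 100) + 100)) fun s' =>
      Same (c₁ :: c₂ :: S) s s' ∧ ∀ i < d, ∀ j < d, s' a i j = f i j := by
  refine (Runs.forLoop_same (fun m s' => (∀ i < m, ∀ j < d, s' a i j = f i j) ∧
    ∀ i, m ≤ i → ∀ j, s' a i j = s a i j) hd ?_ (by simp) ?_ (by decide) hc₁ h0S).conseq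
      le_rfl fun s' h => ⟨h.1, h.2.1⟩
  · intro m s' v h
    rwa [Store.write_ne _ hca.1]
  rintro i hi s1 hs1 h1 ⟨h2, h3⟩
  have h0S' : 0 ∉ c₂ :: S := fun h => h0S (List.mem_cons_of_mem _ h)
  refine (Runs.forLoop_same (fun m s' => (∀ j < m, s' a i j = f i j) ∧
    (∀ j, m ≤ j → s' a i j = s a i j) ∧ ∀ i' j, i' ≠ i → s' a i' j = s1 a i' j)
    (by rw [hs1 0 h0S, hd]) ?_ (by simpa using h3 i le_rfl) ?_ (by decide) hc₂ h0S').conseq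
      le_rfl ?_
  · intro m s' v h
    rwa [Store.write_ne _ hca.2]
  · rintro j hj s2 hs2 h4 ⟨h5, h6, h7⟩
    have hs : Same (c₁ :: c₂ :: S) s s2 :=
      hs1.trans hs2 (List.Subset.refl _) (List.subset_cons_self _ _)
    refine (hbody i hi j hj s2 hs (by rw [hs2 c₁ hc₁, h1]) h4 (h6 j le_rfl)).conseq le_rfl ?_
    rintro s3 ⟨h8, h9, h10⟩
    refine ⟨h8, fun j' hj' => ?_, fun j' hj' => ?_, fun i' j' hi' => ?_⟩
    · rcases eq_or_ne j' j with rfl | hne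
      · exact h9
      · rw [h10 i j' (fun h => hne h.2), h5 j' (by omega)]
    · rw [h10 i j' (fun h => by omega), h6 j' (by omega)]
    · rw [h10 i' j' (fun h => hi' h.1), h7 i' j' hi']
  · rintro s2 ⟨hs2, h4, -, h6⟩
    refine ⟨hs2, fun i' hi' j hj => ?_, fun i' hi' j => ?_⟩
    · rcases eq_or_ne i' i with rfl | hne
      · exact h4 j hj
      · rw [h6 i' j hne, h2 i' (by omega) j hj]
    · rw [h6 i' j (by omega), h3 i' (by omega)]

/-- Copies the matrix to the output and sets the variable `5` to `1` if the matrix has an entry of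
absolute value greater than `1`. -/
def copyPhase : Prog :=
  forLoop 21 0 (forLoop 22 0 (.seq (.assign 3 (var 21) (var 22) (.read 2 (var 21) (var 22)))
    (.ite (.mul (.read 2 (var 21) (var 22)) (.read 2 (var 21) (var 22))) (.lit 1) .skip
      (set 5 (.lit 1)))))

theorem Runs.copyPhase (hd : s 0 0 0 = d) (h5 : s 5 0 0 = 0) :
    Runs K copyPhase s ((d + 1) * ((d + 1) * 250 + 100)) fun s' =>
      Same [21, 22, 3, 5] s s' ∧ (∀ i < d, ∀ j < d, s' 3 i j = s 2 i j) ∧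
      ((s' 5 0 0 = 0 ∧ ∀ i < d, ∀ j < d, s 2 i j * s 2 i j ≤ 1) ∨
        (s' 5 0 0 = 1 ∧ ∃ i < d, ∃ j < d, 1 < s 2 i j * s 2 i j)) := by
  -- The value of the flag after the entries that satisfy `F` have been inspected.
  let flag (F : ℕ → ℕ → Prop) (s' : Store) : Prop :=
    (s' 5 0 0 = 0 ∧ ∀ i j, F i j → s 2 i j * s 2 i j ≤ 1) ∨
      (s' 5 0 0 = 1 ∧ ∃ i < d, ∃ j < d, 1 < s 2 i j * s 2 i j)
  refine (Runs.forLoop_same (S := [22, 3, 5]) (T := (d + 1) * 250)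
    (fun m s' => (∀ i < m, ∀ j < d, s' 3 i j = s 2 i j) ∧ flag (fun i j => i < m ∧ j < d) s')
    hd ?_ ⟨by simp, Or.inl ⟨h5, by simp⟩⟩ ?_).conseq le_rfl ?_
  · intro m s' v h
    simpa [Store.write_ne, flag] using h
  · rintro i hi s1 hs1 h21 ⟨h1, h2⟩
    refine (Runs.forLoop_same (S := [3, 5]) (T := 50 + (50 + 50))
      (fun m s' => (∀ j < m, s' 3 i j = s 2 i j) ∧ (∀ i' j, i' ≠ i → s' 3 i' j = s1 3 i' j) ∧
        flag (fun i' j => i' < i ∧ j < d ∨ i' = i ∧ j < m) s')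
      (by rw [hs1 0 (by decide), hd]) ?_ ⟨by simp, by simp, by simpa using h2⟩ ?_).conseq le_rfl ?_
    · intro m s' v h
      simpa [Store.write_ne, flag] using h
    · rintro j hj s2 hs2 h22 ⟨h3, h4, h5'⟩
      have h21' : s2 21 0 0 = i := by rw [hs2 21 (by decide), h21]
      have h2A (i j : ℕ) : s2 2 i j = s 2 i j := by rw [hs2 2 (by decide), hs1 2 (by decide)]
      refine Runs.seq (T := 50) (T' := 50 + 50) (R := fun s' => s' = s2.write 3 i j (s 2 i j))
        (Runs.assign (by simp [eval_var, h21']) (by simp [eval_var, h22])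
        (by simp [eval, eval_var, h21', h22, h2A]) (fun hs => ?_) rfl) ?_
      · rw [← h2A]; exact hs 2 i j
      rintro s3 rfl
      have h6 : ∀ j' < j + 1, (s2.write 3 i j (s 2 i j)) 3 i j' = s 2 i j' := by
        intro j' hj'
        rw [Store.write_same]
        split_ifs with h
        · rw [h.2]
        · exact h3 j' (by omega)
      have h7 (i' j' : ℕ) (hi' : i' ≠ i) : (s2.write 3 i j (s 2 i j)) 3 i' j' = s1 3 i' j' := by
        rw [Store.write_same, if_neg (fun h => hi' h.1), h4 i' j' hi']
      have h8 : Same [3, 5] s2 (s2.write 3 i j (s 2 i j)) := (Same.refl _ _).write _ _ _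
      refine Runs.ite (T := 50) (u := s 2 i j * s 2 i j) (v := 1) ?_ (by simp [eval])
        (fun hle => ?_) (fun hlt => ?_)
      · simp [eval, eval_var, Store.write_ne, h21', h22, h2A]
      · refine (Runs.skip ⟨h8, h6, h7, ?_⟩).conseq (by norm_num) fun _ h => h
        simp only [flag, Store.write_ne _ (show 5 ≠ 3 by decide)]
        refine h5'.imp_left fun h => ⟨h.1, fun i' j' h' => ?_⟩
        rcases h' with h' | ⟨rfl, h'⟩
        · exact h.2 i' j' (Or.inl h')
        · rcases Nat.lt_succ_iff_lt_or_eq.1 h' with h' | rfl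
          · exact h.2 i' j' (Or.inr ⟨rfl, h'⟩)
          · exact hle
      · refine Runs.set (v := 1) (by simp [eval]) (fun hs => ?_)
          ⟨h8.write _ _ _, ?_, ?_, Or.inr ⟨Store.write_self _ _ _ _ _, i, hi, j, hj, hlt⟩⟩
        · rw [bits_one]; exact (one_le_bits _).trans (hs 0 0 0)
        · rw [Store.write_ne _ (by decide)]; exact h6
        · rw [Store.write_ne _ (by decide)]; exact h7
    · rintro s2 ⟨hs2, h3, h4, h6⟩
      refine ⟨hs2, fun i' hi' j hj => ?_, ?_⟩
      · rcases eq_or_ne i' i with rfl | hne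
        · exact h3 j hj
        · rw [h4 i' j hne, h1 i' (by omega) j hj]
      · refine h6.imp_left fun h => ⟨h.1, fun i' j h' => h.2 i' j ?_⟩
        omega
  · rintro s' ⟨h1, h2, h3⟩
    exact ⟨h1, h2, h3.imp_left fun h => ⟨h.1, fun i hi j hj => h.2 i j ⟨hi, hj⟩⟩⟩

/-- Stores `4 d³ (2 d B)ᵈ N` in the variable `25`, where `N` is the variable `4`. -/
def gapPhase : Prog :=
  .seq (set 26 (.lit 1)) (.seq
    (forLoop 21 0 (set 26 (.mul (var 26)
      (.mul (.lit 2) (.mul (.read 0 (.lit 0) (.lit 0)) (.read 0 (.lit 0) (.lit 2)))))))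
    (set 25 (.mul (.mul (.lit 4) (.mul (.read 0 (.lit 0) (.lit 0))
      (.mul (.read 0 (.lit 0) (.lit 0)) (.read 0 (.lit 0) (.lit 0))))) (.mul (var 26) (var 4)))))

theorem Runs.gapPhase {B N : ℚ} (hd : s 0 0 0 = d) (hB : s 0 0 2 = B) (hN : s 4 0 0 = N)
    (hbd : bits (d : ℚ) ≤ L) (hbB : bits B ≤ L) (hbN : bits N ≤ L) (hL : 2 ≤ L)
    (hK : d * (3 * L) + 8 * L ≤ K) :
    Runs K gapPhase s (50 + ((d + 1) * 150 + 50)) fun s' =>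
      Same [26, 21, 25] s s' ∧ s' 25 0 0 = 4 * d ^ 3 * ((2 * d * B) ^ d * N) ∧
      bits (s' 25 0 0) ≤ d * (3 * L) + 8 * L := by
  have h2 : bits (2 : ℚ) ≤ 2 := by
    have := bits_natCast_le (z := 2) (K := 2) (by norm_num) (by norm_num)
    simpa using this
  have h4 : bits (4 : ℚ) ≤ 3 := by
    have := bits_natCast_le (z := 4) (K := 3) (by norm_num) (by norm_num)
    simpa using this
  have hb2 : bits (2 * d * B) ≤ 3 * L := by
    have h5 := bits_mul_le (2 * d) B
    have h6 := bits_mul_le 2 (d : ℚ)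
    omega
  have hpow (m : ℕ) : bits ((2 * d * B) ^ m) ≤ m * (3 * L) + 1 := by
    induction m with
    | zero => simp [bits_one]
    | succ m ih =>
      rw [pow_succ]
      have := bits_mul_le ((2 * d * B) ^ m) (2 * d * B)
      rw [Nat.succ_mul]
      omega
  have hpowK (m : ℕ) (hm : m ≤ d) : bits ((2 * d * B) ^ m) ≤ K := by
    have := Nat.mul_le_mul_right (3 * L) hm
    have := hpow m
    omega
  refine Runs.seq (R := fun s' => Same [26] s s' ∧ s' 26 0 0 = 1)
    (Runs.set (v := 1) (by simp [eval]) (fun _ => by rw [bits_one]; omega)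
      ⟨(Same.refl _ _).write _ _ _, Store.write_self _ _ _ _ _⟩) ?_
  rintro s0 ⟨hs0, h26⟩
  refine Runs.seq (Runs.forLoop_same (S := [26]) (T := 50)
    (fun m s' => s' 26 0 0 = (2 * d * B) ^ m) (by rw [hs0 0 (by decide), hd]) ?_ (by simp [h26]) ?_)
    ?_
  · intro m s' v h
    simpa [Store.write_ne] using h
  · intro m hm s1 hs1 h21 h
    refine Runs.set (v := (2 * d * B) ^ (m + 1)) ?_ (fun _ => hpowK _ hm)
      ⟨(Same.refl _ _).write _ _ _, Store.write_self _ _ _ _ _⟩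
    simp [eval, eval_var, h, hs1 0 (by decide), hs0 0 (by decide), hd, hB, pow_succ, mul_assoc]
  · rintro s1 ⟨hs1, h1⟩
    have hbG : bits (4 * d ^ 3 * ((2 * d * B) ^ d * N)) ≤ d * (3 * L) + 8 * L := by
      have h5 := bits_mul_le (4 * d ^ 3 : ℚ) ((2 * d * B) ^ d * N)
      have h6 := bits_mul_le 4 (d ^ 3 : ℚ)
      have h7 := bits_mul_le ((2 * d * B) ^ d) N
      have h8 := bits_mul_le (d : ℚ) (d * d)
      have h9 := bits_mul_le (d : ℚ) d
      have h10 := hpow d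
      have h11 : (d ^ 3 : ℚ) = d * (d * d) := by ring
      rw [← h11] at h8
      omega
    refine Runs.set (v := 4 * d ^ 3 * ((2 * d * B) ^ d * N)) ?_ (fun _ => hbG.trans hK)
      ⟨(hs0.trans hs1).write _ _ _, Store.write_self _ _ _ _ _, by rwa [Store.write_self]⟩
    simp only [eval, eval_var, h1, hs1 0 (by decide), hs0 0 (by decide), hd, hs1 4 (by decide),
      hs0 4 (by decide), hN, Int.cast_zero, Nat.floor_zero]
    push_cast
    ring

/-- Starts with the standard basis: the array `9` holds the inverse matrix, `10` the weights and the
variable `12` the determinant. -/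
def basisPhase : Prog :=
  .seq (set 12 (.lit 1)) (forLoop 22 0 (.seq (.assign 9 (var 22) (var 22) (.lit 1))
    (.assign 10 (var 22) (.lit 0) (var 8))))

theorem Runs.basisPhase (hd : s 0 0 0 = d) (h9 : ∀ i j, s 9 i j = 0) :
    Runs K basisPhase s (50 + (d + 1) * 200) fun s' =>
      Same [12, 22, 9, 10] s s' ∧ s' 12 0 0 = 1 ∧
      (∀ i < d, ∀ j < d, s' 9 i j = if i = j then 1 else 0) ∧ ∀ i < d, s' 10 i 0 = s 8 0 0 := by
  have h1K (s' : Store) (hs : Bdd K s') : bits 1 ≤ K := by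
    rw [bits_one]; exact (one_le_bits _).trans (hs 0 0 0)
  refine Runs.seq (R := fun s' => Same [12] s s' ∧ s' 12 0 0 = 1)
    (Runs.set (v := 1) (by simp [eval]) (h1K _)
      ⟨(Same.refl _ _).write _ _ _, Store.write_self _ _ _ _ _⟩) ?_
  rintro s0 ⟨hs0, h12⟩
  refine (Runs.forLoop_same (S := [9, 10]) (T := 50 + 50)
    (fun m s' => (∀ i j, s' 9 i j = if i = j ∧ i < m then 1 else 0) ∧
      ∀ i < m, s' 10 i 0 = s 8 0 0) (by rw [hs0 0 (by decide), hd]) ?_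
    ⟨by simp [hs0 9 (by decide), h9], by simp⟩ ?_).conseq le_rfl ?_
  · intro m s' v h
    simpa [Store.write_ne] using h
  · rintro m hm s1 hs1 h22 ⟨h1, h2⟩
    refine Runs.seq (R := fun s' => s' = s1.write 9 m m 1)
      (Runs.assign (by simp [eval_var, h22]) (by simp [eval_var, h22]) (by simp [eval]) (h1K _)
        rfl) ?_
    rintro s2 rfl
    have h8 : s1 8 0 0 = s 8 0 0 := by rw [hs1 8 (by decide), hs0 8 (by decide)]
    refine Runs.assign (i' := m) (j' := 0) (v := s 8 0 0) (by simp [eval_var, Store.write_ne, h22])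
      (by simp [eval]) (by simp [eval_var, Store.write_ne, h8]) (fun hs => ?_)
      ⟨((Same.refl _ _).write _ _ _).write _ _ _, fun i j => ?_, fun i hi => ?_⟩
    · have := hs 8 0 0
      rwa [Store.write_ne _ (by decide), h8] at this
    · rw [Store.write_ne _ (by decide), Store.write_same, h1]
      split_ifs <;> first | rfl | (exfalso; omega)
    · rw [Store.write_same, Store.write_ne _ (by decide)]
      by_cases him : i = m
      · simp [him]
      · rw [if_neg (fun h => him h.1), h2 i (by omega)]
  · rintro s' ⟨hs', h1, h2⟩
    refine ⟨hs0.trans hs', by rw [hs' 12 (by decide), h12], fun i hi j _ => ?_, h2⟩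
    rw [h1]
    simp [hi]

end


/-! ### Computing the greedy basis -/

/-- The leading `d × d` block of the array `a`. -/
def storeMat (d : ℕ) (s : Store) (a : ℕ) : Matrix (Fin d) (Fin d) ℚ := Matrix.of fun i j => s a i j

/-- The first `d` entries of the column `0` of the array `a`. -/
def storeVec (d : ℕ) (s : Store) (a : ℕ) : Fin d → ℚ := fun i => s a i 0

/-- Stores the coordinates of the current point `21` with respect to the current basis in the
array `13`. -/
def coordPhase : Prog :=
  forLoop 22 0 (.seq (sumLoop (.mul (.read 9 (var 22) (var 23)) (.read 1 (var 21) (var 23))))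
    (.assign 13 (var 22) (.lit 0) (var 24)))

/-- Finds the heaviest basis vector that occurs in the current point: its weight in the
variable `14`, its index in the variable `15`. -/
def pivotSearch : Prog :=
  .seq (set 14 (.lit 0)) (.seq (set 15 (.lit 0)) (forLoop 22 0
    (.ite (.mul (.read 13 (var 22) (.lit 0)) (.read 13 (var 22) (.lit 0))) (.lit 0) .skip
      (.ite (.read 10 (var 22) (.lit 0)) (var 14) .skip
        (.seq (set 14 (.read 10 (var 22) (.lit 0))) (set 15 (var 22)))))))

/-- Divides the pivot row by the pivot, into the array `16`, and updates the determinant. -/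
def pivotRow : Prog :=
  .seq (forLoop 23 0 (.assign 16 (var 23) (.lit 0)
      (.div (.read 9 (var 15) (var 23)) (.read 13 (var 15) (.lit 0)))))
    (.ite (.lit 0) (.read 13 (var 15) (.lit 0))
      (set 12 (.mul (var 12) (.read 13 (var 15) (.lit 0))))
      (set 12 (.mul (var 12) (.sub (.lit 0) (.read 13 (var 15) (.lit 0))))))

/-- The update of the inverse matrix of the basis when the basis vector `15` is replaced by the
current point. -/
def rankOneUpdate : Prog :=
  .seq (.assign 13 (var 15) (.lit 0) (.sub (.read 13 (var 15) (.lit 0)) (.lit 1)))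
    (forLoop 22 0 (forLoop 23 0 (.assign 9 (var 22) (var 23)
      (.sub (.read 9 (var 22) (var 23))
        (.mul (.read 13 (var 22) (.lit 0)) (.read 16 (var 23) (.lit 0)))))))

/-- Replaces the basis vector `15` by the current point `21`. -/
def exchangeStep : Prog :=
  .seq pivotRow (.seq rankOneUpdate
    (.seq (.assign 10 (var 15) (.lit 0) (.read 7 (var 21) (.lit 0)))
      (.assign 11 (var 15) (.lit 0) (var 21))))

/-- Runs over all points and keeps a basis of least weight. -/
def exchangePhase : Prog :=
  forLoop 21 1 (.seq coordPhase (.seq pivotSearch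
    (.ite (var 14) (.read 7 (var 21) (.lit 0)) .skip exchangeStep)))

section

variable {K d n L : ℕ} {s : Store}

theorem Runs.coordPhase {k : ℕ} (hd : s 0 0 0 = d) (hk : s 21 0 0 = k) (hkL : ∀ j, bits (s 1 k j) ≤ L)
    (h9 : ∀ i < d, ∀ j < d, bits (s 9 i j) ≤ L) (hK : d * (2 * L + 1) + 1 ≤ K) :
    Runs K coordPhase s ((d + 1) * (50 + (d + 1) * 150 + 50 + 100)) fun s' =>
      Same [22, 23, 24, 13] s s' ∧
      ∀ i < d, s' 13 i 0 = ∑ j ∈ Finset.range d, s 9 i j * s 1 k j := by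
  refine Runs.fillCol (S := [23, 24, 13]) (fun i => ∑ j ∈ Finset.range d, s 9 i j * s 1 k j)
    hd fun i hi s1 hs1 h22 => ?_
  have hb (j : ℕ) (hj : j < d) : bits (s 9 i j * s 1 k j) ≤ 2 * L :=
    (bits_mul_le _ _).trans (by linarith [h9 i hi j hj, hkL j])
  have h21 : s1 21 0 0 = k := by rw [hs1 21 (by decide), hk]
  refine Runs.seq (Runs.sumLoop (d := d) (L := 2 * L) (fun j => s 9 i j * s 1 k j)
    (by rw [hs1 0 (by decide), hd]) hK hb ?_) ?_
  · intro j hj s2 hs2 h23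
    simp [eval, eval_var, h23, hs2 21 (by decide), h21, hs2 22 (by decide), h22,
      hs2 9 (by decide), hs1 9 (by decide), hs2 1 (by decide), hs1 1 (by decide)]
  · rintro s2 ⟨hs2, h24⟩
    have h12 : Same [23, 24, 13] s1 s2 := hs2.trans (Same.refl [] _)
    refine Runs.assign (v := ∑ j ∈ Finset.range d, s 9 i j * s 1 k j)
      (by rw [eval_var, hs2 22 (by decide), h22]) (by simp [eval]; rfl) (by rw [eval_var, h24])
      (fun _ => (bits_sum_le _ d hb).trans hK)
      ⟨h12.write _ _ _, by simp [Store.write_same], fun i' hi' => ?_⟩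
    rw [Store.write_same, if_neg (fun h => hi' h.1), hs2 13 (by decide)]

theorem Runs.pivotSearch (hd : s 0 0 0 = d) :
    Runs K pivotSearch s (50 + (50 + (d + 1) * 300)) fun s' =>
      Same [14, 15, 22] s s' ∧ ∃ p : ℕ, s' 15 0 0 = p ∧
        (∀ i < d, s 13 i 0 ≠ 0 → s 10 i 0 ≤ s' 14 0 0) ∧
        (s' 14 0 0 = 0 ∨ p < d ∧ s 13 p 0 ≠ 0 ∧ s 10 p 0 = s' 14 0 0) := by
  have h0K (s' : Store) (hs : Bdd K s') : bits 0 ≤ K := by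
    rw [bits_zero]; exact (one_le_bits _).trans (hs 0 0 0)
  refine Runs.seq (R := fun s' => Same [14] s s' ∧ s' 14 0 0 = 0)
    (Runs.set (v := 0) (by simp [eval]) (h0K _)
      ⟨(Same.refl _ _).write _ _ _, Store.write_self _ _ _ _ _⟩) ?_
  rintro s0 ⟨hs0, h14⟩
  refine Runs.seq (R := fun s' => Same [15] s0 s' ∧ s' 15 0 0 = 0)
    (Runs.set (v := 0) (by simp [eval]) (h0K _)
      ⟨(Same.refl _ _).write _ _ _, Store.write_self _ _ _ _ _⟩) ?_
  rintro s1 ⟨hs1, h15⟩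
  have hs01 : Same [14, 15, 22] s s1 := hs0.trans hs1
  refine (Runs.forLoop_same (S := [14, 15]) (T := 50 + 50 + 50 + 50) (fun m s' => ∃ p : ℕ, s' 15 0 0 = p ∧
        (∀ i < m, s 13 i 0 ≠ 0 → s 10 i 0 ≤ s' 14 0 0) ∧
        (s' 14 0 0 = 0 ∨ p < d ∧ s 13 p 0 ≠ 0 ∧ s 10 p 0 = s' 14 0 0))
    (by rw [hs01 0 (by decide), hd]) ?_
    ⟨0, by simp [h15], by simp, Or.inl (by rw [hs1 14 (by decide), h14])⟩ ?_).conseq le_rfl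
    fun s' h => ⟨hs01.trans h.1, h.2⟩
  · intro m s' v h
    simpa [Store.write_ne] using h
  rintro m hm s2 hs2 h22 ⟨p, hp, h1, h2⟩
  have h13 (i : ℕ) : s2 13 i 0 = s 13 i 0 := by rw [hs2 13 (by decide), hs01 13 (by decide)]
  have h10 (i : ℕ) : s2 10 i 0 = s 10 i 0 := by rw [hs2 10 (by decide), hs01 10 (by decide)]
  refine Runs.ite (u := s 13 m 0 * s 13 m 0) (v := 0) (by simp [eval, eval_var, h22, h13])
    (by simp [eval]) (fun hle => ?_) fun hlt => ?_
  · refine (Runs.skip ⟨Same.refl _ _, p, hp, fun i hi hne => ?_, h2⟩).conseq (by norm_num)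
      fun _ h => h
    rcases Nat.lt_succ_iff_lt_or_eq.1 hi with hi | rfl
    · exact h1 i hi hne
    · exact absurd (mul_self_eq_zero.1 (le_antisymm hle (mul_self_nonneg _))) hne
  have hne : s 13 m 0 ≠ 0 := fun h => by simp [h] at hlt
  refine Runs.ite (u := s 10 m 0) (v := s2 14 0 0) (by simp [eval, eval_var, h22, h10])
    (by rw [eval_var]) (fun hle => ?_) fun hlt' => ?_
  · refine (Runs.skip ⟨Same.refl _ _, p, hp, fun i hi hne => ?_, h2⟩).conseq (by norm_num)
      fun _ h => h
    rcases Nat.lt_succ_iff_lt_or_eq.1 hi with hi | rfl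
    · exact h1 i hi hne
    · exact hle
  refine Runs.seq (R := fun s' => s' = s2.write 14 0 0 (s 10 m 0))
    (Runs.set (by simp [eval, eval_var, h22, h10]) (fun hs => h10 m ▸ hs 10 m 0) rfl) ?_
  rintro s3 rfl
  refine Runs.set (v := m) (by simp [eval_var, Store.write_ne, h22]) (fun hs => ?_)
    ⟨((Same.refl _ _).write _ _ _).write _ _ _, m, Store.write_self _ _ _ _ _, fun i hi hne => ?_,
      Or.inr ⟨hm, hne, ?_⟩⟩
  · have := hs 22 0 0
    rwa [Store.write_ne _ (by decide), h22] at this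
  · rw [Store.write_ne _ (by decide), Store.write_self]
    rcases Nat.lt_succ_iff_lt_or_eq.1 hi with hi | rfl
    · exact (h1 i hi hne).trans hlt'.le
    · exact le_rfl
  · rw [Store.write_ne _ (by decide), Store.write_self]

theorem Runs.pivotRow {p Lc : ℕ} (hd : s 0 0 0 = d) (hp : s 15 0 0 = p)
    (h9 : ∀ j < d, bits (s 9 p j) ≤ L) (h13 : bits (s 13 p 0) ≤ Lc) (h12 : bits (s 12 0 0) ≤ L)
    (hK : L + Lc ≤ K) :
    Runs K pivotRow s ((d + 1) * 150 + 100) fun s' => Same [23, 16, 12] s s' ∧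
      (∀ j < d, s' 16 j 0 = s 9 p j / s 13 p 0) ∧ s' 12 0 0 = s 12 0 0 * |s 13 p 0| := by
  refine Runs.seq (Runs.fillCol (a := 16) (S := [16]) (T := 50) (fun j => s 9 p j / s 13 p 0) hd
    fun j hj s1 hs1 h23 => ?_) ?_
  · have h15 : s1 15 0 0 = p := by rw [hs1 15 (by decide), hp]
    refine Runs.assign (v := s 9 p j / s 13 p 0) (by rw [eval_var, h23]) (by simp [eval]; rfl) ?_
      (fun _ => (bits_div_le _ _).trans (by linarith [h9 j hj]))
      ⟨(Same.refl _ _).write _ _ _, by simp [Store.write_same], fun i' hi' => ?_⟩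
    · simp [eval, eval_var, h15, h23, hs1 9 (by decide), hs1 13 (by decide)]
    · rw [Store.write_same, if_neg (fun h => hi' h.1)]
  rintro s1 ⟨hs1, h16⟩
  have h15 : s1 15 0 0 = p := by rw [hs1 15 (by decide), hp]
  have h13' : s1 13 p 0 = s 13 p 0 := by rw [hs1 13 (by decide)]
  have h12' : s1 12 0 0 = s 12 0 0 := by rw [hs1 12 (by decide)]
  have hb : bits (s 12 0 0 * |s 13 p 0|) ≤ K :=
    (bits_mul_le _ _).trans (by rw [bits_abs]; omega)
  have hfin : Same [23, 16, 12] s (s1.write 12 0 0 (s 12 0 0 * |s 13 p 0|)) ∧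
      (∀ j < d, (s1.write 12 0 0 (s 12 0 0 * |s 13 p 0|)) 16 j 0 = s 9 p j / s 13 p 0) ∧
      (s1.write 12 0 0 (s 12 0 0 * |s 13 p 0|)) 12 0 0 = s 12 0 0 * |s 13 p 0| := by
    have h2 : Same [23, 16, 12] s s1 := hs1.trans (Same.refl [] _)
    refine ⟨h2.write _ _ _, fun j hj => ?_, Store.write_self _ _ _ _ _⟩
    rw [Store.write_ne _ (by decide), h16 j hj]
  refine Runs.ite (T := 50) (u := 0) (v := s 13 p 0) (by simp [eval])
    (by simp [eval, eval_var, h15, h13']) (fun hpos => ?_) fun hneg => ?_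
  · refine Runs.set (v := s 12 0 0 * |s 13 p 0|) ?_ (fun _ => hb) hfin
    simp [eval, eval_var, h15, h13', h12', abs_of_nonneg hpos]
  · refine Runs.set (v := s 12 0 0 * |s 13 p 0|) ?_ (fun _ => hb) hfin
    simp [eval, eval_var, h15, h13', h12', abs_of_neg hneg]

theorem Runs.rankOneUpdate {p Lc Lr : ℕ} (hd : s 0 0 0 = d) (hp : s 15 0 0 = p) (hpd : p < d)
    (h9 : ∀ i < d, ∀ j < d, bits (s 9 i j) ≤ L) (h13 : ∀ i < d, bits (s 13 i 0) ≤ Lc)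
    (h16 : ∀ i < d, bits (s 16 i 0) ≤ Lr) (hK : L + Lc + Lr + 3 ≤ K) :
    Runs K rankOneUpdate s (50 + (d + 1) * ((d + 1) * 150 + 100)) fun s' =>
      Same [13, 22, 23, 9] s s' ∧ ∀ i < d, ∀ j < d,
        s' 9 i j = s 9 i j - (s 13 i 0 - if i = p then 1 else 0) * s 16 j 0 := by
  have hc (i : ℕ) (hi : i < d) : bits (s 13 i 0 - if i = p then 1 else 0) ≤ Lc + 2 := by
    have h1 := h13 i hi
    split_ifs
    · have := bits_sub_le (s 13 i 0) 1
      rw [bits_one] at this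
      omega
    · rw [sub_zero]; omega
  refine Runs.seq (R := fun s' => s' = s.write 13 p 0 (s 13 p 0 - 1))
    (Runs.assign (by simp [eval_var, hp]) (j' := 0) (by simp [eval])
      (by simp [eval, eval_var, hp]) (fun _ => ?_) rfl) ?_
  · have := hc p hpd
    rw [if_pos rfl] at this
    omega
  rintro s1 rfl
  have hs1 : Same [13] s (s.write 13 p 0 (s 13 p 0 - 1)) := (Same.refl _ _).write _ _ _
  have h13' (i : ℕ) : (s.write 13 p 0 (s 13 p 0 - 1)) 13 i 0
      = s 13 i 0 - if i = p then 1 else 0 := by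
    rw [Store.write_same]
    by_cases h : i = p <;> simp [h]
  refine (Runs.fillMatrix (a := 9) (S := [9]) (T := 50)
    (fun i j => s 9 i j - (s 13 i 0 - if i = p then 1 else 0) * s 16 j 0)
    (by rw [hs1 0 (by decide), hd]) ?_).conseq le_rfl
    fun s' h => ⟨hs1.trans h.1, h.2⟩
  intro i hi j hj s2 hs2 h22 h23 hij
  rw [hs1 9 (by decide)] at hij
  refine Runs.assign (by rw [eval_var, h22]) (by rw [eval_var, h23])
    (v := s 9 i j - (s 13 i 0 - if i = p then 1 else 0) * s 16 j 0) ?_ (fun _ => ?_)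
    ⟨(Same.refl _ _).write _ _ _, by rw [Store.write_self], fun i' j' hne => ?_⟩
  · simp [eval, eval_var, h22, h23, hij, hs2 13 (by decide), h13', hs2 16 (by decide),
      hs1 16 (by decide)]
  · have h1 := bits_sub_le (s 9 i j) ((s 13 i 0 - if i = p then 1 else 0) * s 16 j 0)
    have h2 := bits_mul_le (s 13 i 0 - if i = p then 1 else 0) (s 16 j 0)
    have h3 := h9 i hi j hj
    have h4 := h16 j hj
    have h5 := hc i hi
    omega
  · rw [Store.write_same, if_neg hne]

theorem Runs.exchangeStep {k p Lc : ℕ} (hd : s 0 0 0 = d) (hk : s 21 0 0 = k)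
    (hp : s 15 0 0 = p) (hpd : p < d)
    (h9 : ∀ i < d, ∀ j < d, bits (s 9 i j) ≤ L) (h13 : ∀ i < d, bits (s 13 i 0) ≤ Lc)
    (h12 : bits (s 12 0 0) ≤ L) (hK : 2 * L + 2 * Lc + 3 ≤ K) :
    Runs K exchangeStep s
      ((d + 1) * 150 + 100 + (50 + (d + 1) * ((d + 1) * 150 + 100) + (50 + 50))) fun s' =>
      Same [16, 12, 13, 22, 23, 9, 10, 11] s s' ∧
      (∀ i < d, ∀ j < d, s' 9 i j
        = s 9 i j - (s 13 i 0 - if i = p then 1 else 0) * (s 9 p j / s 13 p 0)) ∧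
      s' 12 0 0 = s 12 0 0 * |s 13 p 0| ∧
      (∀ i, s' 10 i 0 = if i = p then s 7 k 0 else s 10 i 0) ∧
      ∀ i, s' 11 i 0 = if i = p then (k : ℚ) else s 11 i 0 := by
  refine Runs.seq (Runs.pivotRow (d := d) (L := L) (Lc := Lc) hd hp (h9 p hpd) (h13 p hpd) h12
    (by omega)) ?_
  rintro s1 ⟨hs1, h16, h12'⟩
  have h9' : s1 9 = s 9 := hs1 9 (by decide)
  have h13' : s1 13 = s 13 := hs1 13 (by decide)
  refine Runs.seq (Runs.rankOneUpdate (d := d) (p := p) (L := L) (Lc := Lc) (Lr := L + Lc)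
    (by rw [hs1 0 (by decide), hd]) (by rw [hs1 15 (by decide), hp]) hpd (by rwa [h9'])
    (by rwa [h13']) (fun j hj => ?_) (by omega)) ?_
  · rw [h16 j hj]
    exact (bits_div_le _ _).trans (by linarith [h9 p hpd j hj, h13 p hpd])
  rintro s2 ⟨hs2, h9''⟩
  have hs02' : Same [16, 12, 13, 22, 23, 9] s s2 := hs1.trans hs2
  have hs02 : Same [16, 12, 13, 22, 23, 9, 10, 11] s s2 := hs1.trans hs2
  have h15 : s2 15 0 0 = p := by rw [hs02 15 (by decide), hp]
  have h21 : s2 21 0 0 = k := by rw [hs02 21 (by decide), hk]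
  refine Runs.seq (R := fun s' => s' = s2.write 10 p 0 (s 7 k 0))
    (Runs.assign (by simp [eval_var, h15]) (j' := 0) (by simp [eval])
      (by simp [eval, eval_var, h21, hs02 7 (by decide)])
      (fun hs => hs02 7 (by decide) ▸ hs 7 k 0) rfl) ?_
  rintro s3 rfl
  refine Runs.assign (i' := p) (j' := 0) (v := k) (by simp [eval_var, Store.write_ne, h15])
    (by simp [eval]) (by simp [eval_var, Store.write_ne, h21]) (fun hs => ?_)
    ⟨(hs02.write _ _ _).write _ _ _, fun i hi j hj => ?_, ?_, fun i => ?_, fun i => ?_⟩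
  · have := hs 21 0 0
    rwa [Store.write_ne _ (by decide), h21] at this
  · rw [Store.write_ne _ (by decide), Store.write_ne _ (by decide), h9'' i hi j hj, h9', h13',
      h16 j hj]
  · rw [Store.write_ne _ (by decide), Store.write_ne _ (by decide), hs2 12 (by decide), h12']
  · rw [Store.write_ne _ (by decide), Store.write_same, hs02' 10 (by decide)]
    simp
  · rw [Store.write_same, Store.write_ne _ (by decide), hs02' 11 (by decide)]
    simp

theorem storeMat_mulVec {a : ℕ} {x : Fin n → Fin d → ℤ}
    (hx : ∀ (l : Fin n) (i : Fin d), s 1 l i = x l i) (l : Fin n) (i : Fin d) :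
    (storeMat d s a *ᵥ fun j => (x l j : ℚ)) i = ∑ j ∈ Finset.range d, s a i j * s 1 l j := by
  rw [Finset.sum_range]
  simp only [storeMat, Matrix.mulVec, dotProduct, Matrix.of_apply, hx]

theorem Runs.exchangePhase {b : ℕ} {x : Fin n → Fin d → ℤ} {H : ℚ} (hd : s 0 0 0 = d)
    (hn : s 0 0 1 = n) (hx : ∀ (l : Fin n) (i : Fin d), s 1 l i = x l i)
    (hxb : ∀ l i, |x l i| ≤ 2 ^ b) (hxL : ∀ k j, bits (s 1 k j) ≤ L)
    (hβ : ∀ l < n, 0 ≤ s 7 l 0 ∧ bits (s 7 l 0) ≤ L) (hH : bits H ≤ L)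
    (hL : detBound d b < 2 ^ L)
    (h0 : IsGreedy b x (fun l => s 7 l 0) H 0 (storeMat d s 9) (storeVec d s 10) (storeVec d s 11)
      (s 12 0 0))
    (hK : 2 * L + 2 * (d * (2 * L + 1) + 1) + 3 ≤ K) :
    Runs K exchangePhase s ((n + 1) * ((d + 1) * (50 + (d + 1) * 150 + 50 + 100) +
      (50 + (50 + (d + 1) * 300) + ((d + 1) * 150 + 100 +
        (50 + (d + 1) * ((d + 1) * 150 + 100) + (50 + 50)) + 50)) + 100)) fun s' =>
      Same [21, 22, 23, 24, 13, 14, 15, 16, 12, 9, 10, 11] s s' ∧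
      IsGreedy b x (fun l => s 7 l 0) H n (storeMat d s' 9) (storeVec d s' 10) (storeVec d s' 11)
        (s' 12 0 0) := by
  have hL1 : 1 ≤ L := (one_le_bits _).trans hH
  refine Runs.forLoop_same (S := [22, 23, 24, 13, 14, 15, 16, 12, 9, 10, 11]) (h := 1) (m := n)
    (fun k s' => IsGreedy b x (fun l => s 7 l 0) H k (storeMat d s' 9) (storeVec d s' 10)
      (storeVec d s' 11) (s' 12 0 0)) hn ?_ h0 ?_
  · intro m s' v h
    have h9 : storeMat d (s'.write 21 0 0 v) 9 = storeMat d s' 9 := by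
      unfold storeMat; rw [Store.write_ne _ (by decide)]
    have h10 : storeVec d (s'.write 21 0 0 v) 10 = storeVec d s' 10 := by
      unfold storeVec; rw [Store.write_ne _ (by decide)]
    have h11 : storeVec d (s'.write 21 0 0 v) 11 = storeVec d s' 11 := by
      unfold storeVec; rw [Store.write_ne _ (by decide)]
    rwa [h9, h10, h11, Store.write_ne _ (by decide)]
  rintro k hk s1 hs1 h21 hG
  obtain ⟨hb9, hb10, hb12⟩ := hG.bits_le hL hL1 (fun l => (hβ l l.2).2) hH
  have hb9' : ∀ i < d, ∀ j < d, bits (s1 9 i j) ≤ L := fun i hi j hj => hb9 ⟨i, hi⟩ ⟨j, hj⟩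
  refine Runs.seq (Runs.coordPhase (d := d) (k := k) (L := L) (by rw [hs1 0 (by decide), hd]) h21
    (by rw [hs1 1 (by decide)]; exact hxL k) hb9' (by omega)) ?_
  rintro s2 ⟨hs2, h13⟩
  refine Runs.seq (Runs.pivotSearch (d := d)
    (by rw [hs2 0 (by decide), hs1 0 (by decide), hd])) ?_
  rintro s3 ⟨hs3, p, hp, hmax, hor⟩
  have hs13 : Same [22, 23, 24, 13, 14, 15] s1 s3 := hs2.trans hs3
  have hs03 : Same [21, 22, 23, 24, 13, 14, 15, 16, 12, 9, 10, 11] s s3 := hs1.trans hs13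
  have h21' : s3 21 0 0 = k := by rw [hs13 21 (by decide), h21]
  have hx1 (l : Fin n) (i : Fin d) : s1 1 l i = x l i := by rw [hs1 1 (by decide), hx]
  set c : Fin d → ℚ := storeMat d s1 9 *ᵥ fun j => (x ⟨k, hk⟩ j : ℚ) with hc
  have hc13 (i : ℕ) (hi : i < d) : s2 13 i 0 = c ⟨i, hi⟩ := by
    rw [h13 i hi, hc, storeMat_mulVec hx1]
  have hw (i : ℕ) : s2 10 i 0 = s1 10 i 0 := by rw [hs2 10 (by decide)]
  have h9 : storeMat d s3 9 = storeMat d s1 9 := by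
    unfold storeMat; rw [hs13 9 (by decide)]
  have h10 : storeVec d s3 10 = storeVec d s1 10 := by
    unfold storeVec; rw [hs13 10 (by decide)]
  have h11 : storeVec d s3 11 = storeVec d s1 11 := by
    unfold storeVec; rw [hs13 11 (by decide)]
  refine Runs.ite (u := s3 14 0 0) (v := s 7 k 0) (by rw [eval_var])
    (by simp [eval, eval_var, h21', hs03 7 (by decide)]) (fun hle => ?_) fun hlt => ?_
  · refine (Runs.skip ⟨hs13.trans (Same.refl [] _), ?_⟩).conseq (by omega) fun _ h => h
    rw [h9, h10, h11, hs13 12 (by decide)]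
    refine hG.succ hk fun i hi => ?_
    have := hmax i i.2 (by rw [hc13 i i.2]; exact hi)
    rw [hw] at this
    exact this.trans hle
  · obtain ⟨hpd, hcp, hwp⟩ : p < d ∧ s2 13 p 0 ≠ 0 ∧ s2 10 p 0 = s3 14 0 0 := by
      refine hor.resolve_left fun h => ?_
      rw [h] at hlt
      exact absurd (hβ k hk).1 (not_le.2 hlt)
    have hs313 : s3 13 = s2 13 := hs3 13 (by decide)
    have hs39 : s3 9 = s1 9 := hs13 9 (by decide)
    refine (Runs.exchangeStep (d := d) (k := k) (p := p) (L := L) (Lc := d * (2 * L + 1) + 1)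
      (by rw [hs03 0 (by decide), hd]) h21' hp hpd (by rwa [hs39]) (fun i hi => ?_)
      (by rwa [hs13 12 (by decide)]) hK).conseq le_rfl ?_
    · rw [hs313, h13 i hi]
      refine bits_sum_le _ d fun j hj => (bits_mul_le _ _).trans ?_
      have := hxL k j
      rw [hs1 1 (by decide)]
      linarith [hb9' i hi j hj]
    · rintro s4 ⟨hs4, g9, g12, g10, g11⟩
      refine ⟨hs13.trans hs4, ?_⟩
      have key := hG.exchange hk hxb hc (p := ⟨p, hpd⟩) (by rwa [← hc13 p hpd])
        (fun i hi => by
          have := hmax i i.2 (by rw [hc13 i i.2]; exact hi)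
          rw [← hwp, hw, hw] at this
          exact this)
        (by
          change s 7 k 0 < s1 10 p 0
          rw [← hw, hwp]; exact hlt)
      convert key using 1
      · ext i j
        change s4 9 i j = _
        rw [g9 i i.2 j j.2, hs313, hs39, hc13 i i.2, hc13 p hpd]
        simp [storeMat, Fin.ext_iff]
      · funext i
        change s4 10 i 0 = _
        rw [g10, Function.update_apply, hs13 10 (by decide), hs03 7 (by decide)]
        simp [storeVec, Fin.ext_iff]
      · funext i
        change s4 11 i 0 = _
        rw [g11, Function.update_apply, hs13 11 (by decide)]
        simp [storeVec, Fin.ext_iff]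
      · rw [g12, hs13 12 (by decide), hs313, hc13 p hpd]

end


/-! ### Computing the scaling factors -/

/-- Finds the lightest basis vector that has no factor yet: its weight in the variable `14`, its
index in the variable `15`. -/
def minSearch : Prog :=
  .seq (set 14 (var 8)) (.seq (set 15 (.lit 0)) (forLoop 22 0
    (.ite (.read 17 (var 22) (.lit 0)) (.lit 0)
      (.ite (var 14) (.read 10 (var 22) (.lit 0)) .skip
        (.seq (set 14 (.read 10 (var 22) (.lit 0))) (set 15 (var 22)))) .skip)))

/-- Computes the factor of the next basis vector, in the array `17`; the variables `18` and `19`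
hold the weight and the scaled weight of the last one. -/
def scaleStep : Prog :=
  .seq minSearch (.seq
    (.ite (var 14) (.mul (var 25) (var 18)) (set 19 (.div (.mul (var 19) (var 14)) (var 18)))
      (set 19 (.mul (var 19) (var 25))))
    (.seq (.assign 17 (var 15) (.lit 0) (.div (var 19) (var 14))) (set 18 (var 14))))

/-- Computes the factors of all basis vectors. -/
def scalePhase : Prog := .seq (set 19 (.lit 1)) (forLoop 21 0 scaleStep)

section

variable {K d n L : ℕ} {s : Store}

theorem Runs.minSearch (hd : s 0 0 0 = d) :
    Runs K minSearch s (50 + (50 + (d + 1) * 300)) fun s' =>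
      Same [14, 15, 22] s s' ∧ ∃ p : ℕ, s' 15 0 0 = p ∧
        (∀ i < d, s 17 i 0 ≤ 0 → s' 14 0 0 ≤ s 10 i 0) ∧
        (s' 14 0 0 = s 8 0 0 ∨ p < d ∧ s 17 p 0 ≤ 0 ∧ s 10 p 0 = s' 14 0 0) := by
  refine Runs.seq (R := fun s' => Same [14] s s' ∧ s' 14 0 0 = s 8 0 0)
    (Runs.set (v := s 8 0 0) (by simp [eval_var]) (fun hs => hs 8 0 0)
      ⟨(Same.refl _ _).write _ _ _, Store.write_self _ _ _ _ _⟩) ?_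
  rintro s0 ⟨hs0, h14⟩
  refine Runs.seq (R := fun s' => Same [15] s0 s' ∧ s' 15 0 0 = 0)
    (Runs.set (v := 0) (by simp [eval])
      (fun hs => by rw [bits_zero]; exact (one_le_bits _).trans (hs 0 0 0))
      ⟨(Same.refl _ _).write _ _ _, Store.write_self _ _ _ _ _⟩) ?_
  rintro s1 ⟨hs1, h15⟩
  have hs01 : Same [14, 15, 22] s s1 := hs0.trans hs1
  refine (Runs.forLoop_same (S := [14, 15]) (T := 50 + 50 + 50 + 50)
    (fun m s' => ∃ p : ℕ, s' 15 0 0 = p ∧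
        (∀ i < m, s 17 i 0 ≤ 0 → s' 14 0 0 ≤ s 10 i 0) ∧
        (s' 14 0 0 = s 8 0 0 ∨ p < d ∧ s 17 p 0 ≤ 0 ∧ s 10 p 0 = s' 14 0 0))
    (by rw [hs01 0 (by decide), hd]) ?_
    ⟨0, by simp [h15], by simp, Or.inl (by rw [hs1 14 (by decide), h14])⟩ ?_).conseq le_rfl
    fun s' h => ⟨hs01.trans h.1, h.2⟩
  · intro m s' v h
    simpa [Store.write_ne] using h
  rintro m hm s2 hs2 h22 ⟨p, hp, h1, h2⟩
  have h17 (i : ℕ) : s2 17 i 0 = s 17 i 0 := by rw [hs2 17 (by decide), hs01 17 (by decide)]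
  have h10 (i : ℕ) : s2 10 i 0 = s 10 i 0 := by rw [hs2 10 (by decide), hs01 10 (by decide)]
  refine Runs.ite (u := s 17 m 0) (v := 0) (by simp [eval, eval_var, h22, h17])
    (by simp [eval]) (fun hle => ?_) fun hlt => ?_
  · refine Runs.ite (u := s2 14 0 0) (v := s 10 m 0) (by rw [eval_var])
      (by simp [eval, eval_var, h22, h10]) (fun hle' => ?_) fun hlt' => ?_
    · refine (Runs.skip ⟨Same.refl _ _, p, hp, fun i hi hne => ?_, h2⟩).conseq (by norm_num)
        fun _ h => h
      rcases Nat.lt_succ_iff_lt_or_eq.1 hi with hi | rfl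
      · exact h1 i hi hne
      · exact hle'
    refine Runs.seq (R := fun s' => s' = s2.write 14 0 0 (s 10 m 0))
      (Runs.set (by simp [eval, eval_var, h22, h10]) (fun hs => h10 m ▸ hs 10 m 0) rfl) ?_
    rintro s3 rfl
    refine Runs.set (v := m) (by simp [eval_var, Store.write_ne, h22]) (fun hs => ?_)
      ⟨((Same.refl _ _).write _ _ _).write _ _ _, m, Store.write_self _ _ _ _ _,
        fun i hi hne => ?_, Or.inr ⟨hm, hle, ?_⟩⟩
    · have := hs 22 0 0
      rwa [Store.write_ne _ (by decide), h22] at this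
    · rw [Store.write_ne _ (by decide), Store.write_self]
      rcases Nat.lt_succ_iff_lt_or_eq.1 hi with hi | rfl
      · exact hlt'.le.trans (h1 i hi hne)
      · exact le_rfl
    · rw [Store.write_ne _ (by decide), Store.write_self]
  · refine (Runs.skip ⟨Same.refl _ _, p, hp, fun i hi hne => ?_, h2⟩).conseq (by norm_num)
      fun _ h => h
    rcases Nat.lt_succ_iff_lt_or_eq.1 hi with hi | rfl
    · exact h1 i hi hne
    · exact absurd hne (not_le.2 hlt)

theorem Runs.scalePhase {G : ℚ} (hd : s 0 0 0 = d) (h17 : ∀ i, s 17 i 0 = 0) (h18 : s 18 0 0 = 0)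
    (hG : s 25 0 0 = G) (hG1 : 1 ≤ G) (hGL : bits G ≤ L)
    (hw : ∀ i < d, 1 ≤ s 10 i 0 ∧ s 10 i 0 < s 8 0 0 ∧ bits (s 10 i 0) ≤ L)
    (hK : d * (2 * L) + L + 1 ≤ K) :
    Runs K scalePhase s (50 + (d + 1) * (50 + (50 + (d + 1) * 300) + (50 + 50 + (50 + 50)) + 100))
      fun s' => Same [19, 21, 14, 15, 22, 17, 18] s s' ∧
        GapState (storeVec d s 10) G d (storeVec d s' 17) (s' 18 0 0) (s' 19 0 0) ∧
        ∀ i < d, bits (s' 17 i 0) ≤ d * (2 * L) + L + 1 := by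
  have hL1 : 1 ≤ L := (one_le_bits _).trans hGL
  have hw1 : ∀ i : Fin d, 1 ≤ storeVec d s 10 i := fun i => (hw i i.2).1
  refine Runs.seq (R := fun s' => Same [19] s s' ∧ s' 19 0 0 = 1)
    (Runs.set (v := 1) (by simp [eval])
      (fun hs => by rw [bits_one]; exact (one_le_bits _).trans (hs 0 0 0))
      ⟨(Same.refl _ _).write _ _ _, Store.write_self _ _ _ _ _⟩) ?_
  rintro s0 ⟨hs0, h19⟩
  refine (Runs.forLoop_same (S := [14, 15, 22, 19, 17, 18]) (h := 0) (m := d)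
    (T := 50 + (50 + (d + 1) * 300) + (50 + 50 + (50 + 50)))
    (fun k s' => GapState (storeVec d s 10) G k (storeVec d s' 17) (s' 18 0 0) (s' 19 0 0) ∧
      bits (s' 18 0 0) ≤ L ∧ bits (s' 19 0 0) ≤ k * (2 * L) + 1 ∧
      ∀ i < d, bits (s' 17 i 0) ≤ d * (2 * L) + L + 1)
    (by rw [hs0 0 (by decide), hd]) ?_ ?_ ?_).conseq le_rfl ?_
  · intro m s' v h
    have h17' : storeVec d (s'.write 21 0 0 v) 17 = storeVec d s' 17 := by
      unfold storeVec; rw [Store.write_ne _ (by decide)]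
    rw [h17', Store.write_ne _ (by decide), Store.write_ne _ (by decide),
      Store.write_ne _ (by decide)]
    exact h
  · have h17' : storeVec d s0 17 = fun _ => 0 := by
      funext i
      exact (congrFun (congrFun (hs0 17 (by decide)) i) 0).trans (h17 i)
    rw [h17', hs0 18 (by decide), h18, h19, bits_zero, bits_one]
    refine ⟨gapState_zero hw1, hL1, by simp, fun i hi => ?_⟩
    rw [hs0 17 (by decide), h17, bits_zero]
    omega
  · rintro k hk s1 hs1 h21 ⟨h1, h2, h3, h4⟩
    have hs01 : Same [19, 21, 14, 15, 22, 17, 18] s s1 := hs0.trans hs1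
    have h10 : s1 10 = s 10 := hs01 10 (by decide)
    refine Runs.seq (Runs.minSearch (d := d) (by rw [hs01 0 (by decide), hd])) ?_
    rintro s2 ⟨hs2, p, hp, hmin, hor⟩
    rw [h10] at hmin hor
    rw [hs01 8 (by decide)] at hor
    obtain ⟨hpd, htp, hwp⟩ : p < d ∧ s1 17 p 0 ≤ 0 ∧ s 10 p 0 = s2 14 0 0 := by
      refine hor.resolve_left fun h => ?_
      obtain ⟨i, hi⟩ := h1.exists_eq_zero hk
      have := hmin i i.2 (le_of_eq hi)
      rw [h] at this
      exact absurd (hw i i.2).2.1 (not_lt.2 this)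
    have htp0 : storeVec d s1 17 ⟨p, hpd⟩ = 0 := by
      by_contra hne
      exact absurd (h1.pos _ hne).1 (not_lt.2 htp)
    obtain ⟨hwp1, -, hwpL⟩ := hw p hpd
    have h18' : s2 18 0 0 = s1 18 0 0 := by rw [hs2 18 (by decide)]
    have h19' : s2 19 0 0 = s1 19 0 0 := by rw [hs2 19 (by decide)]
    have h25 : s2 25 0 0 = G := by rw [hs2 25 (by decide), hs01 25 (by decide), hG]
    -- The new scaled weight.
    set g : ℚ := if s 10 p 0 ≤ G * s1 18 0 0 then s1 19 0 0 * s 10 p 0 / s1 18 0 0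
      else s1 19 0 0 * G with hg
    have hgb : bits g ≤ (k + 1) * (2 * L) + 1 := by
      rw [hg]
      split_ifs
      · have h5 := bits_div_le (s1 19 0 0 * s 10 p 0) (s1 18 0 0)
        have h6 := bits_mul_le (s1 19 0 0) (s 10 p 0)
        nlinarith
      · have h6 := bits_mul_le (s1 19 0 0) G
        nlinarith
    have hgb' : bits g ≤ d * (2 * L) + 1 :=
      hgb.trans (Nat.add_le_add_right (Nat.mul_le_mul_right _ hk) 1)
    have htb : bits (g / s 10 p 0) ≤ d * (2 * L) + L + 1 :=
      (bits_div_le _ _).trans (by omega)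
    refine Runs.seq (R := fun s' => s' = s2.write 19 0 0 g)
      (Runs.ite (u := s 10 p 0) (v := G * s1 18 0 0) (by rw [eval_var, hwp])
        (by rw [eval, eval_var, eval_var, h25, h18']) (fun hle => ?_) fun hlt => ?_) ?_
    · refine Runs.set (v := g) ?_ (fun _ => by omega) rfl
      rw [hg, if_pos hle, eval, eval, eval_var, eval_var, eval_var, h18', h19', hwp]
    · refine Runs.set (v := g) ?_ (fun _ => by omega) rfl
      rw [hg, if_neg (not_le.2 hlt), eval, eval_var, eval_var, h19', h25]
    rintro s3 rfl
    refine Runs.seq (R := fun s' => s' = (s2.write 19 0 0 g).write 17 p 0 (g / s 10 p 0))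
      (Runs.assign (by simp [eval_var, Store.write_ne, hp]) (j' := 0) (by simp [eval])
        (by simp [eval, eval_var, Store.write_ne, Store.write_self, hwp]) (fun _ => by omega) rfl) ?_
    rintro s4 rfl
    refine Runs.set (v := s 10 p 0) (by simp [eval_var, Store.write_ne, hwp])
      (fun _ => by omega) ⟨?_, ?_⟩
    · have hs3 : Same [14, 15, 22, 19, 17, 18] s1 s2 := hs2.trans (Same.refl [] _)
      exact ((hs3.write _ _ _).write _ _ _).write _ _ _
    · have h17' : storeVec d (((s2.write 19 0 0 g).write 17 p 0 (g / s 10 p 0)).write 18 0 0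
          (s 10 p 0)) 17 = Function.update (storeVec d s1 17) ⟨p, hpd⟩ (g / s 10 p 0) := by
        funext i
        simp only [storeVec]
        rw [Store.write_ne _ (by decide), Store.write_same, Store.write_ne _ (by decide),
          Function.update_apply, hs2 17 (by decide)]
        simp only [and_true, Fin.ext_iff]
        rfl
      rw [h17', Store.write_self, Store.write_ne _ (by decide), Store.write_ne _ (by decide),
        Store.write_self]
      refine ⟨h1.succ hw1 hG1 htp0 (fun i hi => ?_) hg, hwpL, hgb, fun i hi => ?_⟩
      · have := hmin i i.2 (le_of_eq hi)
        rw [← hwp] at this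
        exact this
      · rw [Store.write_ne _ (by decide), Store.write_same, Store.write_ne _ (by decide)]
        split_ifs
        · exact htb
        · rw [hs2 17 (by decide)]
          exact h4 i hi
  · rintro s' ⟨h1, h2, -, -, h3⟩
    exact ⟨hs0.trans h1, h2, h3⟩

/-! ### Computing the rounded matrix -/

/-- Stores the rounded images of the basis vectors in the array `20`. -/
def roundPhase : Prog :=
  forLoop 21 0 (forLoop 22 0 (.seq
    (.assign 20 (var 21) (var 22) (.mul (.lit 2) (.rnd (.mul
      (.mul (var 25) (.read 17 (var 22) (.lit 0)))
      (.read 6 (.read 11 (var 22) (.lit 0)) (var 21))))))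
    (.ite (var 21) (var 22) (.ite (var 22) (var 21)
      (.assign 20 (var 21) (var 22) (.add (.read 20 (var 21) (var 22)) (.lit 1))) .skip) .skip)))

theorem bits_roundedEntry_le (G t a : ℚ) (δ : Prop) [Decidable δ] :
    bits (roundedEntry G t a δ : ℚ) ≤ bits G + bits t + bits a + 4 := by
  have h2 : bits (2 : ℚ) ≤ 2 := by
    have := bits_natCast_le (z := 2) (K := 2) (by norm_num) (by norm_num)
    simpa using this
  have h3 := bits_mul_le (G * t) a
  have h4 := bits_mul_le G t
  have h5 := bits_round_le (G * t * a)
  have h6 := bits_mul_le 2 ((round (G * t * a) : ℤ) : ℚ)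
  have h7 := bits_add_le (2 * ((round (G * t * a) : ℤ) : ℚ)) 1
  rw [bits_one] at h7
  unfold roundedEntry
  split_ifs <;> push_cast
  · omega
  · rw [add_zero]; omega

theorem Runs.roundPhase {σ : ℕ → ℕ} (hd : s 0 0 0 = d) (hσ : ∀ i < d, s 11 i 0 = σ i)
    (hK : ∀ l < d, ∀ i < d, bits (s 25 0 0) + bits (s 17 i 0) + bits (s 6 (σ i) l) + 4 ≤ K) :
    Runs K roundPhase s ((d + 1) * ((d + 1) * 300 + 100)) fun s' =>
      Same [21, 22, 20] s s' ∧ ∀ l < d, ∀ i < d,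
        s' 20 l i = roundedEntry (s 25 0 0) (s 17 i 0) (s 6 (σ i) l) (l = i) := by
  refine Runs.fillMatrix (a := 20) (S := [20]) (T := 50 + (50 + 50 + 50))
    (fun l i => (roundedEntry (s 25 0 0) (s 17 i 0) (s 6 (σ i) l) (l = i) : ℚ)) hd
    fun l hl i hi s1 hs1 h21 h22 _ => ?_
  have hF (δ : Prop) [Decidable δ] :=
    (bits_roundedEntry_le (s 25 0 0) (s 17 i 0) (s 6 (σ i) l) δ).trans (hK l hl i hi)
  have h11 : s1 11 i 0 = σ i := by rw [hs1 11 (by decide), hσ i hi]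
  refine Runs.seq (R := fun s' => s' = s1.write 20 l i
      (roundedEntry (s 25 0 0) (s 17 i 0) (s 6 (σ i) l) False))
    (Runs.assign (by simp [eval_var, h21]) (by simp [eval_var, h22]) ?_ (fun _ => hF False) rfl) ?_
  · simp [eval, eval_var, h21, h22, h11, hs1 25 (by decide), hs1 17 (by decide), hs1 6 (by decide),
      roundedEntry]
  rintro s2 rfl
  have hskip (hne : l ≠ i) {T : ℕ} (hT : 1 ≤ T) :
      Runs K .skip (s1.write 20 l i (roundedEntry (s 25 0 0) (s 17 i 0) (s 6 (σ i) l) False)) T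
        fun s'' => Same [20] s1 s'' ∧
          s'' 20 l i = roundedEntry (s 25 0 0) (s 17 i 0) (s 6 (σ i) l) (l = i) ∧
          ∀ i' j', ¬ (i' = l ∧ j' = i) → s'' 20 i' j' = s1 20 i' j' := by
    refine (Runs.skip ⟨(Same.refl _ _).write _ _ _, ?_, fun i' j' h => ?_⟩).conseq hT fun _ h => h
    · rw [Store.write_self]
      simp [roundedEntry, hne]
    · rw [Store.write_same, if_neg h]
  refine Runs.ite (T := 50 + 50) (u := l) (v := i) (by simp [eval_var, Store.write_ne, h21])
    (by simp [eval_var, Store.write_ne, h22]) (fun hle => ?_) fun hlt => hskip (fun h => ?_) (by omega)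
  · refine Runs.ite (T := 50) (u := i) (v := l) (by simp [eval_var, Store.write_ne, h22])
      (by simp [eval_var, Store.write_ne, h21]) (fun hle' => ?_)
      fun hlt' => hskip (fun h => ?_) (by omega)
    · have hil : l = i := by exact_mod_cast le_antisymm hle hle'
      refine Runs.assign (by simp [eval_var, Store.write_ne, h21])
        (by simp [eval_var, Store.write_ne, h22])
        (v := roundedEntry (s 25 0 0) (s 17 i 0) (s 6 (σ i) l) (l = i)) ?_
        (fun _ => hF _)
        ⟨((Same.refl _ _).write _ _ _).write _ _ _, Store.write_self _ _ _ _ _, fun i' j' h => ?_⟩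
      · simp [eval, eval_var, Store.write_ne, Store.write_self, h21, h22, roundedEntry, hil]
      · rw [Store.write_same, if_neg h, Store.write_same, if_neg h]
    · exact absurd hlt' (by rw [h]; exact lt_irrefl _)
  · exact absurd hlt (by rw [h]; exact lt_irrefl _)

/-- Multiplies the rounded images by the adjugate of the basis. -/
def outputPhase : Prog :=
  forLoop 21 0 (forLoop 22 0 (.seq
    (sumLoop (.mul (.read 20 (var 21) (var 23)) (.read 9 (var 23) (var 22))))
    (.assign 3 (var 21) (var 22) (.mul (var 12) (var 24)))))

theorem Runs.outputPhase {Lm : ℕ} (hd : s 0 0 0 = d) (h12 : bits (s 12 0 0) ≤ L)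
    (h9 : ∀ i < d, ∀ j < d, bits (s 9 i j) ≤ L) (h20 : ∀ i < d, ∀ j < d, bits (s 20 i j) ≤ Lm)
    (hK : d * (Lm + L + 1) + L + 1 ≤ K) :
    Runs K outputPhase s ((d + 1) * ((d + 1) * (50 + (d + 1) * 150 + 50 + 100) + 100)) fun s' =>
      Same [21, 22, 23, 24, 3] s s' ∧ ∀ l < d, ∀ j < d,
        s' 3 l j = s 12 0 0 * ∑ i ∈ Finset.range d, s 20 l i * s 9 i j := by
  refine Runs.fillMatrix (a := 3) (S := [23, 24, 3])
    (fun l j => s 12 0 0 * ∑ i ∈ Finset.range d, s 20 l i * s 9 i j) hd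
    fun l hl j hj s1 hs1 h21 h22 _ => ?_
  have hb (i : ℕ) (hi : i < d) : bits (s 20 l i * s 9 i j) ≤ Lm + L :=
    (bits_mul_le _ _).trans (by linarith [h9 i hi j hj, h20 l hl i hi])
  refine Runs.seq (Runs.sumLoop (d := d) (L := Lm + L) (fun i => s 20 l i * s 9 i j)
    (by rw [hs1 0 (by decide), hd]) (by omega) hb ?_) ?_
  · intro i hi s2 hs2 h23
    simp [eval, eval_var, h23, hs2 21 (by decide), h21, hs2 22 (by decide), h22,
      hs2 9 (by decide), hs1 9 (by decide), hs2 20 (by decide), hs1 20 (by decide)]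
  · rintro s2 ⟨hs2, h24⟩
    have hs12 : Same [23, 24, 3] s1 s2 := hs2.trans (Same.refl [] _)
    have h12' : s2 12 0 0 = s 12 0 0 := by rw [hs2 12 (by decide), hs1 12 (by decide)]
    refine Runs.assign (v := s 12 0 0 * ∑ i ∈ Finset.range d, s 20 l i * s 9 i j)
      (by rw [eval_var, hs2 21 (by decide), h21]) (by rw [eval_var, hs2 22 (by decide), h22])
      (by rw [eval, eval_var, eval_var, h24, h12']) (fun _ => ?_)
      ⟨hs12.write _ _ _, Store.write_self _ _ _ _ _, fun i' j' h => ?_⟩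
    · have h1 := bits_mul_le (s 12 0 0) (∑ i ∈ Finset.range d, s 20 l i * s 9 i j)
      have h2 := bits_sum_le _ d hb
      omega
    · rw [Store.write_same, if_neg h, hs2 3 (by decide)]

end


/-! ### The rounding program -/

/-- The general case of the rounding. -/
def mainPhase : Prog :=
  .seq imagePhase (.seq gapPhase (.seq basisPhase (.seq exchangePhase
    (.seq scalePhase (.seq roundPhase outputPhase)))))

/-- A bound for the bit length of the images, the weights, the basis and the parameter `G`, when the
input numbers have at most `L` bits. -/
def basicBits (d n L : ℕ) : ℕ :=
  n * (d * (d * (2 * L + 1) + 2) + 2) + d * (d * (2 * L + 1) + 2) + d * (2 * L + 1) +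
    d * (3 * L) + 8 * L + 3

/-- A bound for the bit length of all numbers that are stored, in terms of `basicBits`. -/
def storeBits (d L : ℕ) : ℕ :=
  2 * (d * (2 * L + 1)) + d * (2 * L) + d * ((d * (2 * L) + 3 * L + 5) + L + 1) + 5 * L + 10

section

variable {K d n L b : ℕ} {s : Store} {x : Fin n → Fin d → ℤ} {A : Matrix (Fin d) (Fin d) ℤ}

theorem imageVal_eq (hx : ∀ (l : Fin n) (i : Fin d), s 1 l i = x l i)
    (hA : ∀ i j : Fin d, s 2 i j = A i j) (k : Fin n) (l : Fin d) :
    imageVal d s k l = ((A *ᵥ x k) l : ℤ) := by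
  rw [imageVal, Finset.sum_range]
  simp [Matrix.mulVec, dotProduct, hx, hA]

theorem normVal_eq (hx : ∀ (l : Fin n) (i : Fin d), s 1 l i = x l i)
    (hA : ∀ i j : Fin d, s 2 i j = A i j) (k : Fin n) :
    normVal d s k = ∑ l, |((A *ᵥ x k) l : ℚ)| := by
  rw [normVal, Finset.sum_range]
  exact Finset.sum_congr rfl fun l _ => by rw [imageVal_eq hx hA]

theorem Runs.mainPhase {B N : ℕ} {ε : ℚ} (hd1 : 1 ≤ d) (hd : s 0 0 0 = d) (hn : s 0 0 1 = n)
    (hB : s 0 0 2 = B) (hN : s 4 0 0 = N) (hx : ∀ (l : Fin n) (i : Fin d), s 1 l i = x l i)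
    (hA : ∀ i j : Fin d, s 2 i j = A i j) (h9 : ∀ i j, s 9 i j = 0) (h11 : ∀ i, s 11 i 0 = 0)
    (h17 : ∀ i, s 17 i 0 = 0) (h18 : s 18 0 0 = 0)
    (hx0 : ∀ k, x k ≠ 0) (hxb : ∀ k i, |x k i| ≤ 2 ^ b)
    (hspan : Submodule.span ℝ (Set.range fun k => intPoint (x k)) = ⊤) (hdet : A.det ≠ 0)
    (hBb : 2 ^ b ≤ 2 * B) (hNε : 1 ≤ ε * N)
    (hL : 2 ≤ L) (hLdet : detBound d b < 2 ^ L) (hLx : ∀ i j, bits (s 1 i j) ≤ L)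
    (hLA : ∀ i j, bits (s 2 i j) ≤ L) (hLd : bits (d : ℚ) ≤ L) (hLB : bits (B : ℚ) ≤ L)
    (hLN : bits (N : ℚ) ≤ L) (hK : storeBits d (basicBits d n L) ≤ K) :
    Runs K mainPhase s (10000 * (d + n + 1) ^ 3) fun s' => ∃ A' : Matrix (Fin d) (Fin d) ℤ,
      HasOutput s' A' ∧ A'.det ≠ 0 ∧
      (∀ i j, |(A' i j : ℚ)| ≤ d * (4 * (4 * d ^ 3 * ((2 * d * B) ^ d * N)) ^ (d + 1)
        * detBound d b)) ∧
      ∀ k, ‖radialMap (intMatrix A) (intPoint (x k))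
        - radialMap (intMatrix A') (intPoint (x k))‖ ≤ (ε : ℝ) := by
  set M := basicBits d n L with hM
  have hT : (50 + (n + 1) * ((d + 1) * (50 + (d + 1) * 150 + 250) + 250)) +
      ((50 + ((d + 1) * 150 + 50)) + ((50 + (d + 1) * 200) +
      (((n + 1) * ((d + 1) * (50 + (d + 1) * 150 + 50 + 100) +
        (50 + (50 + (d + 1) * 300) + ((d + 1) * 150 + 100 +
          (50 + (d + 1) * ((d + 1) * 150 + 100) + (50 + 50)) + 50)) + 100)) +
      ((50 + (d + 1) * (50 + (50 + (d + 1) * 300) + (50 + 50 + (50 + 50)) + 100)) +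
      (((d + 1) * ((d + 1) * 300 + 100)) +
        ((d + 1) * ((d + 1) * (50 + (d + 1) * 150 + 50 + 100) + 100)))))))
      ≤ 10000 * (d + n + 1) ^ 3 := by
    have h1 : d + 1 ≤ d + n + 1 := by omega
    have h2 : n + 1 ≤ d + n + 1 := by omega
    have h3 : 1 ≤ d + n + 1 := by omega
    generalize d + n + 1 = S at *
    generalize d + 1 = d' at *
    generalize n + 1 = n' at *
    have h4 : S ≤ S ^ 3 := Nat.le_self_pow (by norm_num) S
    have h5 : S ^ 2 ≤ S ^ 3 := Nat.pow_le_pow_right h3 (by norm_num)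
    have h6 : 1 ≤ S ^ 3 := h3.trans h4
    calc _ ≤ (50 + S * (S * (50 + S * 150 + 250) + 250)) +
          ((50 + (S * 150 + 50)) + ((50 + S * 200) +
          ((S * (S * (50 + S * 150 + 50 + 100) +
            (50 + (50 + S * 300) + (S * 150 + 100 +
              (50 + S * (S * 150 + 100) + (50 + 50)) + 50)) + 100)) +
          ((50 + S * (50 + (50 + S * 300) + (50 + 50 + (50 + 50)) + 100)) +
          ((S * (S * 300 + 100)) +
            (S * (S * (50 + S * 150 + 50 + 100) + 100))))))) := by gcongr
      _ ≤ _ := by nlinarith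
  -- The bounds for the bit lengths.
  have hM1 : n * (d * (d * (2 * L + 1) + 2) + 2) + 3 ≤ M := by
    rw [hM, basicBits]; omega
  have hM2 : d * (d * (2 * L + 1) + 2) + 1 ≤ M := by rw [hM, basicBits]; omega
  have hM3 : d * (2 * L + 1) + 1 ≤ M := by rw [hM, basicBits]; omega
  have hM4 : d * (3 * L) + 8 * L ≤ M := by rw [hM, basicBits]; omega
  have hLM : L ≤ M := by omega
  have hMK : M ≤ K := by rw [storeBits] at hK; omega
  have hK1 : 2 * M + 2 * (d * (2 * M + 1) + 1) + 3 ≤ K := by rw [storeBits] at hK; omega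
  have hK2 : d * (2 * M) + M + 1 ≤ K := by rw [storeBits] at hK; omega
  have hK3 : d * (2 * M) + 3 * M + 5 ≤ K := by rw [storeBits] at hK; omega
  have hK4 : d * ((d * (2 * M) + 3 * M + 5) + M + 1) + M + 1 ≤ K := by
    rw [storeBits] at hK; omega
  set G : ℚ := 4 * d ^ 3 * ((2 * d * B) ^ d * N) with hG
  -- The parameter `G` is large enough.
  have hdq : (1 : ℚ) ≤ d := by exact_mod_cast hd1
  have hΔ : (detBound d b : ℚ) ≤ (2 * d * B) ^ d := by
    have h1 : detBound d b ≤ (2 * d * B) ^ d := by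
      calc detBound d b ≤ d ^ d * (2 * B) ^ d :=
            Nat.mul_le_mul d.factorial_le_pow (Nat.pow_le_pow_left hBb d)
        _ = (2 * d * B) ^ d := by rw [← mul_pow]; congr 1; ring
    exact_mod_cast h1
  have hdet1 : (1 : ℚ) ≤ detBound d b := by exact_mod_cast one_le_detBound d b
  have hN1 : (1 : ℚ) ≤ N := by
    rcases Nat.eq_zero_or_pos N with h | h
    · rw [h] at hNε; norm_num at hNε
    · exact_mod_cast h
  have hd3 : (1 : ℚ) ≤ d ^ 3 := one_le_pow₀ hdq
  have hG1 : 1 ≤ G := by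
    have h1 : (1 : ℚ) ≤ (2 * d * B) ^ d := hdet1.trans hΔ
    have h2 : (1 : ℚ) ≤ (2 * d * B) ^ d * N := one_le_mul_of_one_le_of_one_le h1 hN1
    rw [hG]
    nlinarith
  have hGε : 4 * d ^ 3 * detBound d b ≤ ε * G := by
    have h1 : ε * G = 4 * d ^ 3 * (2 * d * B) ^ d * (ε * N) := by rw [hG]; ring
    rw [h1]
    calc (4 * d ^ 3 * detBound d b : ℚ) ≤ 4 * d ^ 3 * (2 * d * B) ^ d := by gcongr
      _ ≤ _ := le_mul_of_one_le_right (by positivity) hNε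
  suffices h : Runs K RatProg.mainPhase s _ _ from h.conseq hT fun _ h => h
  refine Runs.seq (Runs.imagePhase (d := d) (n := n) (L := L) hd hn hLx hLA (by omega)) ?_
  rintro s1 ⟨hs1, h16, h17', h18'⟩
  refine Runs.seq (Runs.gapPhase (d := d) (B := (B : ℚ)) (N := (N : ℚ)) (L := L)
    (by rw [hs1 0 (by decide), hd]) (by rw [hs1 0 (by decide), hB])
    (by rw [hs1 4 (by decide), hN]) hLd hLB hLN hL (by omega)) ?_
  rintro s2 ⟨hs2, h225, h225b⟩
  have hs02 : Same [8, 21, 27, 22, 23, 24, 6, 7, 26, 25] s s2 := hs1.trans hs2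
  refine Runs.seq (Runs.basisPhase (d := d) (by rw [hs02 0 (by decide), hd])
    (by rw [hs02 9 (by decide)]; exact h9)) ?_
  rintro s3 ⟨hs3, h312, h39, h310⟩
  have hs03 : Same [8, 21, 27, 22, 23, 24, 6, 7, 26, 25, 12, 9, 10] s s3 := hs02.trans hs3
  have hs13 : Same [26, 21, 25, 12, 22, 9, 10] s1 s3 := hs2.trans hs3
  have hH : s2 8 0 0 = s3 8 0 0 := by rw [hs3 8 (by decide)]
  have h37 (k : ℕ) (hk : k < n) : s3 7 k 0 = normVal d s k := by
    rw [hs13 7 (by decide), h17' k hk]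
  have hnorm (k : Fin n) : s3 7 k 0 = ∑ l, |((A *ᵥ x k) l : ℚ)| := by
    rw [h37 k k.2, normVal_eq hx hA]
  have hnormL (k : ℕ) : bits (normVal d s k) ≤ M := (bits_normVal_le hLx hLA k).trans hM2
  have hnorm1 (k : Fin n) : 1 ≤ s3 7 k 0 := by
    rw [hnorm]; exact one_le_sum_abs (mulVec_ne_zero hdet (hx0 k))
  have hHv : s3 8 0 0 = 1 + ∑ k ∈ Finset.range n, normVal d s k := by
    rw [hs13 8 (by decide), h18']
  have hHL : bits (s3 8 0 0) ≤ M := by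
    rw [hHv]
    have h3 := bits_sum_le (normVal d s) n fun j _ => bits_normVal_le (d := d) hLx hLA j
    have h4 := bits_add_le 1 (∑ i ∈ Finset.range n, normVal d s i)
    rw [bits_one] at h4
    linarith
  have hlt (k : Fin n) : s3 7 k 0 < s3 8 0 0 := by
    rw [h37 k k.2, hHv]
    have := Finset.single_le_sum (f := normVal d s) (s := Finset.range n)
      (fun i _ => Finset.sum_nonneg fun _ _ => abs_nonneg _) (Finset.mem_range.2 k.2)
    linarith
  have h0 : IsGreedy b x (fun l => s3 7 l 0) (s3 8 0 0) 0 (storeMat d s3 9) (storeVec d s3 10)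
      (storeVec d s3 11) (s3 12 0 0) := by
    convert isGreedy_zero (b := b) (x := x) (β := fun l => s3 7 l 0) (H := s3 8 0 0) using 1
    · ext i j
      change s3 9 i j = _
      rw [h39 i i.2 j j.2, Matrix.one_apply]
      simp [Fin.ext_iff]
    · funext i
      exact (h310 i i.2).trans hH
    · funext i
      change s3 11 i 0 = 0
      rw [hs03 11 (by decide), h11]
  refine Runs.seq (Runs.exchangePhase (d := d) (n := n) (L := M) (b := b) (x := x)
    (H := s3 8 0 0) (by rw [hs03 0 (by decide), hd]) (by rw [hs03 0 (by decide), hn])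
    (by rw [hs03 1 (by decide)]; exact hx) hxb
    (by rw [hs03 1 (by decide)]; exact fun i j => (hLx i j).trans hLM)
    (fun l hl => ⟨zero_le_one.trans (hnorm1 ⟨l, hl⟩), by rw [h37 l hl]; exact hnormL l⟩) hHL
    (hLdet.trans_le (Nat.pow_le_pow_right (by norm_num) hLM)) h0 hK1) ?_
  rintro s4 ⟨hs4, hgr⟩
  obtain ⟨hb9, hb10, hb12⟩ := hgr.bits_le
    (hLdet.trans_le (Nat.pow_le_pow_right (by norm_num) hLM)) (by omega)
    (fun l => (h37 l l.2).symm ▸ hnormL l) hHL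
  obtain ⟨σ, Y, hY, hWY, hD, hσ, hsupp⟩ := hgr.exists_basis hlt hspan
  have hGM : bits G ≤ M := by rw [hG, ← h225]; omega
  refine Runs.seq (Runs.scalePhase (d := d) (L := M) (G := G)
    (by rw [hs4 0 (by decide), hs03 0 (by decide), hd])
    (by rw [hs4 17 (by decide), hs03 17 (by decide)]; exact h17)
    (by rw [hs4 18 (by decide), hs03 18 (by decide)]; exact h18)
    (by rw [hs4 25 (by decide), hs3 25 (by decide), h225]) hG1
    hGM (fun i hi => ?_) hK2) ?_
  · have h1 : s4 10 i 0 = s3 7 (σ ⟨i, hi⟩) 0 := (hσ ⟨i, hi⟩).2.1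
    rw [h1, hs4 8 (by decide)]
    exact ⟨hnorm1 _, hlt _, by rw [h37 _ (σ ⟨i, hi⟩).2]; exact hnormL _⟩
  rintro s5 ⟨hs5, hgap, hb17⟩
  have hs35 : Same [21, 22, 23, 24, 13, 14, 15, 16, 12, 9, 10, 11, 19, 17, 18] s3 s5 :=
    hs4.trans hs5
  let σ' : ℕ → ℕ := fun i => if h : i < d then σ ⟨i, h⟩ else 0
  have hσ' (i : Fin d) : σ' i = σ i := by simp [σ']
  have h525 : s5 25 0 0 = G := by
    rw [hs35 25 (by decide), hs3 25 (by decide), h225]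
  have h56 (i l : Fin d) : s5 6 (σ' i) l = ((A *ᵥ fun j => Y j i) l : ℤ) := by
    have h1 : (fun j => Y j i) = x (σ i) := funext (hσ i).2.2
    rw [h1, hσ', hs35 6 (by decide), hs13 6 (by decide), h16 _ (σ i).2 l l.2, imageVal_eq hx hA]
  have h56b (i l : ℕ) (hi : i < d) (hl : l < d) : bits (s5 6 (σ' i) l) ≤ M := by
    have h2 : σ' i < n := by rw [hσ' ⟨i, hi⟩]; exact (σ ⟨i, hi⟩).2
    rw [hs35 6 (by decide), hs13 6 (by decide), h16 _ h2 l hl]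
    exact (bits_imageVal_le hLx hLA _ _).trans hM3
  have hentry (l i : ℕ) (hl : l < d) (hi : i < d) :
      bits G + bits (s5 17 i 0) + bits (s5 6 (σ' i) l) + 4 ≤ d * (2 * M) + 3 * M + 5 := by
    have h1 := hb17 i hi
    have h2 := h56b i l hi hl
    omega
  refine Runs.seq (Runs.roundPhase (d := d) (σ := σ')
    (by rw [hs35 0 (by decide), hs03 0 (by decide), hd]) (fun i hi => ?_) (fun l hl i hi => ?_)) ?_
  · rw [hs5 11 (by decide), hσ' ⟨i, hi⟩]
    exact (hσ ⟨i, hi⟩).1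
  · rw [h525]
    exact (hentry l i hl hi).trans hK3
  rintro s6 ⟨hs6, h620⟩
  have hs46 : Same [19, 21, 14, 15, 22, 17, 18, 20] s4 s6 := hs5.trans hs6
  refine (Runs.outputPhase (d := d) (L := M) (Lm := d * (2 * M) + 3 * M + 5)
    (by rw [hs6 0 (by decide), hs35 0 (by decide), hs03 0 (by decide), hd])
    (by rw [hs46 12 (by decide)]; exact hb12)
    (by rw [hs46 9 (by decide)]; exact fun i hi j hj => hb9 ⟨i, hi⟩ ⟨j, hj⟩)
    (fun l hl i hi => ?_) hK4).conseq le_rfl ?_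
  · rw [h620 l hl i hi, h525]
    exact (bits_roundedEntry_le _ _ _ _).trans (hentry l i hl hi)
  rintro s7 ⟨-, h73⟩
  have hw (i : Fin d) : storeVec d s4 10 i = ∑ l, |((A *ᵥ fun j => Y j i) l : ℚ)| := by
    have h1 : (fun j => Y j i) = x (σ i) := funext (hσ i).2.2
    rw [(hσ i).2.1, h1]
    exact hnorm (σ i)
  refine ⟨roundedMatrix A Y (storeVec d s5 17) G, fun l j => ?_,
    det_roundedMatrix_ne_zero (det_ne_zero_of_mul_map_eq_one hWY),
    abs_roundedMatrix_le hY hw hG1 hgap, fun k => ?_⟩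
  · rw [h73 l l.2 j j.2, roundedMatrix_apply hWY, hs46 12 (by decide), hD, Finset.sum_range]
    congr 1
    refine Finset.sum_congr rfl fun i _ => ?_
    rw [h620 l l.2 i i.2, h525, h56, hs46 9 (by decide)]
    simp only [Fin.ext_iff]
    rfl
  · refine norm_radialMap_sub_roundedMatrix_le hY hWY hw hG1 hGε hgap (hxb k) (hx0 k)
      (fun i hi => ?_) hdet
    rw [← hnorm k]
    exact hsupp k i hi

end


/-- The sign of the only entry of the matrix in dimension one. -/
def signPhase : Prog :=
  .ite (.read 2 (.lit 0) (.lit 0)) (.lit 0) (.assign 3 (.lit 0) (.lit 0) (.lit (-1)))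
    (.assign 3 (.lit 0) (.lit 0) (.lit 1))

/-- The rounding, with the integer in the variable `4` in place of the inverse of the accuracy. -/
def roundingBody : Prog :=
  .ite (.read 0 (.lit 0) (.lit 0)) (.lit 1) signPhase
    (.seq copyPhase (.ite (var 5) (.lit 0) .skip mainPhase))

/-- Stores an integer slightly above the inverse of the accuracy in the variable `4`, and erases the
accuracy, so that its digits do not enter any other number. -/
def accuracyPhase : Prog :=
  .seq (set 4 (.add (.rnd (.div (.lit 1) (.read 0 (.lit 0) (.lit 3)))) (.lit 1)))
    (.assign 0 (.lit 0) (.lit 3) (.lit 0))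

/-- The rounding program. -/
def roundingProgram : Prog := .seq accuracyPhase roundingBody

theorem Runs.signPhase {K : ℕ} {s : Store} :
    Runs K signPhase s 100 fun s' => s' 3 0 0 = if s 2 0 0 ≤ 0 then -1 else 1 := by
  have h1K (hs : Bdd K s) : bits 1 ≤ K := by
    rw [bits_one]; exact (one_le_bits _).trans (hs 0 0 0)
  refine Runs.ite (T := 50) (u := s 2 0 0) (v := 0) (by simp [eval]) (by simp [eval])
    (fun hle => ?_) fun hlt => ?_
  · refine Runs.assign (i' := 0) (j' := 0) (v := -1) (by simp [eval]) (by simp [eval])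
      (by simp [eval]) (fun hs => by rw [bits_neg]; exact h1K hs) ?_
    rw [Store.write_self, if_pos hle]
  · refine Runs.assign (i' := 0) (j' := 0) (v := 1) (by simp [eval]) (by simp [eval])
      (by simp [eval]) h1K ?_
    rw [Store.write_self, if_neg (not_le.2 hlt)]

/-- The output in dimension at most one. -/
theorem sign_matrix_spec {d : ℕ} (hd : d ≤ 1) (A : Matrix (Fin d) (Fin d) ℤ) (hA : A.det ≠ 0) :
    (Matrix.of fun i j : Fin d => if A i j ≤ 0 then (-1 : ℤ) else 1).det ≠ 0 ∧
    ∀ x : EuclideanSpace ℝ (Fin d), radialMap (intMatrix A) x =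
      radialMap (intMatrix (Matrix.of fun i j : Fin d => if A i j ≤ 0 then (-1 : ℤ) else 1)) x := by
  obtain rfl | rfl : d = 0 ∨ d = 1 := by omega
  · exact ⟨by simp, fun x => Subsingleton.elim _ _⟩
  · have ha : A 0 0 ≠ 0 := by simpa using hA
    constructor
    · rw [Matrix.det_fin_one, Matrix.of_apply]
      split_ifs <;> norm_num
    · intro x
      have h1 : intMatrix A = |(A 0 0 : ℝ)| •
          intMatrix (Matrix.of fun i j : Fin 1 => if A i j ≤ 0 then (-1 : ℤ) else 1) := by
        ext i j
        obtain rfl : i = 0 := Subsingleton.elim _ _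
        obtain rfl : j = 0 := Subsingleton.elim _ _
        simp only [intMatrix, Matrix.map_apply, Matrix.smul_apply, Matrix.of_apply, smul_eq_mul]
        split_ifs with h
        · have h2 : (A 0 0 : ℝ) ≤ 0 := by exact_mod_cast h
          rw [abs_of_nonpos h2]; push_cast; ring
        · have h2 : (0 : ℝ) ≤ A 0 0 := by exact_mod_cast (not_le.1 h).le
          rw [abs_of_nonneg h2]; push_cast; ring
      rw [h1, radialMap_smul _ (abs_pos.2 (by exact_mod_cast ha))]

theorem entry_bound {d b B N : ℕ} {ε : ℚ} (hd : 2 ≤ d) (hb : 1 ≤ b) (hε : 0 < ε) (hε1 : ε < 1)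
    (hB : B ≤ 2 ^ b) (hN : (N : ℚ) ≤ ε⁻¹ + 3 / 2) :
    (d : ℚ) * (4 * (4 * d ^ 3 * ((2 * d * B) ^ d * N)) ^ (d + 1) * detBound d b)
      ≤ ((d : ℚ) / ε) ^ (25 * d ^ 3 * b) := by
  set e : ℚ := (d : ℚ) / ε with he
  have hdq : (2 : ℚ) ≤ d := by exact_mod_cast hd
  have hde : (d : ℚ) ≤ e := by
    rw [he, le_div_iff₀ hε]; nlinarith
  have he2 : 2 ≤ e := hdq.trans hde
  have he1 : 1 ≤ e := by linarith
  have hinv : 2 * ε⁻¹ ≤ e := by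
    rw [he, div_eq_mul_inv]
    exact mul_le_mul_of_nonneg_right hdq (inv_nonneg.2 hε.le)
  have h4 : (4 : ℚ) ≤ e ^ 2 := by nlinarith
  have hNe : (N : ℚ) ≤ e ^ 2 := by
    have h1 : 1 ≤ ε⁻¹ := (one_le_inv₀ hε).2 hε1.le
    nlinarith
  have h2b : (2 : ℚ) ^ b ≤ e ^ b := by gcongr
  have hBe : (B : ℚ) ≤ e ^ b := by
    refine le_trans ?_ h2b
    exact_mod_cast hB
  have hΔ : (2 * d * B : ℚ) ^ d ≤ e ^ (3 * b * d) := by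
    calc (2 * d * B : ℚ) ^ d ≤ (e * e * e ^ b) ^ d := by gcongr
      _ = e ^ ((2 + b) * d) := by rw [pow_mul]; congr 1; ring
      _ ≤ _ := pow_le_pow_right₀ he1 (Nat.mul_le_mul_right d (by omega))
  have hdet : (detBound d b : ℚ) ≤ e ^ (d + b * d) := by
    have h1 : detBound d b ≤ d ^ d * (2 ^ b) ^ d :=
      Nat.mul_le_mul_right _ d.factorial_le_pow
    calc (detBound d b : ℚ) ≤ (d : ℚ) ^ d * (2 ^ b) ^ d := by exact_mod_cast h1
      _ ≤ e ^ d * (e ^ b) ^ d := by gcongr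
      _ = _ := by rw [← pow_mul, ← pow_add]
  have hexp : 1 + (2 + (2 + 3 + (3 * b * d + 2)) * (d + 1) + (d + b * d)) ≤ 25 * d ^ 3 * b := by
    have h1 : 1 ≤ b * d := Nat.one_le_iff_ne_zero.2 (by positivity)
    have h2 : d ≤ b * d := Nat.le_mul_of_pos_left d hb
    have h3 : b * d ≤ b * d ^ 2 := Nat.mul_le_mul_left b (Nat.le_self_pow (by norm_num) d)
    have h4 : b * d ^ 2 ≤ b * d ^ 3 := Nat.mul_le_mul_left b (Nat.pow_le_pow_right (by omega) (by norm_num))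
    nlinarith
  calc (d : ℚ) * (4 * (4 * d ^ 3 * ((2 * d * B) ^ d * N)) ^ (d + 1) * detBound d b)
      ≤ e * (e ^ 2 * (e ^ 2 * e ^ 3 * (e ^ (3 * b * d) * e ^ 2)) ^ (d + 1) * e ^ (d + b * d)) := by
        gcongr
    _ = e ^ (1 + (2 + (2 + 3 + (3 * b * d + 2)) * (d + 1) + (d + b * d))) := by
        rw [pow_add e 1, pow_one, pow_add e _ (d + b * d), pow_add e 2,
          pow_mul e (2 + 3 + (3 * b * d + 2)), pow_add e (2 + 3), pow_add e 2 3,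
          pow_add e (3 * b * d)]
    _ ≤ _ := pow_le_pow_right₀ he1 hexp

theorem Runs.roundingBody {K d n L b r B N : ℕ} {s : Store} {x : Fin n → Fin d → ℤ}
    {A : Matrix (Fin d) (Fin d) ℤ} {ε : ℚ} (hd : s 0 0 0 = d) (hn : s 0 0 1 = n)
    (hB : s 0 0 2 = B) (hN : s 4 0 0 = N) (hx : ∀ (l : Fin n) (i : Fin d), s 1 l i = x l i)
    (hA : ∀ i j : Fin d, s 2 i j = A i j) (h5 : s 5 0 0 = 0) (h9 : ∀ i j, s 9 i j = 0)
    (h11 : ∀ i, s 11 i 0 = 0) (h17 : ∀ i, s 17 i 0 = 0) (h18 : s 18 0 0 = 0)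
    (hx0 : ∀ k, x k ≠ 0) (hxb : ∀ k i, |x k i| ≤ 2 ^ b)
    (hspan : Submodule.span ℝ (Set.range fun k => intPoint (x k)) = ⊤)
    (hAr : ∀ i j, |A i j| ≤ 2 ^ (r * b)) (hdet : A.det ≠ 0) (hε : 0 < ε) (hε1 : ε < 1)
    (hBb' : B ≤ 2 ^ b) (hBb : 2 ^ b ≤ 2 * B) (hNε : 1 ≤ ε * N) (hN' : (N : ℚ) ≤ ε⁻¹ + 3 / 2)
    (hL : 2 ≤ L) (hLdet : detBound d b < 2 ^ L) (hLx : ∀ i j, bits (s 1 i j) ≤ L)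
    (hLA : ∀ i j, bits (s 2 i j) ≤ L) (hLd : bits (d : ℚ) ≤ L) (hLB : bits (B : ℚ) ≤ L)
    (hLN : bits (N : ℚ) ≤ L) (hK : storeBits d (basicBits d n L) ≤ K) :
    Runs K roundingBody s (20000 * (d + n + 1) ^ 3) fun s' => ∃ A' : Matrix (Fin d) (Fin d) ℤ,
      HasOutput s' A' ∧ A'.det ≠ 0 ∧
      (∀ i j, |(A' i j : ℚ)| ≤ ((d : ℚ) / ε) ^ (25 * d ^ 3 * b)) ∧
      ∀ k, ‖radialMap (intMatrix A) (intPoint (x k))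
        - radialMap (intMatrix A') (intPoint (x k))‖ ≤ (ε : ℝ) := by
  have hεr : (0 : ℝ) ≤ ε := by exact_mod_cast hε.le
  have hone (i : Fin d) : 1 ≤ ((d : ℚ) / ε) ^ (25 * d ^ 3 * b) := by
    refine one_le_pow₀ ?_
    rw [le_div_iff₀ hε]
    have : (1 : ℚ) ≤ d := by exact_mod_cast Fin.pos i
    linarith
  have hT : (d + 1) * ((d + 1) * 250 + 100) + (10000 * (d + n + 1) ^ 3 + 50) + 50
      ≤ 20000 * (d + n + 1) ^ 3 := by
    have h1 : d + 1 ≤ d + n + 1 := by omega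
    generalize d + n + 1 = S at *
    have h3 : 1 ≤ S := by omega
    have h4 : S ≤ S ^ 3 := Nat.le_self_pow (by norm_num) S
    have h5 : S ^ 2 ≤ S ^ 3 := Nat.pow_le_pow_right h3 (by norm_num)
    calc _ ≤ S * (S * 250 + 100) + (10000 * S ^ 3 + 50) + 50 := by gcongr
      _ ≤ _ := by nlinarith
  have hT13 : 100 ≤ 10000 * (d + n + 1) ^ 3 := by
    have : 1 ≤ (d + n + 1) ^ 3 := Nat.one_le_pow _ _ (by omega)
    omega
  obtain ⟨T, hTeq⟩ : ∃ T, T = 10000 * (d + n + 1) ^ 3 := ⟨_, rfl⟩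
  rw [← hTeq] at hT hT13
  refine Runs.conseq (T := (d + 1) * ((d + 1) * 250 + 100) + (T + 50) + 50)
    (Runs.ite (u := d) (v := 1) (by simp [eval, hd]) (by simp [eval]) (fun hle => ?_)
    fun hlt => ?_) hT fun _ h => h
  · have hd1 : d ≤ 1 := by exact_mod_cast hle
    obtain ⟨h1, h2⟩ := sign_matrix_spec hd1 A hdet
    refine Runs.signPhase.conseq (by omega) fun s' hs' => ⟨_, fun i j => ?_, h1, fun i j => ?_, fun k => ?_⟩
    · have hi : (i : ℕ) = 0 := by omega
      have hj : (j : ℕ) = 0 := by omega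
      have h3 := hA i j
      rw [hi, hj] at h3 ⊢
      rw [hs', h3, Matrix.of_apply]
      have h4 : ((A i j : ℤ) : ℚ) ≤ 0 ↔ A i j ≤ 0 := by exact_mod_cast Iff.rfl
      simp only [h4]
      split_ifs <;> simp
    · refine le_trans (le_of_eq ?_) (hone i)
      rw [Matrix.of_apply]
      split_ifs <;> simp
    · rw [h2, sub_self, norm_zero]
      exact hεr
  · have hd2 : 2 ≤ d := by exact_mod_cast hlt
    refine Runs.seq (Runs.copyPhase (d := d) hd h5) ?_
    rintro s1 ⟨hs1, h3, h4⟩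
    refine Runs.ite (T := T) (u := s1 5 0 0) (v := 0) (by rw [eval_var]) (by simp [eval]) (fun hle' => ?_)
      fun hlt' => ?_
    · have h6 : ∀ i < d, ∀ j < d, s 2 i j * s 2 i j ≤ 1 := by
        rcases h4 with h4 | h4
        · exact h4.2
        · rw [h4.1] at hle'; norm_num at hle'
      refine (Runs.skip ⟨A, fun i j => ?_, hdet, fun i j => ?_, fun k => ?_⟩).conseq (by omega)
        fun _ h => h
      · rw [h3 i i.2 j j.2, hA]
      · refine le_trans ?_ (hone i)
        have := h6 i i.2 j j.2
        rw [hA, ← abs_mul_abs_self] at this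
        nlinarith [abs_nonneg (A i j : ℚ)]
      · rw [sub_self, norm_zero]
        exact hεr
    · obtain ⟨i, hi, j, hj, hij⟩ : ∃ i < d, ∃ j < d, 1 < s 2 i j * s 2 i j := by
        rcases h4 with h4 | h4
        · rw [h4.1] at hlt'; norm_num at hlt'
        · exact h4.2
      -- An entry of absolute value greater than `1` forces `b` to be positive.
      have hb : 1 ≤ b := by
        by_contra hb0
        obtain rfl : b = 0 := by omega
        have h6 := hAr ⟨i, hi⟩ ⟨j, hj⟩
        rw [mul_zero, pow_zero] at h6
        rw [hA ⟨i, hi⟩ ⟨j, hj⟩, ← abs_mul_abs_self] at hij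
        have h7 : |(A ⟨i, hi⟩ ⟨j, hj⟩ : ℚ)| ≤ 1 := by exact_mod_cast h6
        nlinarith [abs_nonneg (A ⟨i, hi⟩ ⟨j, hj⟩ : ℚ)]
      refine (Runs.mainPhase (d := d) (n := n) (L := L) (b := b) (B := B) (N := N) (x := x) (A := A)
        (ε := ε) (by omega) (by rw [hs1 0 (by decide), hd]) (by rw [hs1 0 (by decide), hn])
        (by rw [hs1 0 (by decide), hB]) (by rw [hs1 4 (by decide), hN])
        (by rw [hs1 1 (by decide)]; exact hx) (by rw [hs1 2 (by decide)]; exact hA)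
        (by rw [hs1 9 (by decide)]; exact h9) (by rw [hs1 11 (by decide)]; exact h11)
        (by rw [hs1 17 (by decide)]; exact h17) (by rw [hs1 18 (by decide)]; exact h18)
        hx0 hxb hspan hdet hBb hNε hL hLdet (by rw [hs1 1 (by decide)]; exact hLx)
        (by rw [hs1 2 (by decide)]; exact hLA) hLd hLB hLN hK).conseq hTeq.ge ?_
      rintro s2 ⟨A', g1, g2, g3, g4⟩
      exact ⟨A', g1, g2, fun i j => (g3 i j).trans (entry_bound hd2 hb hε hε1 hBb' hN'), g4⟩


/-! ### Bounds for the input -/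

theorem bitLength_inv {q : ℚ} (hq : q ≠ 0) : bitLength q⁻¹ = bitLength q := by
  have h1 : q.num.natAbs ≠ 0 := by simpa using hq
  have h2 : (q⁻¹).num.natAbs = q.den := by
    rw [Rat.num_inv, Int.natAbs_mul, Int.natAbs_sign_of_ne_zero (by simpa using hq), one_mul,
      Int.natAbs_natCast]
  rw [bitLength, bitLength, h2, Rat.den_inv_of_ne_zero hq, add_comm]

/-- The integer that the program uses in place of the inverse of the accuracy. -/
theorem exists_natCast_eq_round_inv_add_one {ε : ℚ} (hε : 0 < ε) :
    ∃ N : ℕ, (N : ℚ) = ((round ε⁻¹ : ℤ) : ℚ) + 1 ∧ (round ε⁻¹).natAbs ≤ N ∧ 1 ≤ ε * N ∧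
      (N : ℚ) ≤ ε⁻¹ + 3 / 2 := by
  have h1 : 0 ≤ round ε⁻¹ := by
    rw [round_eq]
    exact Int.floor_nonneg.2 (by have := inv_pos.2 hε; linarith)
  have h2 : (((round ε⁻¹).toNat + 1 : ℕ) : ℚ) = ((round ε⁻¹ : ℤ) : ℚ) + 1 := by
    have h3 : (((round ε⁻¹).toNat : ℤ) : ℚ) = ((round ε⁻¹ : ℤ) : ℚ) := by
      rw [Int.toNat_of_nonneg h1]
    push_cast at h3 ⊢
    rw [h3]
  have hround := abs_le.1 (abs_sub_round ε⁻¹)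
  refine ⟨(round ε⁻¹).toNat + 1, h2, by omega, ?_, by rw [h2]; linarith [hround.1]⟩
  rw [h2]
  calc 1 = ε * ε⁻¹ := (mul_inv_cancel₀ hε.ne').symm
    _ ≤ _ := mul_le_mul_of_nonneg_left (by linarith [hround.2]) hε.le

/-- The accuracy is inverted, which does not change its bit length, and then rounded. -/
theorem Exec.accuracyPhase {W : ℕ} {s : Store} {ε N : ℚ} (hs : s 0 0 3 = ε) (hε : ε ≠ 0)
    (hN : N = ((round ε⁻¹ : ℤ) : ℚ) + 1) (hW : 4 ≤ W) (hWε : bitLength ε ≤ W)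
    (hWr : bitLength ((round ε⁻¹ : ℤ) : ℚ) ≤ W) (hWN : bitLength N ≤ W) :
    Exec W accuracyPhase s 15 ((s.write 4 0 0 N).write 0 0 3 0) := by
  have hb0 : bitLength 0 ≤ W := by
    have : bitLength 0 = 1 := by simp [bitLength]
    omega
  have hb1 : bitLength 1 ≤ W := by
    have : bitLength 1 = 2 := by simp [bitLength]
    omega
  have hb3 : bitLength 3 ≤ W := by
    have : bitLength 3 ≤ 2 * 2 := (bitLength_le_two_mul_bits 3).trans (by
      have := bits_natCast_le (z := 3) (K := 2) (by norm_num) (by norm_num)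
      norm_num at this
      omega)
    omega
  have hread : eval s (.read 0 (.lit 0) (.lit 3)) = ε := by
    simp [eval, hs]
  have hdiv : eval s (.div (.lit 1) (.read 0 (.lit 0) (.lit 3))) = ε⁻¹ := by
    rw [eval, hread]; simp [eval]
  have hrnd : eval s (.rnd (.div (.lit 1) (.read 0 (.lit 0) (.lit 3))))
      = ((round ε⁻¹ : ℤ) : ℚ) := by
    rw [eval, hdiv]
  have hval : eval s (.add (.rnd (.div (.lit 1) (.read 0 (.lit 0) (.lit 3)))) (.lit 1)) = N := by
    rw [eval, hrnd, hN]; simp [eval]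
  have hfit (s : Store) : Fits W s (.lit 0) ∧ Fits W s (.lit 1) ∧ Fits W s (.lit 3) := by
    simpa [Fits] using ⟨hb0, hb1, hb3⟩
  obtain ⟨h0, h1, h3⟩ := hfit s
  have h := Exec.assign (W := W) 4 (.lit 0) (.lit 0)
    (.add (.rnd (.div (.lit 1) (.read 0 (.lit 0) (.lit 3)))) (.lit 1)) s h0 h0
    ⟨⟨⟨h1, ⟨h0, h3, by rwa [hread]⟩, by rwa [hdiv, bitLength_inv hε]⟩, by rwa [hrnd]⟩, h1,
      by rwa [hval]⟩
  rw [hval] at h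
  obtain ⟨g0, -, g3⟩ := hfit (s.write 4 0 0 N)
  have g := Exec.assign (W := W) 0 (.lit 0) (.lit 3) (.lit 0) (s.write 4 0 0 N) g0 g3 g0
  have hf3 : ⌊((3 : ℤ) : ℚ)⌋₊ = 3 := by
    have := Nat.floor_natCast (R := ℚ) 3
    exact_mod_cast this
  simp only [eval, cost, hf3, Int.cast_zero, Nat.floor_zero] at h g
  exact .seq _ _ _ _ _ _ _ h g

theorem detBound_lt {d b L : ℕ} (hL : d * d + b * d + 1 ≤ L) : detBound d b < 2 ^ L := by
  calc detBound d b ≤ d ^ d * (2 ^ b) ^ d := Nat.mul_le_mul_right _ d.factorial_le_pow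
    _ ≤ (2 ^ d) ^ d * (2 ^ b) ^ d := by
        gcongr
        exact Nat.lt_two_pow_self.le
    _ = 2 ^ (d * d + b * d) := by rw [← pow_mul, ← pow_mul, ← pow_add]
    _ < 2 ^ L := Nat.pow_lt_pow_right (by norm_num) (by omega)

theorem storeBits_basicBits_le {d n U : ℕ} (hd : d ≤ U) (hn : n ≤ U) (hU : 1 ≤ U) :
    storeBits d (basicBits d n (2 * U ^ 2)) ≤ 3000 * U ^ 7 := by
  have h1 : basicBits d n (2 * U ^ 2) ≤ 60 * U ^ 5 := by
    have h2 : U ≤ U ^ 5 := Nat.le_self_pow (by norm_num) U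
    have h3 : U ^ 2 ≤ U ^ 5 := Nat.pow_le_pow_right hU (by norm_num)
    have h4 : U ^ 3 ≤ U ^ 5 := Nat.pow_le_pow_right hU (by norm_num)
    have h5 : U ^ 4 ≤ U ^ 5 := Nat.pow_le_pow_right hU (by norm_num)
    calc basicBits d n (2 * U ^ 2)
        ≤ U * (U * (U * (2 * (2 * U ^ 2) + 1) + 2) + 2) + U * (U * (2 * (2 * U ^ 2) + 1) + 2) +
          U * (2 * (2 * U ^ 2) + 1) + U * (3 * (2 * U ^ 2)) + 8 * (2 * U ^ 2) + 3 := by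
          unfold basicBits; gcongr
      _ ≤ _ := by nlinarith
  have h2 : U ^ 5 ≤ U ^ 7 := Nat.pow_le_pow_right hU (by norm_num)
  have h3 : U ^ 6 ≤ U ^ 7 := Nat.pow_le_pow_right hU (by norm_num)
  have h4 : U ^ 2 ≤ U ^ 7 := Nat.pow_le_pow_right hU (by norm_num)
  have h5 : U ≤ U ^ 7 := Nat.le_self_pow (by norm_num) U
  calc storeBits d (basicBits d n (2 * U ^ 2))
      ≤ 2 * (U * (2 * (60 * U ^ 5) + 1)) + U * (2 * (60 * U ^ 5)) +
        U * ((U * (2 * (60 * U ^ 5)) + 3 * (60 * U ^ 5) + 5) + 60 * U ^ 5 + 1) +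
        5 * (60 * U ^ 5) + 10 := by
        unfold storeBits; gcongr
    _ ≤ _ := by nlinarith

/-- The resources used by the program and the properties of its output.  The constant is kept as a
variable. -/
theorem roundingProgram_spec {C d n b r B : ℕ} (hC : 600000 ≤ C) {x : Fin n → Fin d → ℤ}
    {A : Matrix (Fin d) (Fin d) ℤ} {ε : ℚ} (hx0 : ∀ k, x k ≠ 0) (hxb : ∀ k i, |x k i| ≤ 2 ^ b)
    (hspan : Submodule.span ℝ (Set.range fun k => intPoint (x k)) = ⊤)
    (hAr : ∀ i j, |A i j| ≤ 2 ^ (r * b)) (hrank : (intMatrix A).rank = d)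
    (hε : 0 < ε) (hε1 : ε < 1) (hBb' : B ≤ 2 ^ b) (hBb : 2 ^ b ≤ 2 * B) :
    ∃ (A' : Matrix (Fin d) (Fin d) ℤ) (t : ℕ) (s' : Store),
      Exec (bitLength ε + C * (d + n + r + b + Nat.clog 2 ⌈ε⁻¹⌉₊ + 1) ^ C)
        roundingProgram (inputStore B x A ε) t s' ∧
      t ≤ C * (d + n + r + 1) ^ C ∧ HasOutput s' A' ∧ (intMatrix A').rank = d ∧
      (∀ i j, |(A' i j : ℚ)| ≤ ((d : ℚ) / ε) ^ (C * d ^ 3 * b)) ∧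
      ∀ k, ‖radialMap (intMatrix A) (intPoint (x k))
          - radialMap (intMatrix A') (intPoint (x k))‖ ≤ (ε : ℝ) := by
  have hdet := (rank_intMatrix_eq_iff A).1 hrank
  set lg := Nat.clog 2 ⌈ε⁻¹⌉₊ with hlg
  set U := d + n + r + b + lg + 1 with hU
  have hU1 : 1 ≤ U := by omega
  set L := 2 * U ^ 2 with hLdef
  have hLU : U + 1 ≤ L := by nlinarith
  have hL2 : 2 ≤ L := by omega
  set K := storeBits d (basicBits d n L) with hK
  have hLK : L ≤ K := by rw [hK, storeBits, basicBits]; omega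
  set W := bitLength ε + C * U ^ C with hW
  have hKW : bitLength ε + 200 * K ≤ W := by
    have h1 : K ≤ 3000 * U ^ 7 := storeBits_basicBits_le (by omega) (by omega) hU1
    have h2 : U ^ 7 ≤ U ^ C := Nat.pow_le_pow_right hU1 (by omega)
    have h3 : 600000 * U ^ 7 ≤ C * U ^ C := Nat.mul_le_mul hC h2
    omega
  -- The integer that replaces the inverse of the accuracy.
  obtain ⟨N, hN, hrN, hNε, hN'⟩ := exists_natCast_eq_round_inv_add_one hε
  have hNlt : N < 2 ^ L := by
    have h1 : ε⁻¹ ≤ 2 ^ lg := by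
      have h2 : ⌈ε⁻¹⌉₊ ≤ 2 ^ lg := Nat.le_pow_clog one_lt_two _
      exact (Nat.le_ceil _).trans (by exact_mod_cast h2)
    have h3 : (1 : ℚ) ≤ 2 ^ lg := one_le_pow₀ one_le_two
    have h4 : (N : ℚ) < 2 ^ (lg + 2) := by
      rw [pow_add]; linarith
    have h5 : N < 2 ^ (lg + 2) := by exact_mod_cast h4
    exact h5.trans_le (Nat.pow_le_pow_right (by norm_num) (by omega))
  have hLN : bits (N : ℚ) ≤ L := bits_natCast_le (by omega) hNlt
  have hLr : bits ((round ε⁻¹ : ℤ) : ℚ) ≤ L :=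
    bits_intCast_le (by omega) (hrN.trans_lt hNlt)
  -- The bit lengths of the other input numbers.
  have hpow {k : ℕ} (hk : k < L) : 2 ^ k < 2 ^ L := Nat.pow_lt_pow_right (by norm_num) hk
  have hint {z : ℤ} {k : ℕ} (hk : k < L) (hz : |z| ≤ 2 ^ k) : bits (z : ℚ) ≤ L := by
    refine bits_intCast_le (by omega) (lt_of_le_of_lt ?_ (hpow hk))
    rw [Int.abs_eq_natAbs] at hz
    exact_mod_cast hz
  have hUU : U * U = U ^ 2 := by ring
  have hrb : r * b < L := by
    have : r * b ≤ U * U := Nat.mul_le_mul (by omega) (by omega)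
    have : 1 ≤ U ^ 2 := Nat.one_le_pow _ _ hU1
    omega
  have hLdet : detBound d b < 2 ^ L := by
    refine detBound_lt ?_
    have h1 : d * d ≤ U * U := Nat.mul_le_mul (by omega) (by omega)
    have h2 : b * d + 1 ≤ U * U := by
      have h3 : b * d + b + d + 1 ≤ U * U := by
        calc b * d + b + d + 1 = (b + 1) * (d + 1) := by ring
          _ ≤ U * U := Nat.mul_le_mul (by omega) (by omega)
      omega
    omega
  have hLd : bits (d : ℚ) ≤ L :=
    bits_natCast_le (by omega) (Nat.lt_two_pow_self.trans (hpow (by omega)))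
  have hLn : bits (n : ℚ) ≤ L :=
    bits_natCast_le (by omega) (Nat.lt_two_pow_self.trans (hpow (by omega)))
  have hLB : bits (B : ℚ) ≤ L := bits_natCast_le (by omega) (hBb'.trans_lt (hpow (by omega)))
  have hL0 : bits 0 ≤ L := by rw [bits_zero]; omega
  set s := inputStore B x A ε with hs
  have hLx (i j : ℕ) : bits (s 1 i j) ≤ L := by
    simp only [hs, inputStore]
    split_ifs
    · exact hint (by omega) (hxb _ _)
    · exact hL0
  have hLA (i j : ℕ) : bits (s 2 i j) ≤ L := by
    simp only [hs, inputStore]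
    split_ifs
    · exact hint hrb (hAr _ _)
    · exact hL0
  set s2 := (s.write 4 0 0 N).write 0 0 3 0 with hs2
  have hbdd : Bdd K s2 := by
    intro a i j
    refine le_trans ?_ hLK
    rw [hs2, Store.write_apply]
    split_ifs with h1
    · exact hL0
    rw [Store.write_apply]
    split_ifs with h2
    · exact hLN
    rw [hs]
    unfold inputStore
    split
    · exact hLd
    · exact hLn
    · exact hLB
    · exact absurd ⟨rfl, rfl, rfl⟩ h1
    · split_ifs
      · exact hint (by omega) (hxb _ _)
      · exact hL0
    · split_ifs
      · exact hint hrb (hAr _ _)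
      · exact hL0
    · exact hL0
  have hsame {a : ℕ} (h0 : a ≠ 0) (h4 : a ≠ 4) : s2 a = s a := by
    rw [hs2, Store.write_ne _ h0, Store.write_ne _ h4]
  have h20 (j : ℕ) (hj : j ≠ 3) : s2 0 0 j = s 0 0 j := by
    rw [hs2, Store.write_same, if_neg (fun h => hj h.2), Store.write_ne _ (by decide)]
  have hexec : Exec W accuracyPhase s 15 s2 := by
    have h1 := bitLength_le_two_mul_bits ((round ε⁻¹ : ℤ) : ℚ)
    have h2 := bitLength_le_two_mul_bits (N : ℚ)
    exact Exec.accuracyPhase (ε := ε) rfl hε.ne' hN (by omega) (by omega) (by omega) (by omega)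
  obtain ⟨t, s', ht, hexec', -, A', hout, hdet', hentry, hnorm⟩ :=
    Runs.roundingBody (K := K) (d := d) (n := n) (L := L) (b := b) (r := r) (B := B) (N := N)
      (s := s2) (x := x) (A := A) (ε := ε) (by rw [h20 0 (by decide)]; rfl)
      (by rw [h20 1 (by decide)]; rfl) (by rw [h20 2 (by decide)]; rfl)
      (by rw [hs2, Store.write_ne _ (by decide), Store.write_self])
      (fun l i => by rw [hsame (by decide) (by decide)]; simp [hs, inputStore])
      (fun i j => by rw [hsame (by decide) (by decide)]; simp [hs, inputStore])
      (by rw [hsame (by decide) (by decide)]; rfl)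
      (fun i j => by rw [hsame (by decide) (by decide)]; simp [hs, inputStore])
      (fun i => by rw [hsame (by decide) (by decide)]; simp [hs, inputStore])
      (fun i => by rw [hsame (by decide) (by decide)]; simp [hs, inputStore])
      (by rw [hsame (by decide) (by decide)]; rfl)
      hx0 hxb hspan hAr hdet hε hε1 hBb' hBb hNε hN' hL2 hLdet
      (by rw [hsame (by decide) (by decide)]; exact hLx)
      (by rw [hsame (by decide) (by decide)]; exact hLA) hLd hLB hLN le_rfl hbdd
  refine ⟨A', 15 + t, s', .seq _ _ _ _ _ _ _ hexec (hexec'.mono (by omega)), ?_, hout, (rank_intMatrix_eq_iff A').2 hdet', fun i j => ?_, hnorm⟩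
  · have h1 : (d + n + 1) ^ 3 ≤ (d + n + r + 1) ^ C :=
      (Nat.pow_le_pow_left (by omega) 3).trans (Nat.pow_le_pow_right (by omega) (by omega))
    have h2 : 1 ≤ (d + n + r + 1) ^ C := Nat.one_le_pow _ _ (by omega)
    have h3 : 600000 * (d + n + r + 1) ^ C ≤ C * (d + n + r + 1) ^ C :=
      Nat.mul_le_mul_right _ hC
    omega
  · refine (hentry i j).trans (pow_le_pow_right₀ ?_ ?_)
    · rw [le_div_iff₀ hε]
      have : (1 : ℚ) ≤ d := by exact_mod_cast Fin.pos i
      linarith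
    · gcongr
      omega

end RatProg

/-- One program and one constant `C` work for all inputs.  The program receives `d`, `n`, the
points, the matrix, `ε`, and an estimate `B` of the range `2 ^ b` up to a factor of two; it receives
neither `b` nor `r`. -/
theorem theorem5p1 :
    ∃ (prog : RatProg.Prog) (C : ℕ),
      ∀ (d n b r B : ℕ) (x : Fin n → Fin d → ℤ) (A : Matrix (Fin d) (Fin d) ℤ) (ε : ℚ),
        (∀ k, x k ≠ 0) →
        (∀ k i, |x k i| ≤ 2 ^ b) →
        Submodule.span ℝ (Set.range fun k => intPoint (x k)) = ⊤ →
        (∀ i j, |A i j| ≤ 2 ^ (r * b)) →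
        (intMatrix A).rank = d →
        0 < ε → ε < 1 →
        B ≤ 2 ^ b → 2 ^ b ≤ 2 * B →
        ∃ (A' : Matrix (Fin d) (Fin d) ℤ) (t : ℕ) (s' : RatProg.Store),
          RatProg.Exec
            (RatProg.bitLength ε + C * (d + n + r + b + Nat.clog 2 ⌈ε⁻¹⌉₊ + 1) ^ C)
            prog (RatProg.inputStore B x A ε) t s' ∧
          t ≤ C * (d + n + r + 1) ^ C ∧
          RatProg.HasOutput s' A' ∧
          (intMatrix A').rank = d ∧
          (∀ i j, |(A' i j : ℚ)| ≤ ((d : ℚ) / ε) ^ (C * d ^ 3 * b)) ∧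
          ∀ k, ‖radialMap (intMatrix A) (intPoint (x k))
              - radialMap (intMatrix A') (intPoint (x k))‖ ≤ (ε : ℝ) := by
  refine ⟨RatProg.roundingProgram, 600000, ?_⟩
  intro d n b r B x A ε hx0 hxb hspan hAr hrank hε hε1 hBb' hBb
  exact RatProg.roundingProgram_spec le_rfl hx0 hxb hspan hAr hrank hε hε1 hBb' hBb
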